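/- Let $k$ be a field of characteristic $0$, let $G$ be an arbitrary group and let $H=kG$ be its group algebra, with its usual Hopf algebra structure (comultiplication $\Delta$, counit $\varepsilon$, antipode $S$; $g\in G$ is group-like). A modular crossed module over $H$ is a left $H$-module $M$ which is also a right $H$-comodule, via $\rho:M\to M\otimes H$, $\rho(m)=\sum m_{\langle 0\rangle}\otimes m_{\langle 1\rangle}$, such that for all $h\in H$, $m\in M$ $$\rho(hm)=\sum h_{(2)}m_{\langle 0\rangle}\otimes h_{(3)}m_{\langle 1\rangle}S(h_{(1)}),\qquad \sum m_{\langle 1\rangle}m_{\langle 0\rangle}=m .$$ To it one associates the cyclic object $Z_n(H,M)=H^{\otimes (n+1)}\otimes_H M$ ($H$ acting diagonally on the right of $H^{\otimes(n+1)}$) with face maps $(h^0,\dots,h^n)\otimes_H m\mapsto \varepsilon(h^i)(h^0,\dots,\widehat{h^i},\dots,h^n)\otimes_H m$, degeneracy maps $(h^0,\dots,h^n)\otimes_H m\mapsto (h^0,\dots,\Delta h^i,\dots,h^n)\otimes_H m$ and cyclic operator $(h^0,\dots,h^n)\otimes_H m\mapsto\sum (h^nm_{\langle 1\rangle},h^0,\dots,h^{n-1})\otimes_H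 m_{\langle 0\rangle}$. The cyclic homology $\mathrm{HC}_*(H,M)$ is the homology of the total complex of its Tsygan double complex. Let $t(G)\subseteq G$ be a set of representatives of the conjugacy classes of $G$, and let $t_f(G)$ be the set of those $x\in t(G)$ that have finite order. For $x\in G$ put $M_x=\{m\in M\mid \rho(m)=m\otimes x\}$, let $G_x$ be the centralizer of $x$ in $G$ and $\overline G_x=G_x/\langle x\rangle$; then $M_x$ is stable under $G_x$ and $x$ acts trivially on it, so that $M_x$ is a representation of $\overline G_x$ over $k$. Then for every modular crossed module $M$ over $kG$ and every $n\ge 0$ there is an isomorphism of $k$-vector spaces $$\mathrm{HC}_n(kG,M)\;\cong\;\Bigl(\bigoplus_{x\in t_f(G)}\ \bigoplus_{0\le 2i\le n}\mathrm H_{n-2i}(\overline G_x,M_x)\Bigr)\ \oplus\ \Bigl(\bigoplus_{x\in t(G)\setminus t_f(G)}\mathrm H_n(\overline G_x,M_x)\Bigr),$$ where $\mathrm H_*(\overline G_x,M_x)$ denotes group homology with coefficients. -/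

import Mathlib

open scoped TensorProduct DirectSum

set_option linter.unusedSectionVars false

universe u v w

noncomputable section

namespace CyclicHomology

/-- The part of the structure of a cyclic object in `k`-modules that enters the Tsygan double
complex: modules `Z₀, Z₁, …`, face maps `dᵢ : Zₙ₊₁ → Zₙ` for `0 ≤ i ≤ n + 1` and cyclic operators
`t : Zₙ → Zₙ`. Cyclic homology does not involve the degeneracy maps. -/
structure PrecyclicModule (k : Type u) [CommRing k] where
  obj : ℕ → Type v
  [addCommGroup : ∀ n, AddCommGroup (obj n)]
  [module : ∀ n, Module k (obj n)]
  d : ∀ n, Fin (n + 2) → obj (n + 1) →ₗ[k] obj n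
  t : ∀ n, Module.End k (obj n)
  d_comp_d : ∀ (n : ℕ) (i j : Fin (n + 2)), i ≤ j →
    d n i ∘ₗ d (n + 1) j.succ = d n j ∘ₗ d (n + 1) i.castSucc
  d_succ_comp_t : ∀ (n : ℕ) (i : Fin (n + 1)),
    d n i.succ ∘ₗ t (n + 1) = t n ∘ₗ d n i.castSucc
  d_zero_comp_t : ∀ n : ℕ, d n 0 ∘ₗ t (n + 1) = d n (Fin.last (n + 1))
  t_pow : ∀ n : ℕ, t n ^ (n + 1) = 1

attribute [instance] PrecyclicModule.addCommGroup PrecyclicModule.module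

namespace PrecyclicModule

variable {k : Type u} [CommRing k] (Z : PrecyclicModule.{u, v} k)

/-- The Hochschild differential `b = ∑_{i=0}^{n+1} (-1)^i dᵢ : Zₙ₊₁ → Zₙ`. -/
def b (n : ℕ) : Z.obj (n + 1) →ₗ[k] Z.obj n :=
  ∑ i : Fin (n + 2), (-1 : k) ^ (i : ℕ) • Z.d n i

/-- The acyclic differential `b' = ∑_{i=0}^{n} (-1)^i dᵢ : Zₙ₊₁ → Zₙ` (the last face is omitted). -/
def b' (n : ℕ) : Z.obj (n + 1) →ₗ[k] Z.obj n :=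
  ∑ i : Fin (n + 1), (-1 : k) ^ (i : ℕ) • Z.d n i.castSucc

/-- The signed cyclic operator `(-1)^n t` on `Zₙ`. -/
def sgnT (n : ℕ) : Module.End k (Z.obj n) := (-1 : k) ^ n • Z.t n

/-- The norm operator `N = ∑_{i=0}^{n} ((-1)^n t)^i` on `Zₙ`. -/
def norm (n : ℕ) : Module.End k (Z.obj n) := ∑ i ∈ Finset.range (n + 1), Z.sgnT n ^ i

/-- The vertical differential `CC_{p,q+1} → CC_{p,q}` of the Tsygan double complex, where
`CC_{p,q} = Z_q` for `p, q ≥ 0`: it is `b` in the even columns and `-b'` in the odd columns. -/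
def vert (p q : ℕ) : Z.obj (q + 1) →ₗ[k] Z.obj q := if Even p then Z.b q else -Z.b' q

/-- The horizontal differential `CC_{p,q} → CC_{p-1,q}`, `p ≥ 1`, of the Tsygan double complex:
it is `1 - (-1)^q t` for `p` odd and the norm operator for `p` even. -/
def horiz (p q : ℕ) : Z.obj q →ₗ[k] Z.obj q := if Even p then Z.norm q else 1 - Z.sgnT q

/-- The degree `n` part `⨁_{p+q=n} CC_{p,q}` of the total complex; the component with index `q`
is `CC_{n-q,q}`. -/
abbrev Tot (n : ℕ) : Type v := ∀ q : Fin (n + 1), Z.obj q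

/-- The differential of the total complex: its component in `CC_{n-q,q}` is the sum of the
vertical differential from `CC_{n-q,q+1}` and the horizontal one from `CC_{n+1-q,q}`. -/
def totD (n : ℕ) : Z.Tot (n + 1) →ₗ[k] Z.Tot n :=
  LinearMap.pi fun q : Fin (n + 1) =>
    Z.vert (n - q) q ∘ₗ LinearMap.proj (R := k) (φ := fun j : Fin (n + 2) => Z.obj j) q.succ +
      Z.horiz (n + 1 - q) q ∘ₗ
        LinearMap.proj (R := k) (φ := fun j : Fin (n + 2) => Z.obj j) q.castSucc

lemma sum_comp_sum_eq_zero {A B C : Type v} [AddCommGroup A] [Module k A] [AddCommGroup B]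
    [Module k B] [AddCommGroup C] [Module k C] (m : ℕ) (f : Fin (m + 1) → A →ₗ[k] B)
    (g : Fin m → B →ₗ[k] C)
    (h : ∀ i j : Fin m, i ≤ j → g i ∘ₗ f j.succ = g j ∘ₗ f i.castSucc) :
    (∑ j : Fin m, (-1 : k) ^ (j : ℕ) • g j) ∘ₗ (∑ i : Fin (m + 1), (-1 : k) ^ (i : ℕ) • f i) =
      0 := by
  have key : ∀ j : Fin m, ∑ i : Fin (m + 1), (-1 : k) ^ (j + i : ℕ) • (g j ∘ₗ f i) =
      (∑ i : Fin m, if i ≤ j then (-1 : k) ^ (j + i : ℕ) • (g j ∘ₗ f i.castSucc) else 0) +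
      ∑ i : Fin m, if j ≤ i then -((-1 : k) ^ (j + i : ℕ) • (g j ∘ₗ f i.succ)) else 0 := by
    intro j
    rw [Fin.sum_univ_succAbove _ j.castSucc]
    have hsplit : ∀ i : Fin m, (-1 : k) ^ (j + (j.castSucc.succAbove i : ℕ) : ℕ) •
        (g j ∘ₗ f (j.castSucc.succAbove i)) =
        (if i < j then (-1 : k) ^ (j + i : ℕ) • (g j ∘ₗ f i.castSucc) else 0) +
        (if j ≤ i then -((-1 : k) ^ (j + i : ℕ) • (g j ∘ₗ f i.succ)) else 0) := by
      intro i
      rcases lt_or_ge i j with hij | hij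
      · rw [Fin.succAbove_of_castSucc_lt _ _ (by simpa using hij), if_pos hij,
          if_neg (not_le.2 hij)]
        simp
      · rw [Fin.succAbove_of_le_castSucc _ _ (by simpa using hij), if_neg (not_lt.2 hij),
          if_pos hij]
        simp [pow_add, pow_succ]
    simp_rw [hsplit]
    rw [Finset.sum_add_distrib, ← add_assoc]
    congr 1
    have h2 : ∀ i : Fin m, (if i ≤ j then (-1 : k) ^ (j + i : ℕ) • (g j ∘ₗ f i.castSucc) else 0) =
        (if i = j then (-1 : k) ^ (j + i : ℕ) • (g j ∘ₗ f i.castSucc) else 0) +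
        (if i < j then (-1 : k) ^ (j + i : ℕ) • (g j ∘ₗ f i.castSucc) else 0) := by
      intro i
      rcases lt_trichotomy i j with hij | hij | hij
      · simp [hij, hij.le, hij.ne]
      · simp [hij]
      · simp [hij.ne', not_le.2 hij, not_lt.2 hij.le]
    simp_rw [h2]
    rw [Finset.sum_add_distrib]
    simp
  have : (∑ j : Fin m, (-1 : k) ^ (j : ℕ) • g j) ∘ₗ
      (∑ i : Fin (m + 1), (-1 : k) ^ (i : ℕ) • f i) =
      ∑ j : Fin m, ∑ i : Fin (m + 1), (-1 : k) ^ (j + i : ℕ) • (g j ∘ₗ f i) := by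
    ext x
    simp [LinearMap.sum_apply, pow_add, mul_smul, Finset.smul_sum]
  rw [this]
  simp_rw [key]
  rw [Finset.sum_add_distrib, Finset.sum_comm, ← Finset.sum_add_distrib]
  refine Finset.sum_eq_zero fun i _ => ?_
  rw [← Finset.sum_add_distrib]
  refine Finset.sum_eq_zero fun j _ => ?_
  by_cases hij : i ≤ j
  · rw [if_pos hij, if_pos hij, h i j hij, add_comm (j : ℕ)]
    simp
  · simp [hij]

lemma b_comp_b (n : ℕ) : Z.b n ∘ₗ Z.b (n + 1) = 0 :=
  sum_comp_sum_eq_zero (n + 2) (Z.d (n + 1)) (Z.d n) (Z.d_comp_d n)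

lemma b'_comp_b' (n : ℕ) : Z.b' n ∘ₗ Z.b' (n + 1) = 0 :=
  sum_comp_sum_eq_zero (n + 1) (fun i => Z.d (n + 1) i.castSucc) (fun i => Z.d n i.castSucc)
    fun i j hij => Z.d_comp_d n i.castSucc j.castSucc (by simpa using hij)

/-- The signed face maps `(-1)^i dᵢ`. -/
def sgnD (n : ℕ) (i : Fin (n + 2)) : Z.obj (n + 1) →ₗ[k] Z.obj n := (-1 : k) ^ (i : ℕ) • Z.d n i

lemma sgnT_pow (n : ℕ) : Z.sgnT n ^ (n + 1) = 1 := by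
  rw [sgnT, smul_pow, Z.t_pow, ← pow_mul, Even.neg_one_pow (Nat.even_mul_succ_self n), one_smul]

lemma sgnD_succ (n : ℕ) (i : Fin (n + 1)) :
    Z.sgnD n i.succ ∘ₗ Z.sgnT (n + 1) = Z.sgnT n ∘ₗ Z.sgnD n i.castSucc := by
  simp only [sgnD, sgnT, LinearMap.smul_comp, LinearMap.comp_smul, Z.d_succ_comp_t, smul_smul]
  congr 1
  simp only [Fin.val_succ, Fin.val_castSucc]
  ring

lemma sgnD_zero (n : ℕ) : Z.sgnD n 0 ∘ₗ Z.sgnT (n + 1) = Z.sgnD n (Fin.last (n + 1)) := by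
  simp [sgnD, sgnT, LinearMap.comp_smul, Z.d_zero_comp_t]

lemma b_eq (n : ℕ) : Z.b n = Z.b' n + Z.sgnD n (Fin.last (n + 1)) := by
  rw [b, Fin.sum_univ_castSucc]
  rfl

lemma b_comp_sub (n : ℕ) :
    Z.b n ∘ₗ (1 - Z.sgnT (n + 1)) = (1 - Z.sgnT n) ∘ₗ Z.b' n := by
  have h : Z.b n ∘ₗ Z.sgnT (n + 1) = Z.sgnD n (Fin.last (n + 1)) + Z.sgnT n ∘ₗ Z.b' n := by
    have : Z.b n = Z.sgnD n 0 + ∑ i : Fin (n + 1), Z.sgnD n i.succ := by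
      rw [b, Fin.sum_univ_succ]
      rfl
    rw [this, LinearMap.add_comp, Z.sgnD_zero]
    congr 1
    ext x
    have := fun i => LinearMap.congr_fun (Z.sgnD_succ n i) x
    simp only [LinearMap.comp_apply] at this
    simp only [LinearMap.comp_apply, LinearMap.sum_apply, this, b', map_sum]
    rfl
  rw [LinearMap.comp_sub, h, LinearMap.sub_comp, Z.b_eq]
  ext x
  simp only [LinearMap.sub_apply, LinearMap.add_apply, LinearMap.comp_apply, Module.End.one_apply]
  abel

lemma sgnD_eq (n : ℕ) (i : ℕ) (hi : i < n + 2) :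
    Z.sgnD n ⟨i, hi⟩ ∘ₗ (Z.sgnT (n + 1) ^ i) = (Z.sgnT n ^ i) ∘ₗ Z.sgnD n 0 := by
  induction i with
  | zero => simp; rfl
  | succ i ih =>
    have h := Z.sgnD_succ n ⟨i, by omega⟩
    have ih := ih (by omega)
    rw [pow_succ', pow_succ', Module.End.mul_eq_comp, ← LinearMap.comp_assoc]
    erw [h]
    rw [LinearMap.comp_assoc]
    erw [ih]
    rfl

lemma sgnT_comp_norm (n : ℕ) : Z.sgnT n * Z.norm n = Z.norm n := by
  have h := mul_geom_sum (Z.sgnT n) (n + 1)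
  rw [Z.sgnT_pow, sub_self, sub_mul, one_mul, sub_eq_zero] at h
  exact h

lemma norm_comp_sgnT (n : ℕ) : Z.norm n * Z.sgnT n = Z.norm n := by
  have h := geom_sum_mul (Z.sgnT n) (n + 1)
  rw [Z.sgnT_pow, sub_self, mul_sub, mul_one, sub_eq_zero] at h
  exact h

lemma pow_comp_norm (n i : ℕ) : Z.sgnT n ^ i * Z.norm n = Z.norm n := by
  induction i with
  | zero => simp
  | succ i ih => rw [pow_succ, mul_assoc, sgnT_comp_norm, ih]

lemma norm_comp_pow (n i : ℕ) : Z.norm n * Z.sgnT n ^ i = Z.norm n := by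
  induction i with
  | zero => simp
  | succ i ih => rw [pow_succ', ← mul_assoc, norm_comp_sgnT, ih]

lemma b'_comp_norm (n : ℕ) : Z.b' n ∘ₗ Z.norm (n + 1) = Z.norm n ∘ₗ Z.b n := by
  have h1 : Z.b' n ∘ₗ Z.norm (n + 1) = Z.norm n ∘ₗ Z.sgnD n 0 ∘ₗ Z.norm (n + 1) := by
    have : ∀ i : Fin (n + 1), Z.sgnD n i.castSucc ∘ₗ Z.norm (n + 1) =
        (Z.sgnT n ^ (i : ℕ)) ∘ₗ Z.sgnD n 0 ∘ₗ Z.norm (n + 1) := by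
      intro i
      conv_lhs => rw [← Z.pow_comp_norm (n + 1) i, Module.End.mul_eq_comp, ← LinearMap.comp_assoc]
      have := Z.sgnD_eq n i (by omega)
      erw [this]
      rfl
    have hb : Z.b' n = ∑ i : Fin (n + 1), Z.sgnD n i.castSucc := rfl
    have hn : Z.norm n = ∑ i : Fin (n + 1), Z.sgnT n ^ (i : ℕ) := by rw [norm, Finset.sum_range]
    rw [hb, hn]
    ext x
    have := fun i => LinearMap.congr_fun (this i) x
    simp only [LinearMap.comp_apply] at this
    simp only [LinearMap.comp_apply, LinearMap.sum_apply]
    exact Finset.sum_congr rfl fun i _ => this i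
  have h2 : Z.norm n ∘ₗ Z.b n = Z.norm n ∘ₗ Z.sgnD n 0 ∘ₗ Z.norm (n + 1) := by
    have : ∀ i : Fin (n + 2), Z.norm n ∘ₗ Z.sgnD n i =
        Z.norm n ∘ₗ Z.sgnD n 0 ∘ₗ (Z.sgnT (n + 1) ^ (n + 2 - i : ℕ)) := by
      intro i
      have h := Z.sgnD_eq n i i.2
      have e : Z.sgnD n i = (Z.sgnT n ^ (i : ℕ)) ∘ₗ Z.sgnD n 0 ∘ₗ
          (Z.sgnT (n + 1) ^ (n + 2 - i : ℕ)) := by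
        rw [← LinearMap.comp_assoc, ← h, LinearMap.comp_assoc, ← Module.End.mul_eq_comp, ← pow_add,
          Nat.add_sub_cancel' i.2.le, Z.sgnT_pow]
        rfl
      rw [e, ← LinearMap.comp_assoc, ← Module.End.mul_eq_comp, Z.norm_comp_pow]
    have hs : Z.norm (n + 1) = ∑ i : Fin (n + 2), Z.sgnT (n + 1) ^ (n + 2 - i : ℕ) := by
      have h0 := Z.norm_comp_sgnT (n + 1)
      rw [← h0, norm, Finset.sum_mul, ← Finset.sum_range_reflect, Finset.sum_range]
      refine Finset.sum_congr rfl fun i _ => ?_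
      rw [← pow_succ]
      congr 1
      omega
    have hb : Z.b n = ∑ i : Fin (n + 2), Z.sgnD n i := rfl
    rw [hb, hs]
    ext x
    have := fun i => LinearMap.congr_fun (this i) x
    simp only [LinearMap.comp_apply] at this
    simp only [LinearMap.comp_apply, LinearMap.sum_apply, map_sum]
    exact Finset.sum_congr rfl fun i _ => this i
  rw [h1, h2]

lemma vert_comp_vert (p q : ℕ) : Z.vert p q ∘ₗ Z.vert p (q + 1) = 0 := by
  by_cases hp : Even p <;> simp [vert, hp, LinearMap.neg_comp, LinearMap.comp_neg, b_comp_b, b'_comp_b']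

lemma horiz_comp_horiz (p q : ℕ) : Z.horiz p q ∘ₗ Z.horiz (p + 1) q = 0 := by
  by_cases hp : Even p
  · simp only [horiz, hp, Nat.even_add_one, not_true, if_true, if_false]
    rw [← Module.End.mul_eq_comp, mul_sub, mul_one, norm_comp_sgnT, sub_self]
  · simp only [horiz, hp, Nat.even_add_one, not_false_iff, if_true, if_false]
    rw [← Module.End.mul_eq_comp, sub_mul, one_mul, sgnT_comp_norm, sub_self]

lemma vert_comp_horiz (p q : ℕ) :
    Z.vert p q ∘ₗ Z.horiz (p + 1) (q + 1) + Z.horiz (p + 1) q ∘ₗ Z.vert (p + 1) q = 0 := by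
  by_cases hp : Even p
  · simp only [horiz, vert, hp, Nat.even_add_one, not_true, if_true, if_false]
    rw [b_comp_sub, LinearMap.comp_neg, add_neg_cancel]
  · simp only [horiz, vert, hp, Nat.even_add_one, not_false_iff, if_true, if_false]
    rw [← b'_comp_norm, LinearMap.neg_comp, neg_add_cancel]

lemma totD_comp_totD (n : ℕ) : Z.totD n ∘ₗ Z.totD (n + 1) = 0 := by
  refine LinearMap.ext fun x => ?_
  funext q
  obtain ⟨q, hq⟩ := q
  obtain ⟨p, rfl⟩ : ∃ p, n = p + q := ⟨n - q, by omega⟩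
  have e1 : p + q - q = p := by omega
  have e2 : p + q + 1 - q = p + 1 := by omega
  have e3 : p + q + 1 - (q + 1) = p := by omega
  have e4 : p + q + 1 + 1 - (q + 1) = p + 1 := by omega
  have e5 : p + q + 1 + 1 - q = p + 1 + 1 := by omega
  have h1 := LinearMap.congr_fun (Z.vert_comp_vert p q) (x ⟨q + 2, by omega⟩)
  have h2 := LinearMap.congr_fun (Z.horiz_comp_horiz (p + 1) q) (x ⟨q, by omega⟩)
  have h3 := LinearMap.congr_fun (Z.vert_comp_horiz p q) (x ⟨q + 1, by omega⟩)
  simp only [LinearMap.comp_apply, LinearMap.add_apply, LinearMap.zero_apply] at h1 h2 h3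
  simp only [totD, LinearMap.comp_apply, LinearMap.pi_apply, LinearMap.add_apply,
    LinearMap.proj_apply, map_add, Fin.succ_mk, Fin.castSucc_mk, e1, e2, e3, e4, e5,
    LinearMap.zero_apply, Pi.zero_apply]
  rw [h1, h2, zero_add, add_zero]
  exact h3

/-- The total complex of the Tsygan double complex. -/
def totalComplex : ChainComplex (ModuleCat.{v} k) ℕ :=
  ChainComplex.of (fun n => ModuleCat.of k (Z.Tot n)) (fun n => ModuleCat.ofHom (Z.totD n))
    fun n => by
      rw [← ModuleCat.ofHom_comp, Z.totD_comp_totD]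
      rfl

/-- Cyclic homology: the homology of the total complex of the Tsygan double complex. -/
def HC (n : ℕ) : ModuleCat.{v} k := Z.totalComplex.homology n

end PrecyclicModule

section Hopf

variable (k : Type u) [CommRing k] (H : Type v) [Ring H] [HopfAlgebra k H]

/-- The algebra `H^{⊗ n}`. -/
abbrev TPow (n : ℕ) : Type (max u v) := ⨂[k] _ : Fin n, H

variable {k H}

open WithConv in
/-- The map `H → H^{⊗ n}` that places an element in the tensor factor `i`, as an element of the
convolution algebra of linear maps from the coalgebra `H` to the algebra `H^{⊗ n}`. -/
def inj {n : ℕ} (i : Fin n) : WithConv (H →ₗ[k] TPow k H n) :=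
  toConv (PiTensorProduct.singleAlgHom (R := k) (A := fun _ : Fin n => H) i).toLinearMap

variable (k H) in
/-- The iterated comultiplication `H → H^{⊗ n}`, `h ↦ ∑ h₍₁₎ ⊗ ⋯ ⊗ h₍ₙ₎`, written as the
convolution product of the inclusions of `H` as first, second, …, last tensor factor. For `n = 0`
it is the counit. -/
def iterComul (n : ℕ) : H →ₗ[k] TPow k H n :=
  (List.ofFn fun i : Fin n => inj (k := k) (H := H) i).prod.ofConv

variable (k H) in
/-- The map `h¹ ⊗ ⋯ ⊗ hⁿ ↦ hⁿ ⊗ h¹ ⊗ ⋯ ⊗ hⁿ⁻¹`. -/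
def rot (n : ℕ) : TPow k H n →ₐ[k] TPow k H n :=
  PiTensorProduct.liftAlgHom
    ((PiTensorProduct.tprod k).domDomCongr (finRotate n).symm)
    (by rw [PiTensorProduct.one_def]; rfl)
    (fun x y => by
      simp only [MultilinearMap.domDomCongr_apply, PiTensorProduct.tprod_mul_tprod]
      rfl)

/-- The map `h⁰ ⊗ ⋯ ⊗ hⁿ ↦ ε(hⁱ) h⁰ ⊗ ⋯ ⊗ hⁿ` with `hⁱ` omitted on the right. -/
def face {n : ℕ} (i : Fin (n + 1)) : TPow k H (n + 1) →ₐ[k] TPow k H n :=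
  PiTensorProduct.liftAlgHom
    { toFun := fun h => Coalgebra.counit (R := k) (h i) •
        PiTensorProduct.tprod k fun j => h (i.succAbove j)
      map_update_add' := by
        intro _ m j x y
        rcases Fin.eq_self_or_eq_succAbove i j with rfl | ⟨j, rfl⟩
        · simp [add_smul]
        · have : ∀ z, (fun l => Function.update m (i.succAbove j) z (i.succAbove l)) =
              Function.update (fun l => m (i.succAbove l)) j z := fun z => by
            ext l
            simp [Function.update_apply]
          simp only [this, Function.update_of_ne (Fin.succAbove_ne i j).symm,
            MultilinearMap.map_update_add, smul_add]
      map_update_smul' := by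
        intro _ m j c x
        rcases Fin.eq_self_or_eq_succAbove i j with rfl | ⟨j, rfl⟩
        · simp [mul_smul]
        · have : ∀ z, (fun l => Function.update m (i.succAbove j) z (i.succAbove l)) =
              Function.update (fun l => m (i.succAbove l)) j z := fun z => by
            ext l
            simp [Function.update_apply]
          simp only [this, Function.update_of_ne (Fin.succAbove_ne i j).symm,
            MultilinearMap.map_update_smul]
          rw [smul_comm] }
    (by simp; rfl)
    (fun x y => by
      simp only [MultilinearMap.coe_mk, Pi.mul_apply, Bialgebra.counit_mul,
        PiTensorProduct.smul_tprod_mul_smul_tprod]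
      rfl)

lemma rot_tprod {n : ℕ} (h : Fin n → H) :
    rot k H n (PiTensorProduct.tprod k h) =
      PiTensorProduct.tprod k fun i => h ((finRotate n).symm i) := by
  rw [rot, PiTensorProduct.liftAlgHom_apply]
  exact PiTensorProduct.lift.tprod _

lemma face_tprod {n : ℕ} (i : Fin (n + 1)) (h : Fin (n + 1) → H) :
    face i (PiTensorProduct.tprod k h) = Coalgebra.counit (R := k) (h i) •
        PiTensorProduct.tprod k fun j => h (i.succAbove j) := by
  simp [face]

lemma inj_apply {n : ℕ} (i : Fin n) (h : H) :
    inj (k := k) i h = PiTensorProduct.tprod k (Pi.mulSingle i h) := by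
  simp [inj]

lemma rot_inj {n : ℕ} (i : Fin n) (h : H) :
    rot k H n (inj (k := k) i h) = inj (k := k) (finRotate n i) h := by
  rw [inj_apply, inj_apply, rot_tprod]
  congr 1
  ext j
  simp only [Pi.mulSingle_apply, Equiv.symm_apply_eq]

lemma face_inj_self {n : ℕ} (i : Fin (n + 1)) (h : H) :
    face i (inj (k := k) i h) = algebraMap k _ (Coalgebra.counit (R := k) h) := by
  rw [inj_apply, face_tprod, Algebra.algebraMap_eq_smul_one, PiTensorProduct.one_def]
  simp only [Pi.mulSingle_eq_same]
  congr 2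
  ext j
  simp [Fin.succAbove_ne]

lemma face_inj_succAbove {n : ℕ} (i : Fin (n + 1)) (j : Fin n) (h : H) :
    face i (inj (k := k) (i.succAbove j) h) = inj (k := k) j h := by
  rw [inj_apply, face_tprod, inj_apply]
  rw [Pi.mulSingle_eq_of_ne (Fin.succAbove_ne i j).symm, Bialgebra.counit_one, one_smul]
  congr 1
  ext l
  simp [Pi.mulSingle_apply]

lemma inj_mul {n : ℕ} (i : Fin n) (h h' : H) :
    inj (k := k) i (h * h') = inj (k := k) i h * inj (k := k) i h' := by
  rw [inj_apply, inj_apply, inj_apply, PiTensorProduct.tprod_mul_tprod, Pi.mulSingle_mul]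

lemma inj_commute {n : ℕ} {i j : Fin n} (hij : i ≠ j) (h h' : H) :
    Commute (inj (k := k) i h) (inj (k := k) j h') := by
  rw [inj_apply, inj_apply]
  exact Commute.tprod (Pi.mulSingle_commute hij _ _)

section Convolution

open WithConv

variable {A B : Type*} [Ring A] [Algebra k A] [Ring B] [Algebra k B]

/-- Postcomposition with an algebra map is multiplicative for convolution. -/
def postComp (φ : A →ₐ[k] B) : WithConv (H →ₗ[k] A) →* WithConv (H →ₗ[k] B) where
  toFun f := toConv (φ.toLinearMap ∘ₗ f.ofConv)
  map_one' := by
    ext x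
    simp [LinearMap.convOne_def]
  map_mul' f g := by
    rw [LinearMap.algHom_comp_convMul_distrib]

lemma postComp_apply (φ : A →ₐ[k] B) (f : WithConv (H →ₗ[k] A)) (h : H) :
    postComp φ f h = φ (f h) := rfl

lemma map_ofFn_prod (φ : A →ₐ[k] B) {n : ℕ} (f : Fin n → WithConv (H →ₗ[k] A)) (h : H) :
    φ ((List.ofFn f).prod h) = (List.ofFn fun i => postComp φ (f i)).prod h := by
  rw [← postComp_apply, map_list_prod, List.map_ofFn]
  rfl

lemma prod_ofFn_of_eq_one {G : Type*} [Monoid G] {n : ℕ} (f : Fin (n + 1) → G) (i : Fin (n + 1))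
    (hi : f i = 1) : (List.ofFn f).prod = (List.ofFn fun j => f (i.succAbove j)).prod := by
  induction n with
  | zero =>
    obtain rfl : i = 0 := Fin.fin_one_eq_zero i
    simp [hi]
  | succ n ih =>
    cases i using Fin.cases with
    | zero => rw [List.ofFn_succ, List.prod_cons, hi, one_mul]; simp
    | succ i =>
      rw [List.ofFn_succ, List.prod_cons, ih (fun j => f j.succ) i hi,
        List.ofFn_succ (f := fun j => f (i.succ.succAbove j)), List.prod_cons]
      simp

/-- An element commutes with all values of a convolution product if it commutes with all values
of the factors. -/
lemma commute_prod (a : A) (l : List (WithConv (H →ₗ[k] A)))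
    (hl : ∀ f ∈ l, ∀ h, Commute a (f h)) (h : H) : Commute a (l.prod h) := by
  induction l generalizing h with
  | nil =>
    rw [List.prod_nil, LinearMap.convOne_apply]
    exact (Algebra.commutes _ _).symm
  | cons f l ih =>
    rw [List.prod_cons, (Coalgebra.Repr.arbitrary k h).convMul_apply]
    refine Commute.sum_right _ _ _ fun i _ => ?_
    exact (hl f (by simp) _).mul_right (ih (fun g hg => hl g (by simp [hg])) _)

end Convolution

open WithConv

lemma iterComul_eq (n : ℕ) (h : H) :
    iterComul k H n h = (List.ofFn fun i : Fin n => inj (k := k) (H := H) i).prod h := rfl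

lemma face_iterComul {n : ℕ} (i : Fin (n + 1)) (h : H) :
    face i (iterComul k H (n + 1) h) = iterComul k H n h := by
  rw [iterComul_eq, iterComul_eq, map_ofFn_prod, prod_ofFn_of_eq_one _ i]
  · congr 4
    ext j x
    exact face_inj_succAbove i j x
  · ext x
    exact face_inj_self i x

variable (k H) in
/-- The map `h ↦ 1 ⊗ h₍₁₎ ⊗ ⋯ ⊗ h₍ₙ₎`. -/
def tailComul (n : ℕ) : WithConv (H →ₗ[k] TPow k H (n + 1)) :=
  (List.ofFn fun i : Fin n => inj (k := k) (H := H) i.succ).prod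

lemma toConv_iterComul (n : ℕ) :
    toConv (iterComul k H (n + 1)) = inj (k := k) (H := H) 0 * tailComul k H n := by
  rw [iterComul, toConv_ofConv, List.ofFn_succ, List.prod_cons]
  rfl

lemma finRotate_castSucc {n : ℕ} (i : Fin n) : finRotate (n + 1) i.castSucc = i.succ := by
  simp

lemma rot_iterComul (n : ℕ) (h : H) :
    rot k H (n + 1) (iterComul k H (n + 1) h) = (tailComul k H n * inj (k := k) (H := H) (0 : Fin (n + 1)) :
      WithConv (H →ₗ[k] TPow k H (n + 1))) h := by
  rw [iterComul_eq, map_ofFn_prod, List.ofFn_succ', List.concat_eq_append, List.prod_append,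
    List.prod_singleton, tailComul]
  have h1 : ∀ i : Fin n, postComp (rot k H (n + 1)) (inj i.castSucc) = inj i.succ := fun i => by
    ext x
    rw [postComp_apply, rot_inj, finRotate_castSucc]
  have h2 : postComp (rot k H (n + 1)) (inj (Fin.last n)) = inj 0 := by
    ext x
    rw [postComp_apply, rot_inj, finRotate_last]
  simp only [h1, h2]

lemma inj_zero_commute_tailComul (n : ℕ) (h h' : H) :
    Commute (inj (k := k) (0 : Fin (n + 1)) h) (tailComul k H n h') := by
  refine commute_prod _ _ (fun f hf x => ?_) _
  rw [List.mem_ofFn] at hf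
  obtain ⟨i, rfl⟩ := hf
  exact inj_commute (Fin.succ_ne_zero i).symm _ _

lemma antipode_mul_iterComul (n : ℕ) :
    toConv ((inj (k := k) (0 : Fin (n + 1))).ofConv ∘ₗ HopfAlgebra.antipode k (A := H)) *
      toConv (iterComul k H (n + 1)) = tailComul k H n := by
  have : toConv ((inj (k := k) (0 : Fin (n + 1))).ofConv ∘ₗ HopfAlgebra.antipode k (A := H)) *
      inj (k := k) (0 : Fin (n + 1)) = 1 := by
    have h := congrArg (postComp (PiTensorProduct.singleAlgHom (R := k)
      (A := fun _ : Fin (n + 1) => H) 0)) (LinearMap.antipode_mul_id (R := k) (C := H))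
    rw [map_mul, map_one] at h
    exact h
  rw [toConv_iterComul, ← mul_assoc, this, one_mul]

variable (k H) in
/-- The linear map `h₁ ⊗ (h₂ ⊗ h₃) ↦ (m ⊗ x ↦ h₂m ⊗ h₃xS(h₁))`. -/
def crossAct (M : Type w) [AddCommGroup M] [Module k M] [Module H M] [IsScalarTower k H M] :
    H ⊗[k] (H ⊗[k] H) →ₗ[k] Module.End k (M ⊗[k] H) :=
  LinearMap.mul' k (Module.End k (M ⊗[k] H)) ∘ₗ
    TensorProduct.map
      (LinearMap.lTensorHom M ∘ₗ (LinearMap.mul k H).flip ∘ₗ HopfAlgebra.antipode k)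
      (LinearMap.mul' k (Module.End k (M ⊗[k] H)) ∘ₗ
        TensorProduct.map (LinearMap.rTensorHom H ∘ₗ (Algebra.lsmul k k M).toLinearMap)
          (LinearMap.lTensorHom M ∘ₗ LinearMap.mul k H))

lemma crossAct_apply {M : Type w} [AddCommGroup M] [Module k M] [Module H M] [IsScalarTower k H M]
    (a b c x : H) (m : M) :
    crossAct k H M (a ⊗ₜ (b ⊗ₜ c)) (m ⊗ₜ x) =
      (b • m) ⊗ₜ (c * x * HopfAlgebra.antipode k a) := by
  simp [crossAct]

variable (k H) in
/-- The linear map `M ⊗ H → M`, `m ⊗ h ↦ hm`. -/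
def actMap (M : Type w) [AddCommGroup M] [Module k M] [Module H M] [IsScalarTower k H M] :
    M ⊗[k] H →ₗ[k] M :=
  TensorProduct.lift (Algebra.lsmul k k M : H →ₐ[k] Module.End k M).toLinearMap.flip

variable (k H) in
/-- A crossed module `M` over the Hopf algebra `H`: a left `H`-module which is a right
`H`-comodule through `ρ : M → M ⊗ H`, `ρ(m) = ∑ m₍₀₎ ⊗ m₍₁₎`, such that
`ρ(hm) = ∑ h₍₂₎m₍₀₎ ⊗ h₍₃₎m₍₁₎S(h₍₁₎)`. -/
structure CrossedModule (M : Type w) [AddCommGroup M] [Module k M] [Module H M]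
    [IsScalarTower k H M] where
  coact : M →ₗ[k] M ⊗[k] H
  coassoc : (TensorProduct.assoc k M H H).toLinearMap ∘ₗ coact.rTensor H ∘ₗ coact =
    (Coalgebra.comul (R := k) (A := H)).lTensor M ∘ₗ coact
  counit : (Coalgebra.counit (R := k) (A := H)).lTensor M ∘ₗ coact =
    (TensorProduct.mk k M k).flip 1
  coact_smul : ∀ (h : H) (m : M), coact (h • m) =
    crossAct k H M ((Coalgebra.comul (R := k) (A := H)).lTensor H (Coalgebra.comul h)) (coact m)

variable (k H) in
/-- A crossed module is modular if `∑ m₍₁₎m₍₀₎ = m` for all `m`. -/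
structure ModularCrossedModule (M : Type w) [AddCommGroup M] [Module k M] [Module H M]
    [IsScalarTower k H M] extends CrossedModule k H M where
  modular : ∀ m : M, actMap k H M (coact m) = m

variable (M : Type w) [AddCommGroup M] [Module k M] [Module H M] [IsScalarTower k H M]

variable (k H) in
/-- The relations `(h¹h₍₁₎ ⊗ ⋯ ⊗ hⁿh₍ₙ₎) ⊗ m = (h¹ ⊗ ⋯ ⊗ hⁿ) ⊗ hm` that define the tensor product
over `H` of `H^{⊗ n}`, with its diagonal right `H`-module structure, and `M`. -/
def balRel (n : ℕ) : Submodule k (TPow k H n ⊗[k] M) :=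
  Submodule.span k {z | ∃ (u : TPow k H n) (h : H) (m : M),
    z = (u * iterComul k H n h) ⊗ₜ[k] m - u ⊗ₜ[k] (h • m)}

variable (k H) in
/-- The tensor product `H^{⊗ n} ⊗_H M`. -/
abbrev Bal (n : ℕ) : Type (max u v w) := (TPow k H n ⊗[k] M) ⧸ balRel k H M n

variable {M}

lemma mk_balanced {n : ℕ} (u : TPow k H n) (h : H) (m : M) :
    (balRel k H M n).mkQ ((u * iterComul k H n h) ⊗ₜ m) = (balRel k H M n).mkQ (u ⊗ₜ (h • m)) := by
  rw [← sub_eq_zero, ← map_sub, Submodule.mkQ_apply, Submodule.Quotient.mk_eq_zero]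
  exact Submodule.subset_span ⟨u, h, m, rfl⟩

variable (M) in
lemma face_balRel {n : ℕ} (i : Fin (n + 1)) : balRel k H M (n + 1) ≤
    (balRel k H M n).comap ((face (k := k) (H := H) i).toLinearMap.rTensor M) := by
  refine Submodule.span_le.2 ?_
  rintro _ ⟨u, h, m, rfl⟩
  refine Submodule.subset_span ⟨face i u, h, m, ?_⟩
  simp [face_iterComul]

variable (k H M) in
/-- The face map `(h⁰ ⊗ ⋯ ⊗ hⁿ) ⊗_H m ↦ ε(hⁱ)(h⁰ ⊗ ⋯ ⊗ hⁿ) ⊗_H m` with `hⁱ` omitted on the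
right. -/
def faceZ {n : ℕ} (i : Fin (n + 1)) : Bal k H M (n + 1) →ₗ[k] Bal k H M n :=
  (balRel k H M (n + 1)).mapQ (balRel k H M n) ((face i).toLinearMap.rTensor M) (face_balRel M i)

/-- For `f : H → H^{⊗ n}` and `v` in `H^{⊗ n}`, the map `m ⊗ c ↦ v f(c) ⊗ m`. -/
def contr {n : ℕ} (f : H →ₗ[k] TPow k H n) (v : TPow k H n) :
    M ⊗[k] H →ₗ[k] TPow k H n ⊗[k] M :=
  (TensorProduct.comm k M (TPow k H n)).toLinearMap ∘ₗ
    LinearMap.lTensor M (LinearMap.mulLeft k v ∘ₗ f)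

lemma contr_tmul {n : ℕ} (f : H →ₗ[k] TPow k H n) (v : TPow k H n) (m : M) (c : H) :
    contr f v (m ⊗ₜ c) = (v * f c) ⊗ₜ m := by
  simp [contr]

namespace CrossedModule

variable (C : CrossedModule k H M)

/-- The map `(h⁰ ⊗ ⋯ ⊗ hⁿ) ⊗ m ↦ ∑ (hⁿm₍₁₎ ⊗ h⁰ ⊗ ⋯ ⊗ hⁿ⁻¹) ⊗ m₍₀₎`. -/
def tau (n : ℕ) : TPow k H (n + 1) ⊗[k] M →ₗ[k] TPow k H (n + 1) ⊗[k] M :=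
  LinearMap.rTensor M (LinearMap.mul' k (TPow k H (n + 1)) ∘ₗ
      TensorProduct.map (rot k H (n + 1)).toLinearMap (inj (k := k) (0 : Fin (n + 1))).ofConv) ∘ₗ
    (TensorProduct.assoc k (TPow k H (n + 1)) H M).symm.toLinearMap ∘ₗ
    LinearMap.lTensor (TPow k H (n + 1)) ((TensorProduct.comm k M H).toLinearMap ∘ₗ C.coact)

lemma tau_tmul (n : ℕ) (u : TPow k H (n + 1)) (m : M) :
    C.tau n (u ⊗ₜ m) = contr (inj (k := k) (0 : Fin (n + 1))).ofConv (rot k H (n + 1) u)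
      (C.coact m) := by
  simp only [tau, LinearMap.comp_apply, LinearMap.lTensor_tmul]
  generalize C.coact m = z
  induction z with
  | zero => simp
  | add x y hx hy => simp only [map_add, TensorProduct.tmul_add, hx, hy]
  | tmul m c => simp [contr_tmul]

/-- The map `(h₁ ⊗ h₂) ⊗ h₃ ↦ (1 ⊗ ⋯ ⊗ h₃c ⊗ ⋯)(S(h₁) ⊗ 1 ⊗ ⋯)Δ(h₂)`. -/
def aux (n : ℕ) (c : H) : (H ⊗[k] H) ⊗[k] H →ₗ[k] TPow k H (n + 1) :=
  TensorProduct.lift ((LinearMap.mul k (TPow k H (n + 1))).flip ∘ₗ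
      LinearMap.mulLeft k (inj (k := k) (0 : Fin (n + 1)) c)) ∘ₗ
    TensorProduct.map (LinearMap.mul' k (TPow k H (n + 1)) ∘ₗ
      TensorProduct.map ((inj (k := k) (0 : Fin (n + 1))).ofConv ∘ₗ HopfAlgebra.antipode k)
        (iterComul k H (n + 1))) (inj (k := k) (0 : Fin (n + 1))).ofConv

lemma aux_tmul (n : ℕ) (c x y z : H) : aux (k := k) n c ((x ⊗ₜ y) ⊗ₜ z) =
    inj (k := k) 0 z * (inj (k := k) 0 c * (inj (k := k) 0 (HopfAlgebra.antipode k x) *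
      iterComul k H (n + 1) y)) := by
  simp [aux]

lemma aux_comul (n : ℕ) (c h : H) :
    aux (k := k) n c ((Coalgebra.comul (R := k) (A := H)).rTensor H (Coalgebra.comul h)) =
      rot k H (n + 1) (iterComul k H (n + 1) h) * inj (k := k) 0 c := by
  have h1 := congrArg WithConv.ofConv (antipode_mul_iterComul (k := k) (H := H) n)
  rw [LinearMap.convMul_def] at h1
  simp only at h1
  have h2 : aux (k := k) n c ∘ₗ (Coalgebra.comul (R := k) (A := H)).rTensor H =
      LinearMap.mulRight k (inj (k := k) 0 c) ∘ₗ LinearMap.mul' k (TPow k H (n + 1)) ∘ₗ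
        TensorProduct.map (tailComul k H n).ofConv
          (inj (k := k) (0 : Fin (n + 1))).ofConv := by
    rw [aux, LinearMap.comp_assoc, LinearMap.map_comp_rTensor, LinearMap.comp_assoc, h1]
    refine TensorProduct.ext' fun x y => ?_
    simp only [LinearMap.comp_apply, TensorProduct.map_tmul, TensorProduct.lift.tmul,
      LinearMap.flip_apply, LinearMap.mul_apply', LinearMap.mulLeft_apply, LinearMap.mul'_apply,
      LinearMap.mulRight_apply]
    have c1 := inj_zero_commute_tailComul (k := k) n y x
    have c2 := inj_zero_commute_tailComul (k := k) n c x
    rw [c2.eq, ← mul_assoc, c1.eq]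
  rw [rot_iterComul]
  exact LinearMap.congr_fun h2 (Coalgebra.comul h)

lemma mk_contr_crossAct (n : ℕ) (v : TPow k H (n + 1)) (m : M) (c : H)
    (w : (H ⊗[k] H) ⊗[k] H) :
    (balRel k H M (n + 1)).mkQ (contr (inj (k := k) (0 : Fin (n + 1))).ofConv v
      (crossAct k H M (TensorProduct.assoc k H H H w) (m ⊗ₜ c))) =
      (balRel k H M (n + 1)).mkQ ((v * aux (k := k) n c w) ⊗ₜ m) := by
  induction w with
  | zero => simp
  | add x y hx hy =>
    simp only [map_add, LinearMap.add_apply, mul_add, TensorProduct.add_tmul, hx, hy]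
  | tmul xy z =>
    induction xy with
    | zero => simp
    | add x y hx hy =>
      simp only [map_add, LinearMap.add_apply, mul_add, TensorProduct.add_tmul, hx, hy]
    | tmul x y =>
      rw [TensorProduct.assoc_tmul, crossAct_apply, contr_tmul, ← mk_balanced, aux_tmul]
      have : (inj (k := k) (0 : Fin (n + 1))).ofConv (z * c * HopfAlgebra.antipode k x) = _ :=
        inj_mul _ _ _
      rw [this, inj_mul]
      simp only [mul_assoc]

lemma tau_balRel (n : ℕ) :
    balRel k H M (n + 1) ≤ (balRel k H M (n + 1)).comap (C.tau n) := by
  refine Submodule.span_le.2 ?_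
  rintro _ ⟨u, h, m, rfl⟩
  have key : ∀ z : M ⊗[k] H, (balRel k H M (n + 1)).mkQ
      (contr (inj (k := k) (0 : Fin (n + 1))).ofConv
        (rot k H (n + 1) u * rot k H (n + 1) (iterComul k H (n + 1) h)) z) =
      (balRel k H M (n + 1)).mkQ (contr (inj (k := k) (0 : Fin (n + 1))).ofConv
        (rot k H (n + 1) u) (crossAct k H M
          ((Coalgebra.comul (R := k) (A := H)).lTensor H (Coalgebra.comul h)) z)) := by
    intro z
    induction z with
    | zero => simp
    | add x y hx hy => simp only [map_add, hx, hy]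
    | tmul m c =>
      rw [← Coalgebra.coassoc_apply, mk_contr_crossAct, aux_comul, contr_tmul, mul_assoc]
  change C.tau n _ ∈ balRel k H M (n + 1)
  rw [← Submodule.Quotient.mk_eq_zero, ← Submodule.mkQ_apply, map_sub, map_sub, tau_tmul,
    tau_tmul, C.coact_smul, map_mul, key, sub_self]

/-- The cyclic operator `(h⁰ ⊗ ⋯ ⊗ hⁿ) ⊗_H m ↦ ∑ (hⁿm₍₁₎ ⊗ h⁰ ⊗ ⋯ ⊗ hⁿ⁻¹) ⊗_H m₍₀₎`. -/
def tauZ (n : ℕ) : Module.End k (Bal k H M (n + 1)) :=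
  (balRel k H M (n + 1)).mapQ (balRel k H M (n + 1)) (C.tau n) (C.tau_balRel n)

end CrossedModule

section Identities

lemma face_comp_face {n : ℕ} (i j : Fin (n + 2)) (hij : i ≤ j) :
    (face (k := k) (H := H) i).comp (face j.succ) = (face j).comp (face i.castSucc) := by
  refine AlgHom.toLinearMap_injective (PiTensorProduct.ext (MultilinearMap.ext fun h => ?_))
  simp only [LinearMap.compMultilinearMap_apply, AlgHom.toLinearMap_apply, AlgHom.comp_apply,
    face_tprod, map_smul, smul_smul]
  have h1 : j.succ.succAbove i = i.castSucc :=
    Fin.succAbove_of_castSucc_lt _ _ (by rw [Fin.lt_def, Fin.le_def] at *; simp; omega)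
  have h2 : i.castSucc.succAbove j = j.succ :=
    Fin.succAbove_of_le_castSucc _ _ (by rw [Fin.le_def] at *; simpa using hij)
  rw [h1, h2, mul_comm]
  congr 2
  ext l
  congr 1
  simp only [Fin.succAbove, Fin.ext_iff, Fin.lt_def, Fin.le_def] at *
  split_ifs <;> simp at * <;> omega

lemma face_succ_rot {n : ℕ} (i : Fin (n + 1)) :
    (face (k := k) (H := H) i.succ).comp (rot k H (n + 2)) =
      (rot k H (n + 1)).comp (face i.castSucc) := by
  refine AlgHom.toLinearMap_injective (PiTensorProduct.ext (MultilinearMap.ext fun h => ?_))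
  simp only [LinearMap.compMultilinearMap_apply, AlgHom.toLinearMap_apply, AlgHom.comp_apply,
    face_tprod, map_smul, rot_tprod]
  have h1 : (finRotate (n + 2)).symm i.succ = i.castSucc := by
    rw [Equiv.symm_apply_eq, finRotate_castSucc]
  rw [h1]
  congr 2
  ext l
  congr 1
  rw [Equiv.symm_apply_eq]
  obtain ⟨l, rfl⟩ := (finRotate (n + 1)).surjective l
  rw [Equiv.symm_apply_apply]
  induction l using Fin.lastCases with
  | last =>
    rw [finRotate_last, Fin.succ_succAbove_zero]
    have : i.castSucc.succAbove (Fin.last n) = Fin.last (n + 1) := by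
      rw [Fin.succAbove_of_le_castSucc _ _ (by rw [Fin.le_def]; simp; omega), Fin.succ_last]
    rw [this, finRotate_last]
  | cast l =>
    rw [finRotate_castSucc, Fin.succ_succAbove_succ, Fin.castSucc_succAbove_castSucc,
      finRotate_castSucc]

lemma face_zero_rot {n : ℕ} :
    (face (k := k) (H := H) (0 : Fin (n + 1))).comp (rot k H (n + 1)) = face (Fin.last n) := by
  refine AlgHom.toLinearMap_injective (PiTensorProduct.ext (MultilinearMap.ext fun h => ?_))
  simp only [LinearMap.compMultilinearMap_apply, AlgHom.toLinearMap_apply, AlgHom.comp_apply,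
    face_tprod, rot_tprod]
  have h1 : (finRotate (n + 1)).symm 0 = Fin.last n := by
    rw [Equiv.symm_apply_eq, finRotate_last]
  rw [h1]
  congr 2
  ext l
  congr 1
  rw [Equiv.symm_apply_eq, Fin.succAbove_zero, Fin.succAbove_last, finRotate_castSucc]

lemma face_succ_inj_zero {n : ℕ} (i : Fin (n + 1)) (c : H) :
    face (k := k) i.succ (inj (k := k) 0 c) = inj (k := k) 0 c := by
  have := face_inj_succAbove (k := k) i.succ 0 c
  rwa [Fin.succ_succAbove_zero] at this

/-- The first `j` factors in the iterated comultiplication, inside `H^{⊗ (n+1)}`. -/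
def partComul (n j : ℕ) (hj : j ≤ n + 1) : WithConv (H →ₗ[k] TPow k H (n + 1)) :=
  (List.ofFn fun i : Fin j => inj (k := k) (H := H) (Fin.castLE hj i)).prod

lemma rot_partComul (n j : ℕ) (hj : j + 1 ≤ n + 1) (h : H) :
    rot k H (n + 1) (partComul (k := k) n j (by omega) h) =
      (List.ofFn fun i : Fin j => inj (k := k) (H := H) (Fin.castLE hj i.succ)).prod h := by
  rw [partComul, map_ofFn_prod]
  have : ∀ i : Fin j, postComp (rot k H (n + 1)) (inj (Fin.castLE (by omega) i)) =
      inj (Fin.castLE hj i.succ) := fun i => by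
    ext x
    rw [postComp_apply, rot_inj]
    congr 1
    have e : Fin.castLE (by omega) i = (⟨i, by omega⟩ : Fin n).castSucc := rfl
    rw [e, finRotate_castSucc]
    rfl
  simp only [this]

lemma partComul_succ (n j : ℕ) (hj : j + 1 ≤ n + 1) :
    LinearMap.mul' k (TPow k H (n + 1)) ∘ₗ (TensorProduct.comm k _ _).toLinearMap ∘ₗ
      TensorProduct.map (inj (k := k) (H := H) (0 : Fin (n + 1))).ofConv
        ((rot k H (n + 1)).toLinearMap ∘ₗ (partComul (k := k) n j (by omega)).ofConv) ∘ₗ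
        Coalgebra.comul = (partComul (k := k) n (j + 1) hj).ofConv := by
  conv_rhs => rw [partComul, List.ofFn_succ, List.prod_cons, LinearMap.convMul_def]
  simp only
  rw [← LinearMap.comp_assoc, ← LinearMap.comp_assoc, ← LinearMap.comp_assoc]
  congr 1
  refine TensorProduct.ext' fun x y => ?_
  simp only [LinearMap.comp_apply, TensorProduct.map_tmul, LinearEquiv.coe_coe,
    TensorProduct.comm_tmul, LinearMap.mul'_apply, AlgHom.toLinearMap_apply]
  rw [rot_partComul n j hj]
  refine (commute_prod (k := k) (H := H) _ _ (fun f hf z => ?_) y).symm.eq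
  rw [List.mem_ofFn] at hf
  obtain ⟨i, rfl⟩ := hf
  exact inj_commute (by rw [Ne, Fin.ext_iff]; simp) _ _

lemma rot_pow (n : ℕ) (u : TPow k H (n + 1)) : (rot k H (n + 1))^[n + 1] u = u := by
  have h1 : ∀ (j : ℕ) (h : Fin (n + 1) → H), (rot k H (n + 1))^[j] (PiTensorProduct.tprod k h) =
      PiTensorProduct.tprod k fun i => h (((finRotate (n + 1)).symm ^ j) i) := by
    intro j
    induction j with
    | zero => intro h; rfl
    | succ j ih =>
      intro h
      rw [Function.iterate_succ_apply, rot_tprod, ih]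
      congr 1
      ext i
      rw [pow_succ', Equiv.Perm.mul_apply]
  have h2 : (finRotate (n + 1)).symm ^ (n + 1) = 1 := by
    have h3 : ∀ (j : ℕ) (i : Fin (n + 1)),
        (((finRotate (n + 1)) ^ j) i : ℕ) = (i + j) % (n + 1) := by
      intro j i
      induction j with
      | zero => simp [Nat.mod_eq_of_lt i.2]
      | succ j ih =>
        rw [pow_succ', Equiv.Perm.mul_apply, finRotate_apply, Fin.val_add, ih]
        simp [add_assoc]
    have h4 : (finRotate (n + 1)) ^ (n + 1) = 1 := by
      ext i
      rw [h3]
      simp [Nat.mod_eq_of_lt i.2]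
    change (finRotate (n + 1))⁻¹ ^ (n + 1) = 1
    rw [inv_pow, h4, inv_one]
  induction u using PiTensorProduct.induction_on with
  | smul_tprod r h =>
    have : ∀ j x, (rot k H (n + 1))^[j] (r • x) = r • (rot k H (n + 1))^[j] x := by
      intro j
      induction j with
      | zero => intro x; rfl
      | succ j ih => intro x; rw [Function.iterate_succ_apply, map_smul, ih]; rfl
    rw [this, h1, h2]
    rfl
  | add x y hx hy =>
    have : ∀ j x y, (rot k H (n + 1))^[j] (x + y) =
        (rot k H (n + 1))^[j] x + (rot k H (n + 1))^[j] y := by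
      intro j
      induction j with
      | zero => intro x y; rfl
      | succ j ih => intro x y; rw [Function.iterate_succ_apply, map_add, ih]; rfl
    rw [this, hx, hy]

namespace CrossedModule

variable (C : CrossedModule k H M)

lemma tau_contr (n j : ℕ) (hj : j + 1 ≤ n + 1) (v : TPow k H (n + 1)) (m : M) :
    C.tau n (contr (partComul (k := k) n j (by omega)).ofConv v (C.coact m)) =
      contr (partComul (k := k) n (j + 1) hj).ofConv (rot k H (n + 1) v) (C.coact m) := by
  let K : H ⊗[k] H →ₗ[k] TPow k H (n + 1) :=
    LinearMap.mul' k (TPow k H (n + 1)) ∘ₗ (TensorProduct.comm k _ _).toLinearMap ∘ₗ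
      TensorProduct.map (inj (k := k) (H := H) (0 : Fin (n + 1))).ofConv
        ((rot k H (n + 1)).toLinearMap ∘ₗ (partComul (k := k) n j (by omega)).ofConv)
  let G : M ⊗[k] (H ⊗[k] H) →ₗ[k] TPow k H (n + 1) ⊗[k] M :=
    (TensorProduct.comm k M (TPow k H (n + 1))).toLinearMap ∘ₗ
      LinearMap.lTensor M (LinearMap.mulLeft k (rot k H (n + 1) v) ∘ₗ K)
  have h1 : ∀ z : M ⊗[k] H, C.tau n (contr (partComul (k := k) n j (by omega)).ofConv v z) =
      G (TensorProduct.assoc k M H H (C.coact.rTensor H z)) := by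
    intro z
    induction z with
    | zero => simp
    | add x y hx hy => simp only [map_add, hx, hy]
    | tmul m c =>
      rw [contr_tmul, tau_tmul, LinearMap.rTensor_tmul]
      generalize C.coact m = z
      induction z with
      | zero => simp
      | add x y hx hy => simp only [map_add, TensorProduct.add_tmul, hx, hy]
      | tmul m a => simp [contr_tmul, G, K, mul_assoc]
  have h2 : ∀ z : M ⊗[k] H, G ((Coalgebra.comul (R := k) (A := H)).lTensor M z) =
      contr (partComul (k := k) n (j + 1) hj).ofConv (rot k H (n + 1) v) z := by
    intro z
    induction z with
    | zero => simp
    | add x y hx hy => simp only [map_add, hx, hy]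
    | tmul m c =>
      have := LinearMap.congr_fun (partComul_succ (k := k) (H := H) n j hj) c
      rw [LinearMap.lTensor_tmul, contr_tmul, ← this]
      simp [G, K]
  have h3 := LinearMap.congr_fun C.coassoc m
  rw [h1, ← h2]
  exact congrArg G h3

lemma tau_iterate (n j : ℕ) (hj : j ≤ n + 1) (u : TPow k H (n + 1)) (m : M) :
    (C.tau n)^[j] (u ⊗ₜ m) =
      contr (partComul (k := k) n j hj).ofConv ((rot k H (n + 1))^[j] u) (C.coact m) := by
  induction j with
  | zero =>
    have h := LinearMap.congr_fun C.counit m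
    simp only [LinearMap.comp_apply, LinearMap.flip_apply, TensorProduct.mk_apply] at h
    have h1 : ∀ z : M ⊗[k] H, contr (partComul (k := k) n 0 hj).ofConv u z =
        (TensorProduct.comm k M (TPow k H (n + 1))) (LinearMap.lTensor M
          (LinearMap.mulLeft k u ∘ₗ Algebra.linearMap k _)
          ((Coalgebra.counit (R := k) (A := H)).lTensor M z)) := by
      intro z
      induction z with
      | zero => simp
      | add x y hx hy => simp only [map_add, hx, hy]
      | tmul m c =>
        rw [contr_tmul, LinearMap.lTensor_tmul, LinearMap.lTensor_tmul, TensorProduct.comm_tmul]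
        rfl
    rw [Function.iterate_zero, Function.iterate_zero, id, id, h1, h]
    simp
  | succ j ih =>
    rw [Function.iterate_succ_apply', ih (by omega), tau_contr C n j hj,
      Function.iterate_succ_apply']

end CrossedModule

namespace ModularCrossedModule

variable (C : ModularCrossedModule k H M)

lemma tauZ_pow (n : ℕ) : C.tauZ n ^ (n + 1) = 1 := by
  have h0 : ∀ (j : ℕ) (z : TPow k H (n + 1) ⊗[k] M), (C.tauZ n ^ j) ((balRel k H M (n + 1)).mkQ z) =
      (balRel k H M (n + 1)).mkQ ((C.tau n)^[j] z) := by
    intro j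
    induction j with
    | zero => intro z; rfl
    | succ j ih =>
      intro z
      rw [pow_succ, Module.End.mul_apply, Function.iterate_succ_apply, ← ih]
      rfl
  refine LinearMap.ext fun z => ?_
  obtain ⟨z, rfl⟩ := (balRel k H M (n + 1)).mkQ_surjective z
  induction z with
  | zero => simp
  | add x y hx hy => rw [map_add, map_add, map_add, hx, hy]
  | tmul u m =>
    rw [h0, C.tau_iterate n (n + 1) le_rfl, rot_pow]
    have h1 : ∀ z : M ⊗[k] H, (balRel k H M (n + 1)).mkQ
        (contr (partComul (k := k) n (n + 1) le_rfl).ofConv u z) =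
        (balRel k H M (n + 1)).mkQ (u ⊗ₜ actMap k H M z) := by
      intro z
      induction z with
      | zero => simp
      | add x y hx hy => simp only [map_add, TensorProduct.tmul_add, hx, hy]
      | tmul m c =>
        rw [contr_tmul]
        exact mk_balanced u c m
    rw [h1, C.modular]
    rfl

/-- The cyclic object `Z_*(H, M)` with `Zₙ(H, M) = H^{⊗ (n+1)} ⊗_H M`. -/
def Z : PrecyclicModule.{u, max u v w} k where
  obj n := Bal k H M (n + 1)
  d n i := faceZ k H M i
  t n := C.tauZ n
  d_comp_d n i j hij := by
    refine Submodule.linearMap_qext _ (TensorProduct.ext' fun u m => ?_)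
    have := DFunLike.congr_fun (face_comp_face (k := k) (H := H) i j hij) u
    simp only [AlgHom.comp_apply] at this
    simp only [faceZ, LinearMap.comp_apply, Submodule.mkQ_apply, Submodule.mapQ_apply,
      LinearMap.rTensor_tmul, AlgHom.toLinearMap_apply, this]
  d_succ_comp_t n i := by
    refine Submodule.linearMap_qext _ (TensorProduct.ext' fun u m => ?_)
    simp only [faceZ, CrossedModule.tauZ, LinearMap.comp_apply, Submodule.mkQ_apply,
      Submodule.mapQ_apply, LinearMap.rTensor_tmul, AlgHom.toLinearMap_apply,
      CrossedModule.tau_tmul]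
    congr 1
    generalize C.coact m = z
    have := DFunLike.congr_fun (face_succ_rot (k := k) (H := H) i) u
    simp only [AlgHom.comp_apply] at this
    rw [← this]
    induction z with
    | zero => simp
    | add x y hx hy => simp only [map_add, hx, hy]
    | tmul m c =>
      rw [contr_tmul, contr_tmul, LinearMap.rTensor_tmul, AlgHom.toLinearMap_apply, map_mul,
        face_succ_inj_zero]
  d_zero_comp_t n := by
    refine Submodule.linearMap_qext _ (TensorProduct.ext' fun u m => ?_)
    simp only [faceZ, CrossedModule.tauZ, LinearMap.comp_apply, Submodule.mkQ_apply,
      Submodule.mapQ_apply, LinearMap.rTensor_tmul, AlgHom.toLinearMap_apply,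
      CrossedModule.tau_tmul]
    congr 1
    have h := LinearMap.congr_fun C.counit m
    simp only [LinearMap.comp_apply, LinearMap.flip_apply, TensorProduct.mk_apply] at h
    have h1 : ∀ z : M ⊗[k] H, (face (k := k) (H := H) (0 : Fin (n + 2))).toLinearMap.rTensor M
        (contr (inj (k := k) 0).ofConv (rot k H (n + 2) u) z) =
        (TensorProduct.comm k M (TPow k H (n + 1))) (LinearMap.lTensor M
          (LinearMap.mulLeft k (face (Fin.last (n + 1)) u) ∘ₗ Algebra.linearMap k _)
          ((Coalgebra.counit (R := k) (A := H)).lTensor M z)) := by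
      intro z
      have := DFunLike.congr_fun (face_zero_rot (k := k) (H := H) (n := n + 1)) u
      simp only [AlgHom.comp_apply] at this
      rw [← this]
      induction z with
      | zero => simp
      | add x y hx hy => simp only [map_add, hx, hy]
      | tmul m c =>
        rw [contr_tmul, LinearMap.rTensor_tmul, AlgHom.toLinearMap_apply, map_mul, face_inj_self,
          LinearMap.lTensor_tmul, LinearMap.lTensor_tmul, TensorProduct.comm_tmul]
        rfl
    rw [h1, h]
    simp
  t_pow n := C.tauZ_pow n

/-- The cyclic homology `HC_n(H, M)` of `H` with coefficients in the modular crossed module `M`. -/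
def HC (C : ModularCrossedModule k H M) (n : ℕ) : ModuleCat.{max u v w} k := C.Z.HC n

end ModularCrossedModule

end Identities

end Hopf

section GroupAlgebra

variable {k G : Type u} [CommRing k] [Group G] {M : Type u} [AddCommGroup M] [Module k M]
  [Module (MonoidAlgebra k G) M] [IsScalarTower k (MonoidAlgebra k G) M]

/-- The homogeneous component `M_x = {m | ρ(m) = m ⊗ x}`, for `x` in `G`. -/
def CrossedModule.component (C : CrossedModule k (MonoidAlgebra k G) M) (x : G) : Submodule k M :=
  LinearMap.eqLocus C.coact ((TensorProduct.mk k M (MonoidAlgebra k G)).flip (.single x 1))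

lemma CrossedModule.mem_component {C : CrossedModule k (MonoidAlgebra k G) M} {x : G} {m : M} :
    m ∈ C.component x ↔ C.coact m = m ⊗ₜ MonoidAlgebra.single x 1 := Iff.rfl

lemma CrossedModule.single_smul_mem (C : CrossedModule k (MonoidAlgebra k G) M) (g x : G) {m : M}
    (hm : m ∈ C.component x) :
    (MonoidAlgebra.single g 1 : MonoidAlgebra k G) • m ∈ C.component (g * x * g⁻¹) := by
  rw [mem_component] at *
  rw [C.coact_smul, hm]
  simp [crossAct_apply, MonoidAlgebra.single_mul_single]

/-- The action of the centralizer `G_x` of `x` on `M_x`. -/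
def CrossedModule.componentRep (C : CrossedModule k (MonoidAlgebra k G) M) (x : G) :
    Representation k (Subgroup.centralizer {x}) (C.component x) where
  toFun g := (Algebra.lsmul k k M (MonoidAlgebra.single (g : G) 1 : MonoidAlgebra k G)).restrict
    fun m hm => by
      have h := C.single_smul_mem (g : G) x hm
      rwa [Subgroup.mem_centralizer_singleton_iff.1 g.2, mul_inv_cancel_right] at h
  map_one' := by
    ext m
    simp [← MonoidAlgebra.one_def]
  map_mul' g h := by
    ext m
    change (MonoidAlgebra.single ((g * h : Subgroup.centralizer {x}) : G) 1 : MonoidAlgebra k G) •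
        (m : M) =
      (MonoidAlgebra.single (g : G) 1 : MonoidAlgebra k G) •
        (MonoidAlgebra.single (h : G) 1 : MonoidAlgebra k G) • (m : M)
    rw [← mul_smul, MonoidAlgebra.single_mul_single, mul_one]
    rfl

/-- The subgroup `⟨x⟩` of the centralizer `G_x`. -/
def zpowersSelf (x : G) : Subgroup (Subgroup.centralizer {x}) :=
  Subgroup.zpowers ⟨x, Subgroup.mem_centralizer_singleton_iff.2 rfl⟩

instance zpowersSelf_normal (x : G) : (zpowersSelf x).Normal where
  conj_mem y hy g := by
    obtain ⟨i, rfl⟩ := Subgroup.mem_zpowers_iff.1 hy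
    have h : Commute g ⟨x, Subgroup.mem_centralizer_singleton_iff.2 rfl⟩ :=
      Subtype.ext (Subgroup.mem_centralizer_singleton_iff.1 g.2)
    rw [(h.zpow_right i).eq, mul_inv_cancel_right]
    exact hy

instance ModularCrossedModule.isTrivial_zpowersSelf
    (C : ModularCrossedModule k (MonoidAlgebra k G) M) (x : G) :
    Representation.IsTrivial ((C.componentRep x).comp (zpowersSelf x).subtype) where
  out g := by
    have hx : C.componentRep x ⟨x, Subgroup.mem_centralizer_singleton_iff.2 rfl⟩ = 1 := by
      ext m
      have h := C.modular m
      rw [CrossedModule.mem_component.1 m.2] at h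
      exact h
    obtain ⟨g, hg⟩ := g
    obtain ⟨i, rfl⟩ := Subgroup.mem_zpowers_iff.1 hg
    have h2 : ∀ i : ℤ, C.componentRep x
        (⟨x, Subgroup.mem_centralizer_singleton_iff.2 rfl⟩ ^ i) = 1 := by
      intro i
      induction i using Int.induction_on with
      | zero => simp
      | succ i ih => rw [zpow_add_one, map_mul, ih, hx, mul_one]
      | pred i ih =>
        have h3 : C.componentRep x ⟨x, Subgroup.mem_centralizer_singleton_iff.2 rfl⟩⁻¹ = 1 := by
          have := map_mul (C.componentRep x) ⟨x, Subgroup.mem_centralizer_singleton_iff.2 rfl⟩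
            ⟨x, Subgroup.mem_centralizer_singleton_iff.2 rfl⟩⁻¹
          rw [mul_inv_cancel, map_one, hx, one_mul] at this
          exact this.symm
        rw [zpow_sub_one, map_mul, ih, h3, mul_one]
    exact h2 i

/-- `M_x` as a representation of the group `G_x / ⟨x⟩`. -/
def ModularCrossedModule.componentQuot (C : ModularCrossedModule k (MonoidAlgebra k G) M) (x : G) :
    Rep k (Subgroup.centralizer {x} ⧸ zpowersSelf x) :=
  Rep.of ((C.componentRep x).ofQuotient (zpowersSelf x))

end GroupAlgebra

end CyclicHomology

end

/-! Tuples of group elements form a basis of `(kG)^{⊗(n+1)}`, and the coaction grades `M` by `G`,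
with `g M_y ⊆ M_{gyg⁻¹}`. Hence the cyclic object is a direct sum over conjugacy classes
(`nonempty_HC_equiv_directSum_conjClasses`). The summand of `x` is the space of coinvariants of
`G_x` on `M_x ⊗ k[G^{n+1}]`; its faces omit entries and its cyclic operator is `t(g₀,…,gₙ) = (gₙx,
g₀,…,gₙ₋₁)`. On chains `t^{n+1}` is right multiplication by `x`, so `t` has the right order only
modulo `⟨x⟩`. Since `x` acts trivially on `M_x`, one may divide by `⟨x⟩` first: the spaces `Cₙ =
k[G^{n+1}]_{⟨x⟩}` form a cyclic object of projective representations of `G_x/⟨x⟩`, and the summand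
is obtained from it by tensoring with `M_x` and taking coinvariants. Write `T = (-1)^n t`.

Finite order. Taking `⟨x⟩`-coinvariants is exact in characteristic zero, so `(C, b)` is a projective
resolution of `k` and the Hochschild homology of the summand is group homology. Antisymmetrizing
tuples, with entries averaged over the powers of `x`, gives an endomorphism `a` of this resolution
over the identity of `k` (`tupleD_antisymm`). It is therefore homotopic to the identity, and `a T =
a` (`antisymm_rotateTuple`). Moreover `b'` is contractible. These facts alone split the total
complex (`PrecyclicModule.nonempty_HC_equiv_directSum`): the obstructions to continuing a Hochschild
cycle through the double complex have the form `(1 - T)w`, are killed by `a`, and so are boundaries.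
Thus `HC_n` is the sum of the Hochschild homologies in degrees `n - 2i`.

Infinite order. Now the total complex of `C` is itself a projective resolution of `k`. Its rows are
exact in characteristic zero, so exactness in positive degrees reduces to that of `(C, b)` modulo `1
- T` (`PrecyclicModule.mem_range_totD`). As `1 - T^{n+1}` is a multiple of `1 - T`, this is the
quotient of the chains of `G` by `1 - T`. No nonzero finitely supported chain is invariant under
translation by an element of infinite order, so `1 - T` is injective, and the quotient is the
cokernel of an injection of the contractible `b'`-complex into the `b`-complex, which is exact in
positive degrees (`exists_eq_b_add_of_b_eq`). Tensoring the resolution with `M_x` and taking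
coinvariants gives the cyclic complex of the summand, whose homology is therefore group homology. -/

noncomputable section

namespace CyclicHomology

/-! ### Homology in terms of cycles and boundaries -/

section ElementwiseHomology

open CategoryTheory

variable {k : Type u} [CommRing k]

section

variable {X : ℕ → Type v} [∀ n, AddCommGroup (X n)] [∀ n, Module k (X n)]

/-- The cycles of a sequence of linear maps `⋯ → X₂ → X₁ → X₀`. -/
def cycles (d : ∀ n, X (n + 1) →ₗ[k] X n) : ∀ n, Submodule k (X n)
  | 0 => ⊤
  | n + 1 => LinearMap.ker (d n)

/-- The homology of a sequence of linear maps `⋯ → X₂ → X₁ → X₀`: cycles modulo boundaries. -/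
abbrev Homology (d : ∀ n, X (n + 1) →ₗ[k] X n) (n : ℕ) : Type v :=
  cycles d n ⧸ (LinearMap.range (d n)).submoduleOf (cycles d n)

lemma mem_cycles_zero (d : ∀ n, X (n + 1) →ₗ[k] X n) (x : X 0) : x ∈ cycles d 0 := trivial

lemma mem_cycles_succ {d : ∀ n, X (n + 1) →ₗ[k] X n} {n : ℕ} {x : X (n + 1)} :
    x ∈ cycles d (n + 1) ↔ d n x = 0 := Iff.rfl

end

/-- The homology of a chain complex of modules, in terms of elements. -/
def homologyEquiv (K : ChainComplex (ModuleCat.{v} k) ℕ) (d : ∀ n, K.X (n + 1) →ₗ[k] K.X n)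
    (hd : ∀ n, (K.d (n + 1) n).hom = d n) (n : ℕ) :
    K.homology n ≃ₗ[k] Homology (X := fun n => K.X n) d n := by
  obtain rfl : (fun n => (K.d (n + 1) n).hom) = d := funext hd
  -- The target index `i` is kept free because `next 0 = 0` in `ComplexShape.down ℕ`: in degree zero
  -- the outgoing map is the zero map `K.d 0 0`, whose kernel is everything, matching `cycles d 0 =
  -- ⊤`.
  have key : ∀ (i : ℕ) (hi : (ComplexShape.down ℕ).next n = i)
      (hc : LinearMap.ker (K.d n i).hom =
        cycles (X := fun n => K.X n) (fun n => (K.d (n + 1) n).hom) n),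
      Nonempty (K.homology n ≃ₗ[k]
        Homology (X := fun n => K.X n) (fun n => (K.d (n + 1) n).hom) n) := by
    intro i hi hc
    let e1 : K.homology n ≅ (K.sc' (n + 1) n i).homology :=
      ShortComplex.homologyMapIso (K.isoSc' (n + 1) n i (by simp) hi)
    let e2 := (K.sc' (n + 1) n i).moduleCatHomologyIso
    let e3 : (LinearMap.ker (K.d n i).hom ⧸ LinearMap.range (K.sc' (n + 1) n i).moduleCatToCycles)
        ≃ₗ[k] Homology (X := fun n => K.X n) (fun n => (K.d (n + 1) n).hom) n :=
      Submodule.Quotient.equiv _ _ (LinearEquiv.ofEq _ _ hc) (by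
        ext ⟨x, hx⟩
        constructor
        · rintro ⟨_, ⟨y, rfl⟩, h⟩
          exact ⟨y, congrArg Subtype.val h⟩
        · rintro ⟨y, h⟩
          exact ⟨(K.sc' (n + 1) n i).moduleCatToCycles y, ⟨y, rfl⟩, Subtype.ext h⟩)
    exact ⟨(e1 ≪≫ e2).toLinearEquiv ≪≫ₗ e3⟩
  refine Classical.choice ?_
  cases n with
  | zero =>
    refine key 0 (by simp) ?_
    rw [K.shape _ _ (by simp)]
    exact LinearMap.ker_zero
  | succ n => exact key n (by simp) rfl

section

variable {X : ℕ → Type v} [∀ n, AddCommGroup (X n)] [∀ n, Module k (X n)]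
  {Y : ℕ → Type w} [∀ n, AddCommGroup (Y n)] [∀ n, Module k (Y n)]
  {d : ∀ n, X (n + 1) →ₗ[k] X n} {d' : ∀ n, Y (n + 1) →ₗ[k] Y n}

/-- A linear map on cycles that is onto and whose kernel consists of the boundaries identifies its
target with the homology. -/
lemma nonempty_homology_equiv {W : Type*} [AddCommGroup W] [Module k W] (n : ℕ)
    (φ : cycles d n →ₗ[k] W) (hφ : Function.Surjective φ)
    (hker : ∀ c : cycles d n, φ c = 0 ↔ (c : X n) ∈ LinearMap.range (d n)) :
    Nonempty (Homology d n ≃ₗ[k] W) :=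
  ⟨Submodule.quotEquivOfEq _ _ (by ext c; exact (hker c).symm) ≪≫ₗ φ.quotKerEquivOfSurjective hφ⟩

lemma mem_cycles_of_comm (φ : ∀ n, X n →ₗ[k] Y n) (hφ : ∀ n x, φ n (d n x) = d' n (φ (n + 1) x))
    {n : ℕ} {x : X n} (hx : x ∈ cycles d n) : φ n x ∈ cycles d' n := by
  cases n with
  | zero => trivial
  | succ n =>
    rw [mem_cycles_succ] at *
    rw [← hφ, hx, map_zero]

/-- The map induced on homology by a chain map. -/
def Homology.map (φ : ∀ n, X n →ₗ[k] Y n) (hφ : ∀ n x, φ n (d n x) = d' n (φ (n + 1) x)) (n : ℕ) :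
    Homology d n →ₗ[k] Homology d' n :=
  Submodule.mapQ _ _ ((φ n).restrict fun _ hx => mem_cycles_of_comm φ hφ hx) (by
    rintro ⟨_, hx⟩ ⟨y, rfl⟩
    exact ⟨φ (n + 1) y, (hφ n y).symm⟩)

lemma Homology.map_mk (φ : ∀ n, X n →ₗ[k] Y n) (hφ : ∀ n x, φ n (d n x) = d' n (φ (n + 1) x))
    (n : ℕ) (x : cycles d n) :
    Homology.map φ hφ n (Submodule.Quotient.mk x) =
      Submodule.Quotient.mk ⟨φ n x, mem_cycles_of_comm φ hφ x.2⟩ := rfl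

/-- An isomorphism of complexes induces an isomorphism in homology. -/
lemma nonempty_homology_equiv_of_equiv (φ : ∀ n, X n ≃ₗ[k] Y n)
    (hφ : ∀ n x, φ n (d n x) = d' n (φ (n + 1) x)) (n : ℕ) :
    Nonempty (Homology d n ≃ₗ[k] Homology d' n) := by
  have hψ : ∀ n y, (φ n).symm (d' n y) = d n ((φ (n + 1)).symm y) := fun n y => by
    rw [LinearEquiv.symm_apply_eq, hφ, LinearEquiv.apply_symm_apply]
  refine ⟨LinearEquiv.ofLinearMap (Homology.map (fun n => (φ n).toLinearMap) hφ n)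
    (Homology.map (fun n => (φ n).symm.toLinearMap) hψ n) ?_ ?_⟩
  · refine Submodule.linearMap_qext _ (LinearMap.ext fun x => ?_)
    exact congrArg Submodule.Quotient.mk (Subtype.ext ((φ n).apply_symm_apply _))
  · refine Submodule.linearMap_qext _ (LinearMap.ext fun x => ?_)
    exact congrArg Submodule.Quotient.mk (Subtype.ext ((φ n).symm_apply_apply _))

/-- The homology of a complex that is the direct sum of complexes is the direct sum of their
homologies. -/
lemma nonempty_homology_equiv_directSum {ι : Type*} {Y : ι → ℕ → Type w}
    [∀ i n, AddCommGroup (Y i n)] [∀ i n, Module k (Y i n)]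
    {d' : ∀ i n, Y i (n + 1) →ₗ[k] Y i n}
    (θ : ∀ i n, Y i n →ₗ[k] X n) (π : ∀ i n, X n →ₗ[k] Y i n)
    (hθ : ∀ i n y, θ i n (d' i n y) = d n (θ i (n + 1) y))
    (h1 : ∀ i n y, π i n (θ i n y) = y) (h2 : ∀ i j, i ≠ j → ∀ n y, π i n (θ j n y) = 0)
    (h3 : ∀ n x, ∃ s : Finset ι, x = ∑ i ∈ s, θ i n (π i n x)) (n : ℕ) :
    Nonempty (Homology d n ≃ₗ[k] ⨁ i, Homology (d' i) n) := by
  classical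
  -- That the projections are chain maps need not be assumed: expand `x` as a sum of components and
  -- use that the inclusions are chain maps with orthogonal images.
  have hπ : ∀ i n x, π i n (d n x) = d' i n (π i (n + 1) x) := by
    intro i n x
    obtain ⟨s, hs⟩ := h3 (n + 1) x
    have key : ∀ j ∈ s, π i n (d n (θ j (n + 1) (π j (n + 1) x))) =
        if j = i then d' i n (π i (n + 1) x) else 0 := by
      intro j _
      split_ifs with h
      · subst h
        rw [← hθ, h1]
      · rw [← hθ, h2 i j (Ne.symm h)]
    by_cases hi : i ∈ s
    · conv_lhs => rw [hs]
      rw [map_sum, map_sum, Finset.sum_congr rfl key, Finset.sum_ite_eq' s i, if_pos hi]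
    · have : π i (n + 1) x = 0 := by
        rw [hs, map_sum]
        refine Finset.sum_eq_zero fun j hj => h2 i j ?_ _ _
        rintro rfl
        exact hi hj
      conv_lhs => rw [hs]
      rw [map_sum, map_sum, Finset.sum_congr rfl key, Finset.sum_ite_eq' s i, if_neg hi, this,
        map_zero]
  let Φ : (⨁ i, Homology (d' i) n) →ₗ[k] Homology d n :=
    DirectSum.toModule k ι _ fun i => Homology.map (θ i) (hθ i) n
  -- On homology the `j`-th projection reads off the `j`-th coordinate, which gives injectivity of
  -- `Φ`. Surjectivity comes from expanding a cycle into its components.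
  have hΦ : ∀ j (z : ⨁ i, Homology (d' i) n), Homology.map (π j) (hπ j) n (Φ z) = z j := by
    intro j z
    induction z using DirectSum.induction_on with
    | zero => simp
    | of i z =>
      obtain ⟨z, rfl⟩ := Submodule.Quotient.mk_surjective _ z
      change Homology.map (π j) (hπ j) n (Φ (DirectSum.lof k ι (fun i => Homology (d' i) n) i _)) =
        (DirectSum.lof k ι (fun i => Homology (d' i) n) i _ : ⨁ i, Homology (d' i) n) j
      rw [DirectSum.toModule_lof, Homology.map_mk, Homology.map_mk]
      by_cases hij : i = j
      · subst hij
        rw [DirectSum.lof_apply]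
        congr 1
        exact Subtype.ext (h1 _ _ _)
      · rw [DirectSum.lof_eq_of, DirectSum.of_eq_of_ne _ _ _ (Ne.symm hij)]
        rw [Submodule.Quotient.mk_eq_zero]
        change π j n (θ i n z) ∈ LinearMap.range (d' j n)
        rw [h2 j i (Ne.symm hij)]
        exact zero_mem _
    | add x y hx hy => rw [map_add, map_add, hx, hy, DirectSum.add_apply]
  refine ⟨(LinearEquiv.ofBijective Φ ⟨fun y z h => ?_, fun z => ?_⟩).symm⟩
  · ext j
    rw [← hΦ, ← hΦ, h]
  · obtain ⟨⟨x, hx⟩, rfl⟩ := Submodule.Quotient.mk_surjective _ z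
    obtain ⟨s, hs⟩ := h3 n x
    refine ⟨∑ i ∈ s, DirectSum.lof k ι _ i
      (Submodule.Quotient.mk ⟨π i n x, mem_cycles_of_comm (π i) (hπ i) hx⟩), ?_⟩
    rw [map_sum]
    simp only [Φ, DirectSum.toModule_lof, Homology.map_mk]
    rw [← Submodule.mkQ_apply]
    simp only [← Submodule.mkQ_apply]
    rw [← map_sum]
    congr 1
    ext
    simp [← hs]

end

end ElementwiseHomology

end CyclicHomology

namespace CyclicHomology

/-! ### Chains of the total complex as sequences -/

namespace PrecyclicModule

variable {k : Type u} [CommRing k] (Z : PrecyclicModule.{u, v} k)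

/-- The first `n + 1` terms of a sequence, as a chain of the total complex. -/
def trunc (n : ℕ) (c : ∀ q, Z.obj q) : Z.Tot n := fun q => c q

/-- Extension by zero of a chain of the total complex to a sequence. -/
def extendZero {n : ℕ} (x : Z.Tot n) : ∀ q, Z.obj q :=
  fun q => if h : q < n + 1 then x ⟨q, h⟩ else 0

lemma trunc_extendZero {n : ℕ} (x : Z.Tot n) : Z.trunc n (Z.extendZero x) = x := by
  funext q
  exact dif_pos q.2

/-- The differential of the total complex on sequences. -/
def seqD (n : ℕ) : (∀ q, Z.obj q) →ₗ[k] ∀ q, Z.obj q :=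
  -- The column index `n - q` is a truncated subtraction, so only the entries with `q ≤ n` have a
  -- meaning. Working with full sequences avoids dependent indices in `Fin (n + 1)`.
  LinearMap.pi fun q => Z.vert (n - q) q ∘ₗ LinearMap.proj (q + 1) +
    Z.horiz (n + 1 - q) q ∘ₗ LinearMap.proj q

lemma seqD_apply (n : ℕ) (c : ∀ q, Z.obj q) (q : ℕ) :
    Z.seqD n c q = Z.vert (n - q) q (c (q + 1)) + Z.horiz (n + 1 - q) q (c q) := rfl

lemma totD_trunc (n : ℕ) (c : ∀ q, Z.obj q) :
    Z.totD n (Z.trunc (n + 1) c) = Z.trunc n (Z.seqD n c) := rfl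

lemma seqD_seqD (n : ℕ) (c : ∀ q, Z.obj q) {q : ℕ} (hq : q ≤ n) :
    Z.seqD n (Z.seqD (n + 1) c) q = 0 := by
  have h := LinearMap.congr_fun (Z.totD_comp_totD n) (Z.trunc _ c)
  rw [LinearMap.comp_apply, totD_trunc, totD_trunc] at h
  exact congrFun h ⟨q, by omega⟩

/-- A sequence whose first `n + 1` terms are a cycle of the total complex. -/
def IsCycle (c : ∀ q, Z.obj q) : ℕ → Prop
  | 0 => True
  | n + 1 => ∀ q ≤ n, Z.seqD n c q = 0

lemma trunc_mem_cycles {c : ∀ q, Z.obj q} {n : ℕ} :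
    Z.trunc n c ∈ cycles (X := Z.Tot) Z.totD n ↔ Z.IsCycle c n := by
  cases n with
  | zero => exact ⟨fun _ => trivial, fun _ => trivial⟩
  | succ n =>
    rw [mem_cycles_succ, totD_trunc]
    exact ⟨fun h q hq => congrFun h ⟨q, by omega⟩, fun h => funext fun q => h q (by omega)⟩

lemma trunc_mem_range {c : ∀ q, Z.obj q} {n : ℕ} :
    Z.trunc n c ∈ LinearMap.range (Z.totD n) ↔ ∃ e, ∀ q ≤ n, c q = Z.seqD n e q := by
  constructor
  · rintro ⟨e, he⟩
    rw [← Z.trunc_extendZero e, totD_trunc] at he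
    exact ⟨_, fun q hq => (congrFun he ⟨q, by omega⟩).symm⟩
  · rintro ⟨e, he⟩
    exact ⟨Z.trunc _ e, by rw [totD_trunc]; exact funext fun q => (he q (by omega)).symm⟩

lemma isCycle_seqD (n : ℕ) (e : ∀ q, Z.obj q) : Z.IsCycle (Z.seqD n e) n := by
  cases n with
  | zero => trivial
  | succ n => exact fun q hq => Z.seqD_seqD n e hq

lemma IsCycle.sub {n : ℕ} {c c' : ∀ q, Z.obj q} (h : Z.IsCycle c n) (h' : Z.IsCycle c' n) :
    Z.IsCycle (c - c') n := by
  cases n with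
  | zero => trivial
  | succ n =>
    intro q hq
    rw [map_sub, Pi.sub_apply, h q hq, h' q hq, sub_zero]

lemma vert_congr {p p' : ℕ} (h : Even p ↔ Even p') (q : ℕ) : Z.vert p q = Z.vert p' q := by
  simp [vert, h]

lemma horiz_congr {p p' : ℕ} (h : Even p ↔ Even p') (q : ℕ) : Z.horiz p q = Z.horiz p' q := by
  simp [horiz, h]

lemma vert_even {p : ℕ} (h : Even p) (q : ℕ) : Z.vert p q = Z.b q := if_pos h

lemma vert_odd {p : ℕ} (h : ¬ Even p) (q : ℕ) : Z.vert p q = -Z.b' q := if_neg h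

lemma horiz_even {p : ℕ} (h : Even p) (q : ℕ) : Z.horiz p q = Z.norm q := if_pos h

lemma horiz_odd {p : ℕ} (h : ¬ Even p) (q : ℕ) : Z.horiz p q = 1 - Z.sgnT q := if_neg h

lemma seqD_self (n : ℕ) (c : ∀ q, Z.obj q) :
    Z.seqD n c n = Z.b n (c (n + 1)) + (c n - Z.sgnT n (c n)) := by
  rw [seqD_apply, vert_even _ (by simp), horiz_odd _ (by simp)]
  rfl

lemma seqD_pred (n : ℕ) (c : ∀ q, Z.obj q) :
    Z.seqD (n + 1) c n = -Z.b' n (c (n + 1)) + Z.norm n (c n) := by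
  rw [seqD_apply, vert_odd _ (by simp), horiz_even _ ⟨1, by omega⟩]
  rfl

/-- The double complex is periodic in the column index with period two. This is what allows the
inductions in steps of two: forgetting columns 0 and 1 of a chain of degree `n + 2` leaves a chain
of degree `n`. -/
lemma seqD_add_two {n q : ℕ} (c : ∀ q, Z.obj q) (hq : q ≤ n) :
    Z.seqD (n + 2) c q = Z.seqD n c q := by
  rw [seqD_apply, seqD_apply, Z.vert_congr (p := n + 2 - q) (p' := n - q),
    Z.horiz_congr (p := n + 2 + 1 - q) (p' := n + 1 - q)]
  · rw [show n + 2 + 1 - q = n + 1 - q + 2 by omega, Nat.even_add]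
    simp
  · rw [show n + 2 - q = n - q + 2 by omega, Nat.even_add]
    simp

lemma seqD_congr {n q : ℕ} {c c' : ∀ q, Z.obj q} (h : c q = c' q) (h' : c (q + 1) = c' (q + 1)) :
    Z.seqD n c q = Z.seqD n c' q := by
  rw [seqD_apply, h', h, seqD_apply]

/-- Cyclic homology in terms of cycles and boundaries. -/
def HCEquiv (n : ℕ) : Z.HC n ≃ₗ[k] Homology (X := Z.Tot) Z.totD n :=
  homologyEquiv Z.totalComplex Z.totD (fun n => congrArg ModuleCat.Hom.hom
    (ChainComplex.of_d (fun n => ModuleCat.of k (Z.Tot n))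
      (fun n => ModuleCat.ofHom (Z.totD n)) n)) n

lemma b_sub_sgnT (n : ℕ) (z : Z.obj (n + 1)) :
    Z.b n (z - Z.sgnT (n + 1) z) = Z.b' n z - Z.sgnT n (Z.b' n z) :=
  LinearMap.congr_fun (Z.b_comp_sub n) z

lemma norm_sub_sgnT (n : ℕ) (z : Z.obj n) : Z.norm n (z - Z.sgnT n z) = 0 := by
  rw [map_sub, sub_eq_zero]
  exact (LinearMap.congr_fun (Z.norm_comp_sgnT n) z).symm

lemma sub_sgnT_norm (n : ℕ) (z : Z.obj n) : Z.norm n z - Z.sgnT n (Z.norm n z) = 0 := by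
  rw [sub_eq_zero]
  exact (LinearMap.congr_fun (Z.sgnT_comp_norm n) z).symm

section Split

/-! ### Splitting of cyclic homology -/

variable {Z} {a : ∀ n, Module.End k (Z.obj n)}
  (hb' : ∀ n, ∀ z ∈ cycles Z.b' n, z ∈ LinearMap.range (Z.b' n))
  (hab : ∀ n z, a n (Z.b n z) = Z.b n (a (n + 1) z))
  (haT : ∀ n z, a n (Z.sgnT n z) = a n z)
  (ha : ∀ n, ∀ z ∈ cycles Z.b n, a n z - z ∈ LinearMap.range (Z.b n))

-- Since `a` is the identity on Hochschild homology, it detects boundaries.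
include ha in
lemma mem_range_b_of_map {n : ℕ} {z : Z.obj n} (hz : z ∈ cycles Z.b n)
    (h : a n z ∈ LinearMap.range (Z.b n)) : z ∈ LinearMap.range (Z.b n) := by
  have := sub_mem h (ha n z hz)
  rwa [sub_sub_cancel] at this

-- The cycle lives in columns 0 and 1. Exactness of `b'` makes its component in column 1 a boundary
-- `b' w`; removing it changes the component in column 0 by `w - T w`, which `a` does not see. What
-- remains is a Hochschild cycle whose image under `a` bounds, so it bounds.
include hb' ha haT in
lemma exists_seqD_of_eq_zero {n : ℕ} {c : ∀ q, Z.obj q} (hc : Z.IsCycle c n)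
    (h0 : ∀ q, q + 2 ≤ n → c q = 0) (hn : a n (c n) ∈ LinearMap.range (Z.b n)) :
    ∃ e, ∀ q ≤ n, c q = Z.seqD n e q := by
  cases n with
  | zero =>
    obtain ⟨v, hv⟩ := mem_range_b_of_map ha (mem_cycles_zero _ _) hn
    refine ⟨Function.update (0 : ∀ q, Z.obj q) 1 v, fun q hq => ?_⟩
    obtain rfl : q = 0 := by omega
    rw [seqD_self]
    simp [hv]
  | succ m =>
    obtain ⟨w, hw⟩ : c m ∈ LinearMap.range (Z.b' m) := by
      apply hb'
      cases m with
      | zero => trivial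
      | succ m =>
        have := hc m (by omega)
        rw [seqD_pred, h0 m (by omega), map_zero, add_zero, neg_eq_zero] at this
        exact this
    have h1 := hc m le_rfl
    rw [seqD_self] at h1
    -- This is a `b`-cycle because `b (w - T w) = b' w - T (b' w) = c m - T (c m)`, which is `-b (c
    -- (m + 1))` by the cycle equation.
    have h2 : c (m + 1) + (w - Z.sgnT (m + 1) w) ∈ LinearMap.range (Z.b (m + 1)) := by
      refine mem_range_b_of_map ha ?_ ?_
      · rw [mem_cycles_succ, map_add, b_sub_sgnT, hw, h1]
      · rwa [map_add, map_sub, haT, sub_self, add_zero]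
    obtain ⟨v, hv⟩ := h2
    refine ⟨Function.update (Function.update (0 : ∀ q, Z.obj q) (m + 1) (-w)) (m + 2) v,
      fun q hq => ?_⟩
    rcases Nat.lt_or_ge q m with hqm | hqm
    · rw [h0 q (by omega), seqD_apply, Function.update_of_ne (by omega),
        Function.update_of_ne (by omega), Function.update_of_ne (by omega),
        Function.update_of_ne (by omega)]
      simp
    · obtain rfl | rfl : q = m ∨ q = m + 1 := by omega
      · rw [seqD_pred, Function.update_of_ne (by omega), Function.update_self,
          Function.update_of_ne (by omega), Function.update_of_ne (by omega)]
        simp [hw]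
      · rw [seqD_self, Function.update_self, Function.update_of_ne (by omega),
          Function.update_self, hv, map_neg]
        abel

-- Injectivity of the splitting. Forgetting columns 0 and 1 gives a cycle of degree `n`, which
-- bounds by induction; subtracting the boundary of this bounding chain leaves a cycle in columns 0
-- and 1.
include hb' hab haT ha in
lemma exists_seqD_of_isCycle (n : ℕ) : ∀ {c : ∀ q, Z.obj q}, Z.IsCycle c n →
    (∀ q ≤ n, Even (n - q) → a q (c q) ∈ LinearMap.range (Z.b q)) →
    ∃ e, ∀ q ≤ n, c q = Z.seqD n e q := by
  induction n using Nat.twoStepInduction with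
  | zero =>
    intro c hc h
    exact exists_seqD_of_eq_zero hb' haT ha hc (by omega) (h 0 le_rfl (by simp))
  | one =>
    intro c hc h
    exact exists_seqD_of_eq_zero hb' haT ha hc (by omega) (h 1 le_rfl (by simp))
  | more n ih _ =>
    intro c hc h
    have hcn : Z.IsCycle c n := by
      cases n with
      | zero => trivial
      | succ n =>
        intro q hq
        rw [← seqD_add_two _ _ hq]
        exact hc q (by omega)
    obtain ⟨e, he⟩ := ih hcn fun q hq hq' => h q (by omega) (by
      rw [show n + 2 - q = n - q + 2 by omega, Nat.even_add]
      simpa using hq')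
    -- The entries `n + 2` and `n + 3` are set to zero so that subtracting the boundary does not
    -- touch the component of `c` in column 0.
    let e' : ∀ q, Z.obj q := fun q => if q ≤ n + 1 then e q else 0
    have hc' : Z.IsCycle (c - Z.seqD (n + 2) e') (n + 2) :=
      IsCycle.sub Z hc (Z.isCycle_seqD _ _)
    obtain ⟨f, hf⟩ := exists_seqD_of_eq_zero hb' haT ha hc' (fun q hq => by
      rw [Pi.sub_apply, Z.seqD_add_two _ (by omega), he q (by omega), sub_eq_zero]
      apply seqD_congr
      · exact (if_pos (by omega)).symm
      · exact (if_pos (by omega)).symm) (by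
      rw [Pi.sub_apply, seqD_self, show e' (n + 2 + 1) = 0 from if_neg (by omega),
        show e' (n + 2) = 0 from if_neg (by omega)]
      simpa using h (n + 2) le_rfl (by simp))
    refine ⟨e' + f, fun q hq => ?_⟩
    rw [map_add, Pi.add_apply, ← hf q hq, Pi.sub_apply]
    abel

-- Surjectivity of the splitting: Hochschild cycles prescribed in the even columns extend, up to
-- boundaries and after applying `a`, to a cycle of the total complex. Passing from `n` to `n + 2`,
-- the element `N (c n)` is a `b'`-cycle, hence `b' w'`. Then `w' - T w'` is a `b`-cycle killed by
-- `a`, hence a boundary `b v`, and nothing obstructs the extension.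
include hb' hab haT ha in
lemma exists_isCycle (w : ∀ q, Z.obj q) (n : ℕ)
    (hw : ∀ q ≤ n, Even (n - q) → w q ∈ cycles Z.b q) :
    ∃ c, Z.IsCycle c n ∧ ∀ q ≤ n, Even (n - q) → a q (c q) - w q ∈ LinearMap.range (Z.b q) := by
  induction n using Nat.twoStepInduction with
  | zero =>
    refine ⟨w, trivial, fun q hq _ => ?_⟩
    obtain rfl : q = 0 := by omega
    exact ha 0 _ trivial
  | one =>
    refine ⟨Function.update (0 : ∀ q, Z.obj q) 1 (w 1), fun q hq => ?_, fun q hq hq' => ?_⟩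
    · obtain rfl : q = 0 := Nat.le_zero.1 hq
      have := hw 1 le_rfl (by simp)
      rw [mem_cycles_succ] at this
      rw [seqD_self]
      simp [this]
    · obtain rfl : q = 1 := by
        by_contra h
        obtain rfl : q = 0 := by omega
        simp at hq'
      rw [Function.update_self]
      exact ha 1 _ (hw 1 le_rfl (by simp))
  | more n ih _ =>
    obtain ⟨c, hc, hcw⟩ := ih fun q hq hq' => hw q (by omega) (by
      rw [show n + 2 - q = n - q + 2 by omega, Nat.even_add]
      simpa using hq')
    obtain ⟨w', hw'⟩ : Z.norm n (c n) ∈ LinearMap.range (Z.b' n) := by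
      apply hb'
      cases n with
      | zero => trivial
      | succ m =>
        have h1 := hc m le_rfl
        rw [seqD_self] at h1
        rw [mem_cycles_succ]
        have h2 := LinearMap.congr_fun (Z.b'_comp_norm m) (c (m + 1))
        rw [LinearMap.comp_apply, LinearMap.comp_apply, eq_neg_of_add_eq_zero_left h1, map_neg,
          norm_sub_sgnT, neg_zero] at h2
        exact h2
    have hz : Z.b n (w' - Z.sgnT (n + 1) w') = 0 := by
      rw [b_sub_sgnT, hw', sub_sgnT_norm]
    have haz : a (n + 1) (w' - Z.sgnT (n + 1) w') = 0 := by
      rw [map_sub, haT, sub_self]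
    obtain ⟨v, hv⟩ := mem_range_b_of_map ha (n := n + 1) hz (by rw [haz]; exact zero_mem _)
    have hav : a (n + 2) v ∈ cycles Z.b (n + 2) := by
      rw [mem_cycles_succ, ← hab, hv, haz]
    -- In column 0, `-v` cancels `w' - T w'`, and `w (n + 2)` has the prescribed class. The term `a
    -- v` is a cycle since `b (a v) = a (b v) = 0`; it compensates the contribution `a (-v)`,
    -- because `a (a v)` and `a v` are homologous.
    refine ⟨fun q => if q ≤ n then c q else
      Function.update (Function.update (0 : ∀ q, Z.obj q) (n + 1) w') (n + 2)
      (-v + (w (n + 2) + a (n + 2) v)) q, fun q hq => ?_, fun q hq hq' => ?_⟩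
    · rcases Nat.lt_or_ge q n with hqn | hqn
      · cases n with
        | zero => omega
        | succ n =>
          have := hc q (by omega)
          rw [← seqD_add_two _ _ (by omega)] at this
          rw [← this]
          apply seqD_congr
          · exact if_pos (by omega)
          · exact if_pos (by omega)
      · obtain rfl | rfl : q = n ∨ q = n + 1 := by omega
        · rw [seqD_pred, if_neg (by omega), if_pos le_rfl, Function.update_of_ne (by omega),
            Function.update_self, hw', neg_add_cancel]
        · rw [seqD_self, if_neg (by omega), if_neg (by omega), Function.update_self,
            Function.update_of_ne (by omega), Function.update_self, map_add, map_add,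
            mem_cycles_succ.1 hav, mem_cycles_succ.1 (hw (n + 2) le_rfl (by simp)), map_neg, hv]
          abel
    · rcases Nat.lt_or_ge n q with hqn | hqn
      · obtain rfl : q = n + 2 := by
          by_contra h
          obtain rfl : q = n + 1 := by omega
          simp at hq'
        beta_reduce
        rw [if_neg (by omega), Function.update_self]
        have h1 := ha _ _ (hw (n + 2) le_rfl (by simp))
        have h2 := ha _ _ hav
        have := add_mem h1 h2
        convert this using 1
        rw [map_add, map_add, map_neg]
        abel
      · beta_reduce
        rw [if_pos (show q ≤ n from hqn)]
        refine hcw q hqn ?_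
        rw [show n + 2 - q = n - q + 2 by omega, Nat.even_add] at hq'
        simpa using hq'

-- The cycle equation says that `b (c q)` lies in the image of `1 - T`, and `a` kills that image.
include hab haT in
lemma map_mem_cycles_b {n : ℕ} {c : ∀ q, Z.obj q} (hc : Z.IsCycle c n) {q : ℕ} (hq : q ≤ n)
    (h : Even (n - q)) : a q (c q) ∈ cycles Z.b q := by
  cases q with
  | zero => trivial
  | succ q =>
    cases n with
    | zero => omega
    | succ n =>
      have h1 := hc q (by omega)
      rw [seqD_apply, vert_even _ (by simpa using h), horiz_odd _ (by
        rw [show n + 1 - q = n + 1 - (q + 1) + 1 by omega, Nat.even_add_one, not_not]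
        exact h)] at h1
      have h2 : Z.b q (c (q + 1)) = -(c q - Z.sgnT q (c q)) := eq_neg_of_add_eq_zero_left h1
      rw [mem_cycles_succ, ← hab, h2, map_neg, map_sub, haT, sub_self, neg_zero]

include hb' hab haT ha in
/-- If `b'` is exact and there is a chain endomorphism `a` of the Hochschild complex that is
invariant under the signed cyclic operators and induces the identity on homology, then cyclic
homology is a sum of shifted copies of Hochschild homology. -/
theorem nonempty_HC_equiv_directSum (n : ℕ) :
    Nonempty (Z.HC n ≃ₗ[k] ⨁ i : {i : ℕ // 2 * i ≤ n}, Homology Z.b (n - 2 * i)) := by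
  have hfin : Finite {i : ℕ // 2 * i ≤ n} :=
    Set.Finite.to_subtype ((Set.finite_le_nat n).subset fun i (hi : 2 * i ≤ n) =>
      show i ≤ n by omega)
  have := Fintype.ofFinite {i : ℕ // 2 * i ≤ n}
  -- The isomorphism sends a cycle to the classes of `a` applied to its components in the even
  -- columns `2i`.
  let φ (i : {i : ℕ // 2 * i ≤ n}) :
      cycles (X := Z.Tot) Z.totD n →ₗ[k] Homology Z.b (n - 2 * i) :=
    Submodule.mkQ _ ∘ₗ LinearMap.codRestrict _
      (a _ ∘ₗ LinearMap.proj (R := k) (φ := fun j : Fin (n + 1) => Z.obj j)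
        ⟨n - 2 * i, by omega⟩ ∘ₗ Submodule.subtype _) (fun x => by
        have hx := x.2
        rw [← Z.trunc_extendZero x.1, trunc_mem_cycles] at hx
        have := map_mem_cycles_b hab haT hx (Nat.sub_le n (2 * (i : ℕ)))
          (by rw [Nat.sub_sub_self i.2]; simp)
        convert this using 2
        exact congrArg (a _) (congrFun (Z.trunc_extendZero x.1) ⟨n - 2 * i, by omega⟩).symm)
  have hφ : ∀ (i : {i : ℕ // 2 * i ≤ n}) (c : ∀ q, Z.obj q)
      (hc : Z.trunc n c ∈ cycles (X := Z.Tot) Z.totD n)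
      (y : cycles Z.b (n - 2 * i)), φ i ⟨Z.trunc n c, hc⟩ = Submodule.Quotient.mk y ↔
        a _ (c (n - 2 * i)) - y ∈ LinearMap.range (Z.b (n - 2 * i)) := by
    intro i c hc y
    exact Submodule.Quotient.eq _
  have heven : ∀ q ≤ n, Even (n - q) → ∃ i : {i : ℕ // 2 * i ≤ n}, q = n - 2 * i := by
    rintro q hq ⟨i, hi⟩
    exact ⟨⟨i, by omega⟩, by simp only; omega⟩
  obtain ⟨e⟩ := nonempty_homology_equiv (X := Z.Tot) (d := Z.totD) n (LinearMap.pi φ) (by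
    intro y
    choose y' hy' using fun i => Submodule.Quotient.mk_surjective _ (y i)
    have hinj : ∀ i j : {i : ℕ // 2 * i ≤ n}, n - 2 * (i : ℕ) = n - 2 * j → i = j :=
      fun i j h => Subtype.ext (by have := i.2; have := j.2; omega)
    -- The representatives are assembled into one sequence, with zero in the other degrees. The
    -- transport is along `n - 2 * i = q`, and `hinj` shows that the chosen `i` is the intended one.
    let w : ∀ q, Z.obj q := fun q =>
      if h : ∃ i : {i : ℕ // 2 * i ≤ n}, n - 2 * (i : ℕ) = q then h.choose_spec ▸ (y' h.choose).1
      else 0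
    have hw : ∀ i : {i : ℕ // 2 * i ≤ n}, w (n - 2 * i) = y' i := by
      intro i
      have h : ∃ j : {i : ℕ // 2 * i ≤ n}, n - 2 * (j : ℕ) = n - 2 * i := ⟨i, rfl⟩
      have hji := hinj _ _ h.choose_spec
      simp only [w, dif_pos h]
      generalize_proofs h1
      generalize h.choose = j at *
      subst hji
      rfl
    obtain ⟨c, hc, hcw⟩ := exists_isCycle hb' hab haT ha w n fun q hq hq' => by
      obtain ⟨i, rfl⟩ := heven q hq hq'
      rw [hw]
      exact (y' i).2
    refine ⟨⟨Z.trunc n c, Z.trunc_mem_cycles.2 hc⟩, funext fun i => ?_⟩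
    rw [← hy', LinearMap.pi_apply, hφ, ← hw]
    exact hcw _ (Nat.sub_le _ _) (by rw [Nat.sub_sub_self i.2]; simp)) (by
    rintro ⟨x, hx⟩
    obtain ⟨c, rfl⟩ : ∃ c, x = Z.trunc n c := ⟨_, (Z.trunc_extendZero x).symm⟩
    have hker : ∀ i, φ i ⟨Z.trunc n c, hx⟩ = 0 ↔
        a _ (c (n - 2 * i)) ∈ LinearMap.range (Z.b (n - 2 * i)) := fun i => by
      have := hφ i c hx 0
      rwa [Submodule.Quotient.mk_zero, ZeroMemClass.coe_zero, sub_zero] at this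
    rw [trunc_mem_range, funext_iff]
    simp only [LinearMap.pi_apply, Pi.zero_apply, hker]
    constructor
    · intro h
      refine exists_seqD_of_isCycle hb' hab haT ha n (Z.trunc_mem_cycles.1 hx) fun q hq hq' => ?_
      obtain ⟨i, rfl⟩ := heven q hq hq'
      exact h i
    -- Into an even column the horizontal differential is `1 - T`, so `a` leaves only the Hochschild
    -- boundary.
    · rintro ⟨e, he⟩ i
      have hi := i.2
      rw [he _ (Nat.sub_le _ _), seqD_apply, vert_even _ (by rw [Nat.sub_sub_self hi]; simp),
        horiz_odd _ (by
          rw [show n + 1 - (n - 2 * (i : ℕ)) = 2 * i + 1 by omega]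
          simp), map_add, hab, LinearMap.sub_apply, map_sub, haT, Module.End.one_apply, sub_self,
        add_zero]
      exact ⟨_, rfl⟩)
  exact ⟨Z.HCEquiv n ≪≫ₗ e ≪≫ₗ
    (DirectSum.linearEquivFunOnFintype k {i : ℕ // 2 * i ≤ n} _).symm⟩

end Split

end PrecyclicModule

/-! ### Exactness of the total complex in characteristic zero -/

section Acyclic

variable {k : Type u} [Field k] [CharZero k] (Z : PrecyclicModule.{u, v} k)

namespace PrecyclicModule

/-- A row is the periodic complex of the cyclic group of order `q + 1` acting through the signed
operator; it is exact because `q + 1` is invertible. -/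
lemma exists_horiz_eq {p q : ℕ} {z : Z.obj q} (hz : Z.horiz p q z = 0) :
    ∃ e, Z.horiz (p + 1) q e = z := by
  have hq : ((q + 1 : ℕ) : k) ≠ 0 := Nat.cast_ne_zero.2 (by omega)
  by_cases hp : Even p
  · rw [Z.horiz_even hp] at hz
    rw [Z.horiz_odd (by rw [Nat.even_add_one, not_not]; exact hp)]
    have h1 : ∑ i ∈ Finset.range (q + 1), (z - (Z.sgnT q ^ i) z) = ((q + 1 : ℕ) : k) • z := by
      rw [Finset.sum_sub_distrib, ← LinearMap.sum_apply]
      change _ - Z.norm q z = _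
      rw [hz, sub_zero, Finset.sum_const, Finset.card_range, Nat.cast_smul_eq_nsmul]
    -- If `N z = 0` then `(q + 1) z` is the sum of the elements `z - T^i z`, and `1 - T^i = (1 - T)
    -- ∑_{j<i} T^j`.
    refine ⟨((q + 1 : ℕ) : k)⁻¹ • ∑ i ∈ Finset.range (q + 1),
      (∑ j ∈ Finset.range i, Z.sgnT q ^ j) z, ?_⟩
    rw [map_smul, inv_smul_eq_iff₀ hq, ← h1, map_sum]
    refine Finset.sum_congr rfl fun i _ => ?_
    exact LinearMap.congr_fun (mul_neg_geom_sum (Z.sgnT q) i) z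
  · rw [Z.horiz_odd hp] at hz
    rw [Z.horiz_even (by rw [Nat.even_add_one]; exact hp)]
    have hT : Z.sgnT q z = z := (sub_eq_zero.1 hz).symm
    have hTi : ∀ i, (Z.sgnT q ^ i) z = z := by
      intro i
      induction i with
      | zero => rfl
      | succ i ih => rw [pow_succ, Module.End.mul_apply, hT, ih]
    refine ⟨((q + 1 : ℕ) : k)⁻¹ • z, ?_⟩
    rw [map_smul, inv_smul_eq_iff₀ hq, norm, LinearMap.sum_apply]
    simp only [hTi]
    rw [Finset.sum_const, Finset.card_range, Nat.cast_smul_eq_nsmul]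

/-- As `m ≤ n`, the component in column 0 vanishes, and every other one is in a column where the
rows are exact. The highest possibly nonzero component is a horizontal cycle, hence a horizontal
boundary; subtracting the total boundary of its preimage clears that row and only alters the row
below. -/
lemma exists_seqD_of_eq_zero_of_le (m : ℕ) : ∀ {n : ℕ} {c : ∀ q, Z.obj q}, m ≤ n → Z.IsCycle c n →
    (∀ q, m ≤ q → q ≤ n → c q = 0) → ∃ e, ∀ q ≤ n, c q = Z.seqD n e q := by
  induction m with
  | zero =>
    intro n c _ _ h
    exact ⟨0, fun q hq => by rw [h q (Nat.zero_le _) hq, map_zero]; rfl⟩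
  | succ m ih =>
    intro n c hmn hc h
    obtain ⟨n, rfl⟩ : ∃ n', n = n' + 1 := ⟨n - 1, by omega⟩
    have h1 := hc m (by omega)
    rw [seqD_apply, h (m + 1) le_rfl hmn, map_zero, zero_add] at h1
    obtain ⟨e, he⟩ := Z.exists_horiz_eq h1
    obtain ⟨f, hf⟩ := ih
      (c := c - Z.seqD (n + 1) (Function.update (0 : ∀ q, Z.obj q) m e)) (by omega)
      (IsCycle.sub Z hc (Z.isCycle_seqD _ _)) (fun q hq hq' => by
        rw [Pi.sub_apply, seqD_apply, Function.update_of_ne (by omega)]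
        obtain rfl | hq := hq.eq_or_lt
        · rw [Function.update_self, show n + 1 + 1 - m = n + 1 - m + 1 by omega, he]
          simp
        · rw [Function.update_of_ne (by omega), h q (by omega) hq']
          simp)
    refine ⟨Function.update (0 : ∀ q, Z.obj q) m e + f, fun q hq => ?_⟩
    rw [map_add, Pi.add_apply, ← hf q hq, Pi.sub_apply]
    abel

/-- The total complex is exact in positive degrees if this holds for the quotient of the
Hochschild complex by the signed cyclic operators. -/
theorem mem_range_totD (hZ : ∀ n z, (∃ e, Z.b n z = e - Z.sgnT n e) →
    ∃ v e, z = Z.b (n + 1) v + (e - Z.sgnT (n + 1) e)) (n : ℕ) {x : Z.Tot (n + 1)}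
    (hx : Z.totD n x = 0) : x ∈ LinearMap.range (Z.totD (n + 1)) := by
  obtain ⟨c, rfl⟩ : ∃ c, x = Z.trunc (n + 1) c := ⟨_, (Z.trunc_extendZero x).symm⟩
  have hc : Z.IsCycle c (n + 1) := Z.trunc_mem_cycles.1 hx
  rw [trunc_mem_range]
  have h1 := hc n le_rfl
  rw [seqD_self] at h1
  -- By the cycle equation the component in column 0 is a cycle modulo `1 - T`. The resulting `v`
  -- and `e`, placed in columns 0 and 1, give a boundary that cancels it.
  obtain ⟨v, e, hve⟩ := hZ n (c (n + 1)) ⟨-c n, by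
    rw [eq_neg_of_add_eq_zero_left h1, map_neg]
    abel⟩
  obtain ⟨f, hf⟩ := Z.exists_seqD_of_eq_zero_of_le (n + 1) (n := n + 1)
    (c := c - Z.seqD (n + 1)
      (Function.update (Function.update (0 : ∀ q, Z.obj q) (n + 1) e) (n + 2) v)) le_rfl
    (IsCycle.sub Z hc (Z.isCycle_seqD _ _)) (fun q hq hq' => by
      obtain rfl : q = n + 1 := by omega
      rw [Pi.sub_apply, seqD_self, Function.update_self, Function.update_of_ne (by omega),
        Function.update_self, ← hve, sub_self])
  refine ⟨Function.update (Function.update (0 : ∀ q, Z.obj q) (n + 1) e) (n + 2) v + f,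
    fun q hq => ?_⟩
  rw [map_add, Pi.add_apply, ← hf q hq, Pi.sub_apply]
  abel

end PrecyclicModule

end Acyclic

end CyclicHomology

/-! ### Paracyclic objects and their total complexes -/

namespace CyclicHomology

open CategoryTheory

/-- Face maps and cyclic operators in a category that satisfy the relations of a precyclic object,
except that the operators `t` need not have finite order. -/
structure ParacyclicObject (𝒞 : Type*) [Category 𝒞] where
  obj : ℕ → 𝒞
  d : ∀ n, Fin (n + 2) → (obj (n + 1) ⟶ obj n)
  t : ∀ n, obj n ⟶ obj n
  d_comp_d : ∀ (n : ℕ) (i j : Fin (n + 2)), i ≤ j →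
    d (n + 1) j.succ ≫ d n i = d (n + 1) i.castSucc ≫ d n j
  t_comp_d_succ : ∀ (n : ℕ) (i : Fin (n + 1)), t (n + 1) ≫ d n i.succ = d n i.castSucc ≫ t n
  t_comp_d_zero : ∀ n : ℕ, t (n + 1) ≫ d n 0 = d n (Fin.last (n + 1))

namespace ParacyclicObject

section Functor

variable {𝒞 𝒟 : Type*} [Category 𝒞] [Category 𝒟]

/-- The image of a paracyclic object under a functor. -/
def map (X : ParacyclicObject 𝒞) (F : 𝒞 ⥤ 𝒟) : ParacyclicObject 𝒟 where
  obj n := F.obj (X.obj n)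
  d n i := F.map (X.d n i)
  t n := F.map (X.t n)
  d_comp_d n i j h := by rw [← F.map_comp, X.d_comp_d n i j h, F.map_comp]
  t_comp_d_succ n i := by rw [← F.map_comp, X.t_comp_d_succ, F.map_comp]
  t_comp_d_zero n := by rw [← F.map_comp, X.t_comp_d_zero]

end Functor

section Linear

variable (k : Type u) [CommRing k] {𝒞 : Type*} [Category 𝒞] [Preadditive 𝒞] [Linear k 𝒞]
  (X : ParacyclicObject 𝒞)

/-- The Hochschild differential. -/
def b (n : ℕ) : X.obj (n + 1) ⟶ X.obj n := ∑ i : Fin (n + 2), (-1 : k) ^ (i : ℕ) • X.d n i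

/-- The Hochschild differential without the last face. -/
def b' (n : ℕ) : X.obj (n + 1) ⟶ X.obj n :=
  ∑ i : Fin (n + 1), (-1 : k) ^ (i : ℕ) • X.d n i.castSucc

/-- The signed cyclic operator. -/
def sgnT (n : ℕ) : X.obj n ⟶ X.obj n := (-1 : k) ^ n • X.t n

/-- The norm operator. -/
def norm (n : ℕ) : End (X.obj n) :=
  ∑ i ∈ Finset.range (n + 1), End.of (X.sgnT k n) ^ i

/-- The vertical differentials of the Tsygan double complex. -/
def vert (p q : ℕ) : X.obj (q + 1) ⟶ X.obj q :=
  if Even p then X.b k q else (-X.b' k q : X.obj (q + 1) ⟶ X.obj q)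

/-- The horizontal differentials of the Tsygan double complex. -/
def horiz (p q : ℕ) : X.obj q ⟶ X.obj q :=
  if Even p then (X.norm k q).asHom else 𝟙 _ - X.sgnT k q

end Linear

section ModuleCat

variable {k : Type u} [CommRing k] {𝒞 : Type*} [Category 𝒞] [Preadditive 𝒞] [Linear k 𝒞]
  (X : ParacyclicObject 𝒞) (F : 𝒞 ⥤ ModuleCat.{v} k) (hF : ∀ n, (F.map (X.t n)).hom ^ (n + 1) = 1)

/-- The precyclic module obtained from a paracyclic object by a functor that makes the cyclic
operators periodic. -/
abbrev toPrecyclicModule : PrecyclicModule.{u, v} k where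
  obj n := F.obj (X.obj n)
  d n i := (F.map (X.d n i)).hom
  t n := (F.map (X.t n)).hom
  d_comp_d n i j h := by
    rw [← ModuleCat.hom_comp, ← ModuleCat.hom_comp, ← F.map_comp, ← F.map_comp, X.d_comp_d n i j h]
  d_succ_comp_t n i := by
    rw [← ModuleCat.hom_comp, ← ModuleCat.hom_comp, ← F.map_comp, ← F.map_comp, X.t_comp_d_succ]
  d_zero_comp_t n := by
    rw [← ModuleCat.hom_comp, ← F.map_comp, X.t_comp_d_zero]
  t_pow n := hF n

variable [F.Additive] [F.Linear k]

lemma toPrecyclicModule_b (n : ℕ) :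
    (X.toPrecyclicModule F hF).b n = (F.map (X.b k n)).hom := by
  simp only [b, PrecyclicModule.b, F.map_sum, F.map_smul, ModuleCat.hom_sum, ModuleCat.hom_smul]

lemma toPrecyclicModule_b' (n : ℕ) :
    (X.toPrecyclicModule F hF).b' n = (F.map (X.b' k n)).hom := by
  simp only [b', PrecyclicModule.b', F.map_sum, F.map_smul, ModuleCat.hom_sum, ModuleCat.hom_smul]

lemma toPrecyclicModule_sgnT (n : ℕ) :
    (X.toPrecyclicModule F hF).sgnT n = (F.map (X.sgnT k n)).hom := by
  simp only [sgnT, PrecyclicModule.sgnT, F.map_smul, ModuleCat.hom_smul]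

lemma map_pow_hom {A : 𝒞} (f : End A) (i : ℕ) :
    (F.map (f ^ i : End A)).hom = (F.map f).hom ^ i := by
  induction i with
  | zero => simp; rfl
  | succ i ih =>
    rw [pow_succ', pow_succ', ← ih, End.mul_def, F.map_comp, ModuleCat.hom_comp]
    rfl

lemma toPrecyclicModule_norm (n : ℕ) :
    (X.toPrecyclicModule F hF).norm n = (F.map (X.norm k n).asHom).hom := by
  simp only [norm, PrecyclicModule.norm, F.map_sum, ModuleCat.hom_sum, map_pow_hom,
    toPrecyclicModule_sgnT]

lemma toPrecyclicModule_vert (p q : ℕ) :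
    (X.toPrecyclicModule F hF).vert p q = (F.map (X.vert k p q)).hom := by
  by_cases hp : Even p
  · rw [PrecyclicModule.vert_even _ hp, vert, if_pos hp, toPrecyclicModule_b]
  · rw [PrecyclicModule.vert_odd _ hp, vert, if_neg hp, toPrecyclicModule_b', F.map_neg]
    rfl

lemma toPrecyclicModule_horiz (p q : ℕ) :
    (X.toPrecyclicModule F hF).horiz p q = (F.map (X.horiz k p q)).hom := by
  by_cases hp : Even p
  · rw [PrecyclicModule.horiz_even _ hp, horiz, if_pos hp, toPrecyclicModule_norm]
  · rw [PrecyclicModule.horiz_odd _ hp, horiz, if_neg hp, toPrecyclicModule_sgnT, F.map_sub,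
      F.map_id]
    rfl

end ModuleCat

section Rep

variable {k G : Type u} [CommRing k] [Group G] (X : ParacyclicObject (Rep.{u} k G))

/-- The total complex of a paracyclic representation. -/
def totRep (n : ℕ) : Rep.{u} k G :=
  Rep.of (X := ∀ q : Fin (n + 1), X.obj q)
    { toFun g := LinearMap.pi fun q => (X.obj q).ρ g ∘ₗ LinearMap.proj q
      map_one' := by ext; simp
      map_mul' g h := LinearMap.ext fun x => funext fun q => by simp }

/-- The projection from the total complex. -/
def totProj (n : ℕ) (q : Fin (n + 1)) : X.totRep n ⟶ X.obj q :=
  Rep.ofHom ⟨LinearMap.proj q, fun _ => rfl⟩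

/-- The inclusion into the total complex. -/
def totSingle (n : ℕ) (q : Fin (n + 1)) : X.obj q ⟶ X.totRep n :=
  Rep.ofHom ⟨LinearMap.single k (fun q : Fin (n + 1) => X.obj q) q, fun g => by
    refine LinearMap.ext fun x => funext fun j => ?_
    change (Pi.single q ((X.obj q).ρ g x) : ∀ q : Fin (n + 1), X.obj q) j =
      (X.obj j).ρ g ((Pi.single q x : ∀ q : Fin (n + 1), X.obj q) j)
    rcases eq_or_ne j q with rfl | h
    · simp
    · simp [Pi.single_eq_of_ne h]⟩

lemma totSingle_comp_totProj (n : ℕ) (q : Fin (n + 1)) :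
    X.totSingle n q ≫ X.totProj n q = 𝟙 _ := by
  ext x
  exact Pi.single_eq_same (M := fun q : Fin (n + 1) => X.obj q) q x

lemma totSingle_comp_totProj_of_ne (n : ℕ) {q q' : Fin (n + 1)} (h : q' ≠ q) :
    X.totSingle n q ≫ X.totProj n q' = 0 := by
  ext x
  exact Pi.single_eq_of_ne (M := fun q : Fin (n + 1) => X.obj q) h x

lemma sum_totProj_comp_totSingle (n : ℕ) :
    ∑ q, X.totProj n q ≫ X.totSingle n q = 𝟙 (X.totRep n) := by
  refine Rep.hom_ext ?_
  refine Representation.IntertwiningMap.ext (LinearMap.ext fun x => ?_)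
  change (∑ q, X.totProj n q ≫ X.totSingle n q : X.totRep n ⟶ X.totRep n).hom x = x
  rw [Rep.sum_hom, Representation.IntertwiningMap.sum_apply]
  exact Finset.univ_sum_single (M := fun q : Fin (n + 1) => X.obj q) x

/-- A finite product is also a direct sum, so lifts can be chosen on each factor and added. -/
instance totRep_projective [∀ q, Projective (X.obj q)] (n : ℕ) : Projective (X.totRep n) where
  factors f e _ := by
    refine ⟨∑ q, X.totProj n q ≫ Projective.factorThru (X.totSingle n q ≫ f) e, ?_⟩
    rw [Preadditive.sum_comp]
    simp only [Category.assoc, Projective.factorThru_comp]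
    simp only [← Category.assoc]
    rw [← Preadditive.sum_comp, sum_totProj_comp_totSingle, Category.id_comp]

/-- The differential of the total complex of a paracyclic representation. -/
def totRepD (n : ℕ) : X.totRep (n + 1) ⟶ X.totRep n :=
  ∑ q : Fin (n + 1), (X.totProj (n + 1) q.succ ≫ X.vert k (n - q) q +
    X.totProj (n + 1) q.castSucc ≫ X.horiz k (n + 1 - q) q) ≫ X.totSingle n q

lemma totRepD_comp_totProj (n : ℕ) (q : Fin (n + 1)) :
    X.totRepD n ≫ X.totProj n q = X.totProj (n + 1) q.succ ≫ X.vert k (n - q) q +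
      X.totProj (n + 1) q.castSucc ≫ X.horiz k (n + 1 - q) q := by
  rw [totRepD, Preadditive.sum_comp, Finset.sum_eq_single q]
  · rw [Category.assoc, totSingle_comp_totProj, Category.comp_id]
  · intro j _ hj
    rw [Category.assoc, totSingle_comp_totProj_of_ne _ _ (Ne.symm hj), Limits.comp_zero]
  · simp

variable (F : Rep.{u} k G ⥤ ModuleCat.{u} k) [F.Additive] [F.Linear k]
  (hF : ∀ n, (F.map (X.t n)).hom ^ (n + 1) = 1)

/-- Additive functors commute with total complexes. -/
def mapTotEquiv (n : ℕ) : F.obj (X.totRep n) ≃ₗ[k] (X.toPrecyclicModule F hF).Tot n :=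
  LinearEquiv.ofLinearMap (LinearMap.pi fun q => (F.map (X.totProj n q)).hom)
    (∑ q : Fin (n + 1), (F.map (X.totSingle n q)).hom ∘ₗ LinearMap.proj q) (by
      refine LinearMap.ext fun x => funext fun q => ?_
      change (F.map (X.totProj n q)).hom
        ((∑ j, (F.map (X.totSingle n j)).hom ∘ₗ LinearMap.proj j) x) = x q
      rw [LinearMap.sum_apply, map_sum, Finset.sum_eq_single q]
      · have h := congrArg (fun f => (F.map f).hom (x q)) (X.totSingle_comp_totProj n q)
        simp only [F.map_comp, F.map_id] at h
        exact h
      · intro j _ hj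
        have h := congrArg (fun f => (F.map f).hom (x j))
          (X.totSingle_comp_totProj_of_ne n (Ne.symm hj))
        simp only [F.map_comp, F.map_zero] at h
        exact h
      · simp) (by
      refine LinearMap.ext fun x => ?_
      have h := congrArg (fun f => (F.map f).hom x) (X.sum_totProj_comp_totSingle n)
      simp only [F.map_sum, F.map_comp, F.map_id, ModuleCat.hom_sum, LinearMap.sum_apply] at h
      rw [LinearMap.comp_apply, LinearMap.sum_apply]
      exact h)

lemma mapTotEquiv_apply (n : ℕ) (x : F.obj (X.totRep n)) (q : Fin (n + 1)) :
    X.mapTotEquiv F hF n x q = (F.map (X.totProj n q)).hom x := rfl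

/-- Applying `F` to the total complex formed from representations gives the complex of cyclic
homology. This lets a resolution by total complexes compute cyclic homology. -/
lemma mapTotEquiv_comm (n : ℕ) (x : F.obj (X.totRep (n + 1))) :
    X.mapTotEquiv F hF n ((F.map (X.totRepD n)).hom x) =
      (X.toPrecyclicModule F hF).totD n (X.mapTotEquiv F hF (n + 1) x) := by
  funext q
  have h := congrArg (fun f => (F.map f).hom x) (X.totRepD_comp_totProj n q)
  simp only [F.map_add, F.map_comp] at h
  rw [mapTotEquiv_apply]
  refine h.trans ?_
  rw [PrecyclicModule.totD, LinearMap.pi_apply, toPrecyclicModule_vert, toPrecyclicModule_horiz]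
  rfl

-- The relation uses the finite order of the cyclic operators, which is not part of a paracyclic
-- object. It is checked after a faithful functor, where `hF` supplies that order.
include hF in
lemma totRepD_comp_totRepD [F.Faithful] (n : ℕ) : X.totRepD (n + 1) ≫ X.totRepD n = 0 := by
  apply F.map_injective
  rw [F.map_comp, F.map_zero]
  refine ModuleCat.hom_ext (LinearMap.ext fun x => ?_)
  apply (X.mapTotEquiv F hF n).injective
  refine (X.mapTotEquiv_comm F hF n _).trans ?_
  refine (congrArg _ (X.mapTotEquiv_comm F hF (n + 1) x)).trans ?_
  exact (LinearMap.congr_fun (PrecyclicModule.totD_comp_totD _ n) _).trans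
    (LinearEquiv.map_zero _).symm

end Rep

end ParacyclicObject

/-! ### Tuples of group elements and the twisted rotation -/

section Tuples

variable {G : Type u} [Group G] (x : G)

/-- The twisted rotation `(g₀, …, gₙ) ↦ (gₙx, g₀, …, gₙ₋₁)`. -/
def rotateTuple {n : ℕ} (u : Fin (n + 1) → G) : Fin (n + 1) → G :=
  Fin.cons (u (Fin.last n) * x) fun i : Fin n => u i.castSucc

/-- Right multiplication of all entries of a tuple. -/
def mulTuple {n : ℕ} (u : Fin n → G) (g : G) : Fin n → G := fun i => u i * g

lemma mulTuple_mulTuple {n : ℕ} (u : Fin n → G) (g h : G) :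
    mulTuple (mulTuple u g) h = mulTuple u (g * h) := funext fun _ => mul_assoc _ _ _

lemma mulTuple_one {n : ℕ} (u : Fin n → G) : mulTuple u 1 = u := funext fun _ => mul_one _

lemma removeNth_mulTuple {n : ℕ} (i : Fin (n + 1)) (u : Fin (n + 1) → G) (g : G) :
    Fin.removeNth i (mulTuple u g) = mulTuple (Fin.removeNth i u) g := rfl

lemma cons_mulTuple {n : ℕ} (u : Fin n → G) (g h : G) :
    (Fin.cons (h * g) (mulTuple u g) : Fin (n + 1) → G) = mulTuple (Fin.cons h u) g := by
  funext i
  cases i using Fin.cases <;> rfl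

/-- The factor `x` at the end of the first entry is passed by `g` because the two commute; this is
why only the centralizer of `x` is made to act. -/
lemma rotateTuple_mulTuple {n : ℕ} (u : Fin (n + 1) → G) {g : G} (hg : Commute g x) :
    rotateTuple x (mulTuple u g) = mulTuple (rotateTuple x u) g := by
  rw [rotateTuple, rotateTuple, ← cons_mulTuple, mulTuple, mul_assoc, mul_assoc, hg.eq]
  rfl

lemma removeNth_zero_rotateTuple {n : ℕ} (u : Fin (n + 1) → G) :
    Fin.removeNth 0 (rotateTuple x u) = Fin.removeNth (Fin.last n) u := by
  rw [Fin.removeNth_zero, Fin.removeNth_last]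
  rfl

lemma removeNth_succ_rotateTuple {n : ℕ} (i : Fin (n + 1)) (u : Fin (n + 2) → G) :
    Fin.removeNth i.succ (rotateTuple x u) = rotateTuple x (Fin.removeNth i.castSucc u) := by
  funext j
  cases j using Fin.cases with
  | zero =>
    rw [Fin.removeNth_apply, Fin.succ_succAbove_zero]
    change u (Fin.last (n + 1)) * x = u (i.castSucc.succAbove (Fin.last n)) * x
    rw [Fin.succAbove_of_le_castSucc _ _ (by rw [Fin.le_def]; simp; omega), Fin.succ_last]
  | succ j =>
    rw [Fin.removeNth_apply, Fin.succ_succAbove_succ]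
    change u (i.succAbove j).castSucc = u (i.castSucc.succAbove j.castSucc)
    rw [Fin.castSucc_succAbove_castSucc]

lemma removeNth_removeNth_of_le {n : ℕ} {i j : Fin (n + 2)} (h : i ≤ j) (u : Fin (n + 3) → G) :
    Fin.removeNth i (Fin.removeNth j.succ u) = Fin.removeNth j (Fin.removeNth i.castSucc u) := by
  have h1 : j.succ.succAbove i = i.castSucc :=
    Fin.succAbove_of_castSucc_lt _ _ (by rw [Fin.lt_def, Fin.le_def] at *; simp; omega)
  have h2 : i.predAbove j.succ = j := by
    rw [Fin.predAbove_of_castSucc_lt _ _ (by rw [Fin.lt_def, Fin.le_def] at *; simp; omega),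
      Fin.pred_succ]
  have := Fin.removeNth_removeNth_eq_swap u i j.succ
  rwa [h1, h2] at this

lemma rotateTuple_iterate {n : ℕ} (j : ℕ) (hj : j ≤ n + 1) (u : Fin (n + 1) → G)
    (i : Fin (n + 1)) : (rotateTuple x)^[j] u i =
      if h : (i : ℕ) < j then u ⟨n + 1 - j + i, by omega⟩ * x else u ⟨i - j, by omega⟩ := by
  induction j generalizing i with
  | zero => simp
  | succ j ih =>
    rw [Function.iterate_succ_apply']
    cases i using Fin.cases with
    | zero =>
      rw [rotateTuple, Fin.cons_zero, ih (by omega), dif_neg (by simp; omega), dif_pos (by simp)]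
      congr 3
      simp
    | succ i =>
      rw [rotateTuple, Fin.cons_succ, ih (by omega)]
      by_cases h : (i : ℕ) < j
      · rw [dif_pos (by simpa using h), dif_pos (by simpa using h)]
        congr 3
        simp
        omega
      · rw [dif_neg (by simpa using h), dif_neg (by simpa using h)]
        congr 2
        simp

/-- A full turn multiplies every entry by `x` once. So the rotation is cyclic only after dividing by
the powers of `x`. -/
lemma rotateTuple_iterate_succ {n : ℕ} (u : Fin (n + 1) → G) :
    (rotateTuple x)^[n + 1] u = mulTuple u x := by
  funext i
  rw [rotateTuple_iterate x (n + 1) le_rfl, dif_pos i.2]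
  simp [mulTuple]

end Tuples

/-! ### The augmented standard complex -/

section TupleComplex

variable (k : Type u) [CommRing k] {G : Type u} [Group G] (x : G)

/-- The linear extension of a map between sets of tuples. -/
abbrev tupleMap {m n : ℕ} (f : (Fin m → G) → (Fin n → G)) :
    ((Fin m → G) →₀ k) →ₗ[k] ((Fin n → G) →₀ k) := Finsupp.lmapDomain k k f

lemma tupleMap_single {m n : ℕ} (f : (Fin m → G) → (Fin n → G)) (u : Fin m → G) (r : k) :
    tupleMap k f (Finsupp.single u r) = Finsupp.single (f u) r := Finsupp.mapDomain_single

lemma tupleMap_comp {l m n : ℕ} (f : (Fin l → G) → (Fin m → G)) (g : (Fin m → G) → (Fin n → G)) :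
    tupleMap k g ∘ₗ tupleMap k f = tupleMap k (g ∘ f) := (Finsupp.lmapDomain_comp k k f g).symm

lemma tupleMap_id {n : ℕ} : tupleMap k (id : (Fin n → G) → (Fin n → G)) = LinearMap.id :=
  Finsupp.lmapDomain_id k k

variable (G) in
/-- The differential of the augmented standard complex. -/
def tupleD (n : ℕ) : ((Fin (n + 1) → G) →₀ k) →ₗ[k] ((Fin n → G) →₀ k) :=
  ∑ i : Fin (n + 1), (-1 : k) ^ (i : ℕ) • tupleMap k (Fin.removeNth i)

lemma tupleD_single (n : ℕ) (u : Fin (n + 1) → G) :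
    tupleD k G n (Finsupp.single u 1) =
      ∑ i : Fin (n + 1), (-1 : k) ^ (i : ℕ) • Finsupp.single (Fin.removeNth i u) 1 := by
  simp only [tupleD, LinearMap.sum_apply, LinearMap.smul_apply, tupleMap_single]

lemma tupleD_zero_cons (g : G) (z : (Fin 0 → G) →₀ k) :
    tupleD k G 0 (tupleMap k (Fin.cons (α := fun _ => G) g) z) = z := by
  induction z using Finsupp.induction_linear with
  | zero => simp
  | add y z hy hz => rw [map_add, map_add, hy, hz]
  | single u r =>
    rw [tupleMap_single, ← mul_one r, ← smul_eq_mul, ← Finsupp.smul_single, map_smul,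
      tupleD_single, Fin.sum_univ_one]
    rw [show (Fin.removeNth 0 (Fin.cons g u : Fin 1 → G) : Fin 0 → G) = u from
      Subsingleton.elim _ _]
    simp

/-- Prepending `g` is a contracting homotopy: face 0 undoes it, and the other faces commute with it
with index and sign shifted by one. -/
lemma tupleD_succ_cons (n : ℕ) (g : G) (z : (Fin (n + 1) → G) →₀ k) :
    tupleD k G (n + 1) (tupleMap k (Fin.cons (α := fun _ => G) g) z) =
      z - tupleMap k (Fin.cons (α := fun _ => G) g) (tupleD k G n z) := by
  induction z using Finsupp.induction_linear with
  | zero => simp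
  | add y z hy hz => simp only [map_add, hy, hz]; abel
  | single u r =>
    rw [tupleMap_single, ← mul_one r, ← smul_eq_mul, ← Finsupp.smul_single, map_smul,
      ← Finsupp.smul_single, map_smul, map_smul, tupleD_single, tupleD_single, Fin.sum_univ_succ,
      map_sum, ← smul_sub]
    congr 1
    rw [sub_eq_add_neg, ← Finset.sum_neg_distrib]
    congr 1
    · simp
    · refine Finset.sum_congr rfl fun i _ => ?_
      rw [map_smul, tupleMap_single, Fin.val_succ, pow_succ, mul_neg_one, neg_smul]
      congr 3
      funext j
      cases j using Fin.cases with
      | zero => simp [Fin.removeNth]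
      | succ j => simp [Fin.removeNth]

lemma exists_tupleD_eq {n : ℕ} {z : (Fin (n + 1) → G) →₀ k} (hz : tupleD k G n z = 0) :
    ∃ y, tupleD k G (n + 1) y = z :=
  ⟨_, by rw [tupleD_succ_cons k n (1 : G), hz, map_zero, sub_zero]⟩

end TupleComplex

/-! ### Antisymmetrization averaged over the powers of `x` -/

section Antisymmetrization

variable (k : Type u) [Field k] {G : Type u} [Group G] (x : G)

/-- Insertion of the average of `g, gx, …, gx^(N-1)` in front of a tuple. -/
def averageCons (N : ℕ) {n : ℕ} (g : G) : ((Fin n → G) →₀ k) →ₗ[k] ((Fin (n + 1) → G) →₀ k) :=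
  (N : k)⁻¹ • ∑ a ∈ Finset.range N, tupleMap k (Fin.cons (α := fun _ => G) (g * x ^ a))

/-- Replacing `g` by `gx` only permutes `g, gx, …, gx^(N-1)` cyclically. -/
lemma averageCons_mul {N : ℕ} (hN : x ^ N = 1) {n : ℕ} (g : G) :
    averageCons k x N (n := n) (g * x) = averageCons k x N g := by
  cases N with
  | zero => simp [averageCons]
  | succ N =>
    rw [averageCons, averageCons, Finset.sum_range_succ, Finset.sum_range_succ']
    congr 2
    · refine Finset.sum_congr rfl fun a _ => ?_
      rw [mul_assoc, ← pow_succ']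
    · rw [mul_assoc, ← pow_succ', hN, pow_zero]

lemma averageCons_mulTuple (N : ℕ) {n : ℕ} (g : G) {h : G} (hh : Commute h x)
    (z : (Fin n → G) →₀ k) :
    averageCons k x N (g * h) (tupleMap k (mulTuple · h) z) =
      tupleMap k (mulTuple · h) (averageCons k x N g z) := by
  simp only [averageCons, LinearMap.smul_apply, LinearMap.sum_apply, map_smul, map_sum]
  congr 1
  refine Finset.sum_congr rfl fun a _ => ?_
  rw [← LinearMap.comp_apply, ← LinearMap.comp_apply, tupleMap_comp, tupleMap_comp]
  congr 2
  funext u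
  rw [Function.comp_apply, Function.comp_apply, ← cons_mulTuple, mul_assoc, mul_assoc,
    (hh.pow_right a).eq]

variable [CharZero k]

lemma average_const {M : Type*} [AddCommGroup M] [Module k M] {N : ℕ} (hN : N ≠ 0) (m : M) :
    (N : k)⁻¹ • ∑ _a ∈ Finset.range N, m = m := by
  rw [Finset.sum_const, Finset.card_range, ← Nat.cast_smul_eq_nsmul k, inv_smul_smul₀]
  exact Nat.cast_ne_zero.2 hN

lemma tupleD_zero_averageCons {N : ℕ} (hN : N ≠ 0) (g : G) (z : (Fin 0 → G) →₀ k) :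
    tupleD k G 0 (averageCons k x N g z) = z := by
  rw [averageCons, LinearMap.smul_apply, LinearMap.sum_apply, map_smul, map_sum]
  simp only [tupleD_zero_cons]
  exact average_const k hN z

/-- An average of contracting homotopies is again a contracting homotopy. -/
lemma tupleD_succ_averageCons {N : ℕ} (hN : N ≠ 0) (n : ℕ) (g : G)
    (z : (Fin (n + 1) → G) →₀ k) :
    tupleD k G (n + 1) (averageCons k x N g z) = z - averageCons k x N g (tupleD k G n z) := by
  rw [averageCons, LinearMap.smul_apply, LinearMap.sum_apply, map_smul, map_sum]
  simp only [tupleD_succ_cons]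
  rw [Finset.sum_sub_distrib, smul_sub, average_const k hN, averageCons, LinearMap.smul_apply,
    LinearMap.sum_apply]

/-- The antisymmetrization of tuples whose entries are averaged over the powers of `x`. -/
def antisymm (N : ℕ) : ∀ n, ((Fin n → G) →₀ k) →ₗ[k] ((Fin n → G) →₀ k)
  | 0 => LinearMap.id
  -- The alternating sum over permutations is expanded by the choice of the entry that comes first,
  -- like a determinant along a row. This recursion makes the faces computable by the homotopy
  -- formula for `averageCons`.
  | n + 1 => Finsupp.linearCombination k fun u : Fin (n + 1) → G =>
      ((n + 1 : ℕ) : k)⁻¹ • ∑ i : Fin (n + 1), (-1 : k) ^ (i : ℕ) •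
        averageCons k x N (u i) (antisymm N n (Finsupp.single (Fin.removeNth i u) 1))

lemma antisymm_succ_single (N n : ℕ) (u : Fin (n + 1) → G) :
    antisymm k x N (n + 1) (Finsupp.single u 1) =
      ((n + 1 : ℕ) : k)⁻¹ • ∑ i : Fin (n + 1), (-1 : k) ^ (i : ℕ) •
        averageCons k x N (u i) (antisymm k x N n (Finsupp.single (Fin.removeNth i u) 1)) := by
  rw [antisymm, Finsupp.linearCombination_single, one_smul]

lemma smul_antisymm_succ_single (N n : ℕ) (u : Fin (n + 1) → G) :
    ((n + 1 : ℕ) : k) • antisymm k x N (n + 1) (Finsupp.single u 1) =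
      ∑ i : Fin (n + 1), (-1 : k) ^ (i : ℕ) •
        averageCons k x N (u i) (antisymm k x N n (Finsupp.single (Fin.removeNth i u) 1)) := by
  rw [antisymm_succ_single, smul_inv_smul₀]
  exact Nat.cast_ne_zero.2 (by omega)

lemma antisymm_mulTuple (N : ℕ) {h : G} (hh : Commute h x) (n : ℕ) :
    antisymm k x N n ∘ₗ tupleMap k (mulTuple · h) =
      tupleMap k (mulTuple · h) ∘ₗ antisymm k x N n := by
  induction n with
  | zero => rfl
  | succ n ih =>
    refine Finsupp.lhom_ext' fun u => LinearMap.ext_ring ?_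
    change antisymm k x N (n + 1) (tupleMap k (mulTuple · h) (Finsupp.single u 1)) =
      tupleMap k (mulTuple · h) (antisymm k x N (n + 1) (Finsupp.single u 1))
    rw [tupleMap_single, antisymm_succ_single, antisymm_succ_single, map_smul, map_sum]
    congr 1
    refine Finset.sum_congr rfl fun i _ => ?_
    rw [map_smul, ← averageCons_mulTuple k x N _ hh, ← LinearMap.comp_apply (tupleMap k _), ← ih,
      LinearMap.comp_apply, tupleMap_single, removeNth_mulTuple]
    rfl

/-- The twisted rotation is a cyclic permutation of `n + 1` entries, of sign `(-1)^n`, together with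
a factor `x` on one entry that the averaging does not see. -/
lemma antisymm_rotateTuple {N : ℕ} (hN : x ^ N = 1) (n : ℕ) (u : Fin (n + 1) → G) :
    antisymm k x N (n + 1) (Finsupp.single (rotateTuple x u) 1) =
      (-1 : k) ^ n • antisymm k x N (n + 1) (Finsupp.single u 1) := by
  induction n with
  | zero =>
    rw [antisymm_succ_single, antisymm_succ_single]
    rw [Fin.sum_univ_succ, Fin.sum_univ_zero, Fin.sum_univ_succ, Fin.sum_univ_zero, pow_zero,
      one_smul, removeNth_zero_rotateTuple]
    change _ • (_ • averageCons k x N (u 0 * x) _ + _) = _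
    rw [averageCons_mul k x hN]
    rfl
  | succ n ih =>
    rw [antisymm_succ_single, antisymm_succ_single, smul_comm]
    congr 1
    rw [Fin.sum_univ_succ]
    refine (add_comm _ _).trans ?_
    conv_rhs => rw [Fin.sum_univ_castSucc, smul_add, Finset.smul_sum]
    congr 1
    · refine Finset.sum_congr rfl fun i _ => ?_
      rw [removeNth_succ_rotateTuple, ih, map_smul, smul_smul, smul_smul]
      congr 1
      rw [Fin.val_succ, Fin.val_castSucc, ← pow_add, ← pow_add]
      congr 1
      ring
    · rw [removeNth_zero_rotateTuple, Fin.val_last, smul_smul, ← mul_pow]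
      simp only [Fin.val_zero, pow_zero, mul_neg, mul_one, neg_neg, one_pow]
      change _ • averageCons k x N (u (Fin.last _) * x) _ = _
      rw [averageCons_mul k x hN]

/-- Multiply by `n + 2` and use `d h = 1 - h d` for each insertion `h` in the expansion. The terms
from `1` add up to the antisymmetrization of the boundary. By induction the terms from `h d` form a
double sum over pairs of removed entries, which gives `n + 1` further copies. -/
lemma tupleD_antisymm {N : ℕ} (hN : N ≠ 0) (n : ℕ) :
    tupleD k G n ∘ₗ antisymm k x N (n + 1) = antisymm k x N n ∘ₗ tupleD k G n := by
  induction n with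
  | zero =>
    refine Finsupp.lhom_ext' fun u => LinearMap.ext_ring ?_
    change tupleD k G 0 (antisymm k x N 1 (Finsupp.single u 1)) =
      antisymm k x N 0 (tupleD k G 0 (Finsupp.single u 1))
    rw [antisymm_succ_single, tupleD_single]
    rw [Fin.sum_univ_succ, Fin.sum_univ_zero, Fin.sum_univ_succ, Fin.sum_univ_zero, add_zero,
      add_zero, map_smul, map_smul, map_smul, tupleD_zero_averageCons k x hN]
    simp
  | succ n ih =>
    refine Finsupp.lhom_ext' fun u => LinearMap.ext_ring ?_
    change tupleD k G (n + 1) (antisymm k x N (n + 2) (Finsupp.single u 1)) =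
      antisymm k x N (n + 1) (tupleD k G (n + 1) (Finsupp.single u 1))
    have h0 : ((n + 2 : ℕ) : k) ≠ 0 := Nat.cast_ne_zero.2 (by omega)
    rw [← smul_right_injective _ h0 |>.eq_iff]
    rw [← map_smul, smul_antisymm_succ_single, map_sum]
    simp only [map_smul, tupleD_succ_averageCons k x hN]
    have ih' : ∀ v : Fin (n + 1) → G, tupleD k G n (antisymm k x N (n + 1) (Finsupp.single v 1)) =
        ∑ j : Fin (n + 1), (-1 : k) ^ (j : ℕ) •
          antisymm k x N n (Finsupp.single (Fin.removeNth j v) 1) := by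
      intro v
      have := LinearMap.congr_fun ih (Finsupp.single v 1)
      rw [LinearMap.comp_apply, LinearMap.comp_apply, tupleD_single, map_sum] at this
      simpa only [map_smul] using this
    simp only [ih', smul_sub, Finset.sum_sub_distrib, map_sum, map_smul, tupleD_single]
    -- On the left `i` is removed first and put in front; on the right the entry put in front is
    -- removed second. Exchanging the order of the two removals changes the sign.
    have key : ∑ i : Fin (n + 2), (-1 : k) ^ (i : ℕ) • ∑ j : Fin (n + 1), (-1 : k) ^ (j : ℕ) •
        averageCons k x N (u i)
          (antisymm k x N n (Finsupp.single (Fin.removeNth j (Fin.removeNth i u)) 1)) =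
        -∑ l : Fin (n + 2), (-1 : k) ^ (l : ℕ) • ((n + 1 : ℕ) : k) •
          antisymm k x N (n + 1) (Finsupp.single (Fin.removeNth l u) 1) := by
      simp only [smul_antisymm_succ_single, Finset.smul_sum, smul_smul, ← pow_add]
      rw [← Finset.sum_neg_distrib]
      simp only [← Finset.sum_neg_distrib]
      rw [← Finset.sum_product', ← Finset.sum_product', Finset.univ_product_univ]
      -- A pair `(i, j)` means: remove entry `i`, then entry `j` of what is left. The map `e`
      -- describes the same two entries in the opposite order.
      let e : Fin (n + 2) × Fin (n + 1) → Fin (n + 2) × Fin (n + 1) :=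
        fun p => (p.1.succAbove p.2, p.2.predAbove p.1)
      have he : Function.Involutive e := fun p => by
        simp only [e, Fin.succAbove_succAbove_predAbove, Fin.predAbove_predAbove_succAbove]
      refine Finset.sum_bij (fun p _ => e p) (fun _ _ => Finset.mem_univ _)
        (fun _ _ _ _ h => he.injective h) (fun p _ => ⟨e p, Finset.mem_univ _, he p⟩) ?_
      rintro ⟨i, j⟩ _
      simp only [e]
      rw [← Fin.removeNth_removeNth_eq_swap, Fin.removeNth_apply,
        Fin.succAbove_succAbove_predAbove, Fin.neg_one_pow_succAbove_add_predAbove, neg_smul,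
        neg_neg]
    rw [key, sub_neg_eq_add, ← Finset.sum_add_distrib, Finset.smul_sum]
    refine Finset.sum_congr rfl fun i _ => ?_
    rw [← smul_add, smul_comm]
    congr 1
    push_cast
    module

end Antisymmetrization

lemma rep_sum_hom_apply {k Γ : Type*} [CommRing k] [Group Γ] {A B : Rep.{v} k Γ} {ι : Type*}
    (s : Finset ι) (f : ι → (A ⟶ B)) (z : A) : (∑ i ∈ s, f i).hom z = ∑ i ∈ s, (f i).hom z := by
  rw [Rep.sum_hom, Representation.IntertwiningMap.sum_apply]

/-! ### Chains of `G` as a paracyclic representation of the centralizer -/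

section TupleRep

variable (k : Type u) [CommRing k] {G : Type u} [Group G] (x : G)

lemma commute_of_mem_centralizer (g : Subgroup.centralizer {x}) : Commute (g : G) x :=
  Subgroup.mem_centralizer_singleton_iff.1 g.2

/-- The element `x` of its own centralizer. -/
def selfCentralizer : Subgroup.centralizer {x} := ⟨x, Subgroup.mem_centralizer_singleton_iff.2 rfl⟩

/-- The action of the centralizer of `x` on tuples by right multiplication with inverses. -/
def tupleRepresentation (n : ℕ) :
    Representation k (Subgroup.centralizer {x}) ((Fin n → G) →₀ k) where
  toFun g := tupleMap k (mulTuple · (g : G)⁻¹)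
  map_one' := by
    refine Finsupp.lhom_ext' fun u => LinearMap.ext_ring ?_
    change tupleMap k _ (Finsupp.single u 1) = Finsupp.single u 1
    rw [tupleMap_single]
    simp [mulTuple_one]
  map_mul' g h := by
    rw [Module.End.mul_eq_comp, tupleMap_comp]
    congr 1
    funext u
    simp [mulTuple_mulTuple]

/-- The representation of the centralizer of `x` on the chains of `G`. -/
abbrev tupleRep (n : ℕ) : Rep.{u} k (Subgroup.centralizer {x}) := Rep.of (tupleRepresentation k x n)

lemma tupleRep_ρ_apply (n : ℕ) (g : Subgroup.centralizer {x}) (z : (Fin n → G) →₀ k) :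
    (tupleRep k x n).ρ g z = tupleMap k (mulTuple · (g : G)⁻¹) z := rfl

variable {k}

/-- A linear map between chains that commutes with right multiplications as a morphism of
representations. -/
def tupleHom {m n : ℕ} (f : ((Fin m → G) →₀ k) →ₗ[k] ((Fin n → G) →₀ k))
    (hf : ∀ h, Commute h x → f ∘ₗ tupleMap k (mulTuple · h) = tupleMap k (mulTuple · h) ∘ₗ f) :
    tupleRep k x m ⟶ tupleRep k x n :=
  Rep.ofHom ⟨f, fun g => hf _ (commute_of_mem_centralizer x g).inv_left⟩

lemma tupleRep_hom_ext {m : ℕ} {Y : Rep.{u} k (Subgroup.centralizer {x})}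
    {f g : tupleRep k x m ⟶ Y}
    (h : ∀ u : Fin m → G, f.hom (Finsupp.single u (1 : k)) = g.hom (Finsupp.single u (1 : k))) :
    f = g := by
  refine Rep.hom_ext (Representation.IntertwiningMap.ext ?_)
  exact Finsupp.lhom_ext' fun u => LinearMap.ext_ring (h u)

variable (k) in
/-- A map between tuples that commutes with right multiplications as a morphism of
representations. -/
abbrev tupleMapHom {m n : ℕ} (f : (Fin m → G) → (Fin n → G))
    (hf : ∀ h, Commute h x → ∀ u, f (mulTuple u h) = mulTuple (f u) h) :
    tupleRep k x m ⟶ tupleRep k x n :=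
  tupleHom x (tupleMap k f) fun h hh => by
    rw [tupleMap_comp, tupleMap_comp]
    congr 1
    funext u
    exact hf h hh u

variable (k)

/-- The paracyclic representation of chains of `G` with the twisted rotation. -/
def tupleParacyclic : ParacyclicObject (Rep.{u} k (Subgroup.centralizer {x})) where
  obj n := tupleRep k x (n + 1)
  d n i := tupleMapHom k x (Fin.removeNth i) fun _ _ _ => rfl
  t n := tupleMapHom k x (rotateTuple x) fun _ hh u => rotateTuple_mulTuple x u hh
  d_comp_d n i j h := tupleRep_hom_ext x fun u => by
    change tupleMap k (Fin.removeNth i) (tupleMap k (Fin.removeNth j.succ) (Finsupp.single u 1)) =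
      tupleMap k (Fin.removeNth j) (tupleMap k (Fin.removeNth i.castSucc) (Finsupp.single u 1))
    rw [tupleMap_single, tupleMap_single, tupleMap_single, tupleMap_single,
      removeNth_removeNth_of_le h]
  t_comp_d_succ n i := tupleRep_hom_ext x fun u => by
    change tupleMap k (Fin.removeNth i.succ) (tupleMap k (rotateTuple x) (Finsupp.single u 1)) =
      tupleMap k (rotateTuple x) (tupleMap k (Fin.removeNth i.castSucc) (Finsupp.single u 1))
    rw [tupleMap_single, tupleMap_single, tupleMap_single, tupleMap_single,
      removeNth_succ_rotateTuple]
  t_comp_d_zero n := tupleRep_hom_ext x fun u => by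
    change tupleMap k (Fin.removeNth 0) (tupleMap k (rotateTuple x) (Finsupp.single u 1)) =
      tupleMap k (Fin.removeNth (Fin.last (n + 1))) (Finsupp.single u 1)
    rw [tupleMap_single, tupleMap_single, tupleMap_single, removeNth_zero_rotateTuple]

lemma tupleParacyclic_b_apply (n : ℕ) (z : (Fin (n + 2) → G) →₀ k) :
    ((tupleParacyclic k x).b k n).hom z = tupleD k G (n + 1) z := by
  rw [tupleD, LinearMap.sum_apply]
  exact rep_sum_hom_apply Finset.univ
    (fun i : Fin (n + 2) => (-1 : k) ^ (i : ℕ) • (tupleParacyclic k x).d n i) z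

variable (G) in
/-- The differential of the augmented standard complex without the last face. -/
def tupleD' (n : ℕ) : ((Fin (n + 1) → G) →₀ k) →ₗ[k] ((Fin n → G) →₀ k) :=
  ∑ i : Fin n, (-1 : k) ^ (i : ℕ) • tupleMap k (Fin.removeNth i.castSucc)

lemma tupleD'_single (n : ℕ) (u : Fin (n + 1) → G) :
    tupleD' k G n (Finsupp.single u 1) =
      ∑ i : Fin n, (-1 : k) ^ (i : ℕ) • Finsupp.single (Fin.removeNth i.castSucc u) 1 := by
  simp only [tupleD', LinearMap.sum_apply, LinearMap.smul_apply, tupleMap_single]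

lemma tupleParacyclic_b'_apply (n : ℕ) (z : (Fin (n + 2) → G) →₀ k) :
    ((tupleParacyclic k x).b' k n).hom z = tupleD' k G (n + 1) z := by
  rw [tupleD', LinearMap.sum_apply]
  exact rep_sum_hom_apply Finset.univ
    (fun i : Fin (n + 1) => (-1 : k) ^ (i : ℕ) • (tupleParacyclic k x).d n i.castSucc) z

lemma tupleParacyclic_sgnT_apply (n : ℕ) (z : (Fin (n + 1) → G) →₀ k) :
    ((tupleParacyclic k x).sgnT k n).hom z = (-1 : k) ^ n • tupleMap k (rotateTuple x) z := rfl

lemma iterate_tupleMap {n : ℕ} (f : (Fin n → G) → (Fin n → G)) (j : ℕ) (z : (Fin n → G) →₀ k) :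
    (tupleMap k f)^[j] z = tupleMap k f^[j] z := by
  induction j with
  | zero => exact (LinearMap.congr_fun (tupleMap_id k) z).symm
  | succ j ih =>
    rw [Function.iterate_succ_apply', ih, Function.iterate_succ', ← tupleMap_comp,
      LinearMap.comp_apply]

/-- The group acts by right multiplication with inverses, so the factor `x` gained in a full turn is
the action of `x⁻¹`. -/
lemma tupleParacyclic_t_iterate (n : ℕ) (z : (Fin (n + 1) → G) →₀ k) :
    (((tupleParacyclic k x).t n).hom)^[n + 1] z =
      (tupleRep k x (n + 1)).ρ (selfCentralizer x)⁻¹ z := by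
  refine (iterate_tupleMap k (rotateTuple x) (n + 1) z).trans ?_
  rw [tupleRep_ρ_apply]
  congr 2
  funext u
  rw [rotateTuple_iterate_succ]
  simp [selfCentralizer]

/-- The repetition of the last entry in front of a tuple. -/
def consLast {n : ℕ} (u : Fin (n + 1) → G) : Fin (n + 2) → G := Fin.cons (u (Fin.last n)) u

lemma tupleD'_consLast_zero (z : (Fin 1 → G) →₀ k) : tupleD' k G 1 (tupleMap k consLast z) = z := by
  refine LinearMap.congr_fun (f := tupleD' k G 1 ∘ₗ tupleMap k consLast) (g := LinearMap.id) ?_ z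
  refine Finsupp.lhom_ext' fun u => LinearMap.ext_ring ?_
  change tupleD' k G 1 (tupleMap k consLast (Finsupp.single u 1)) = Finsupp.single u 1
  rw [tupleMap_single, tupleD'_single, Fin.sum_univ_one]
  simp [consLast]

/-- Repeating the last entry in front contracts `b'`: face 0 undoes it, and the other faces in `b'`
commute with it since they keep the last entry. Unlike prepending a fixed element it is equivariant,
so it survives every additive functor. -/
lemma tupleD'_consLast_succ (n : ℕ) (z : (Fin (n + 2) → G) →₀ k) :
    tupleD' k G (n + 2) (tupleMap k consLast z) +
      tupleMap k consLast (tupleD' k G (n + 1) z) = z := by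
  refine LinearMap.congr_fun (f := tupleD' k G (n + 2) ∘ₗ tupleMap k consLast +
    tupleMap k consLast ∘ₗ tupleD' k G (n + 1)) (g := LinearMap.id) ?_ z
  refine Finsupp.lhom_ext' fun u => LinearMap.ext_ring ?_
  change tupleD' k G (n + 2) (tupleMap k consLast (Finsupp.single u 1)) +
      tupleMap k consLast (tupleD' k G (n + 1) (Finsupp.single u 1)) = Finsupp.single u 1
  rw [tupleMap_single, tupleD'_single, tupleD'_single, map_sum, Fin.sum_univ_succ, add_assoc,
    ← Finset.sum_add_distrib, Finset.sum_eq_zero, add_zero]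
  · simp [consLast]
  · intro i _
    rw [map_smul, tupleMap_single, Fin.val_succ, pow_succ, mul_neg_one, neg_smul,
      neg_add_eq_zero]
    congr 2
    funext j
    cases j using Fin.cases with
    | zero =>
      rw [Fin.removeNth_apply, ← Fin.succ_castSucc, Fin.succ_succAbove_zero, consLast, consLast,
        Fin.cons_zero, Fin.cons_zero, Fin.removeNth_apply,
        Fin.succAbove_of_le_castSucc _ _ (by rw [Fin.le_def]; simp; omega), Fin.succ_last]
    | succ j =>
      rw [Fin.removeNth_apply, ← Fin.succ_castSucc, Fin.succ_succAbove_succ, consLast, consLast,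
        Fin.cons_succ, Fin.cons_succ, Fin.removeNth_apply]

/-- The contracting homotopy of `b'`. -/
def lastCons (n : ℕ) : (tupleParacyclic k x).obj n ⟶ (tupleParacyclic k x).obj (n + 1) :=
  tupleMapHom k x consLast fun h _ u => cons_mulTuple u h (u (Fin.last n))

lemma lastCons_comp_b'_zero : lastCons k x 0 ≫ (tupleParacyclic k x).b' k 0 = 𝟙 _ :=
  Rep.hom_ext (Representation.IntertwiningMap.ext (LinearMap.ext fun z =>
    (tupleParacyclic_b'_apply k x 0 _).trans (tupleD'_consLast_zero k z)))

lemma lastCons_comp_b'_succ (n : ℕ) :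
    lastCons k x (n + 1) ≫ (tupleParacyclic k x).b' k (n + 1) +
      (tupleParacyclic k x).b' k n ≫ lastCons k x n = 𝟙 _ :=
  Rep.hom_ext (Representation.IntertwiningMap.ext (LinearMap.ext fun z =>
    (congrArg₂ (fun a b : (Fin (n + 2) → G) →₀ k => a + b)
      (tupleParacyclic_b'_apply k x (n + 1) _)
      (congrArg (tupleMap k consLast) (tupleParacyclic_b'_apply k x n z))).trans
      (tupleD'_consLast_succ k n z)))

end TupleRep

/-! ### Chains fixed by the signed rotation, and the equivariant antisymmetrization -/

section Field

variable (k : Type u) [Field k] {G : Type u} [Group G] (x : G)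

/-- A fixed chain is fixed by `T^(n+1)`, which is right multiplication by `x` as `(-1)^(n(n+1)) =
1`. Its coefficients are then constant along the infinitely many tuples `u x^j`, against finite
support. -/
lemma sub_sgnT_injective (hx : ¬ IsOfFinOrder x) (n : ℕ) {z : (Fin (n + 1) → G) →₀ k}
    (hz : ((tupleParacyclic k x).sgnT k n).hom z = z) : z = 0 := by
  have h1 : ∀ j : ℕ, (tupleMap k (rotateTuple x))^[j] z = (-1 : k) ^ (n * j) • z := by
    intro j
    induction j with
    | zero => simp
    | succ j ih =>
      rw [Function.iterate_succ_apply', ih, map_smul]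
      have h2 : tupleMap k (rotateTuple x) z = (-1 : k) ^ n • z := by
        conv_rhs => rw [← hz, tupleParacyclic_sgnT_apply, smul_smul, ← mul_pow]
        simp
      rw [h2, smul_smul, ← pow_add, mul_add, mul_one]
  have h3 : tupleMap k (mulTuple · x) z = z := by
    have h := h1 (n + 1)
    rw [iterate_tupleMap, Even.neg_one_pow (Nat.even_mul_succ_self n), one_smul] at h
    rwa [show (rotateTuple x)^[n + 1] = fun u : Fin (n + 1) → G => mulTuple u x from
      funext (rotateTuple_iterate_succ x)] at h
  by_contra h0
  obtain ⟨u, hu⟩ := Finsupp.ne_iff.1 h0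
  have hinj : Function.Injective (fun u : Fin (n + 1) → G => mulTuple u x) := fun u v h =>
    funext fun i => mul_right_cancel (congrFun h i)
  have h4 : ∀ v : Fin (n + 1) → G, z (mulTuple v x) = z v := fun v => by
    conv_lhs => rw [← h3]
    exact Finsupp.mapDomain_apply hinj z v
  have h5 : ∀ j : ℕ, mulTuple u (x ^ j) ∈ z.support := by
    intro j
    rw [Finsupp.mem_support_iff]
    induction j with
    | zero => rw [pow_zero, mulTuple_one]; exact hu
    | succ j ih => rw [pow_succ, ← mulTuple_mulTuple, h4]; exact ih
  refine hx (isOfFinOrder_iff_pow_eq_one.2 ?_)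
  have h6 : ¬ Function.Injective fun j : ℕ => (⟨_, h5 j⟩ : z.support) :=
    not_injective_infinite_finite _
  rw [Function.Injective] at h6
  push Not at h6
  obtain ⟨a, b, hab, hne⟩ := h6
  have h7 : x ^ a = x ^ b := mul_left_cancel (congrFun (Subtype.ext_iff.1 hab) 0)
  rcases lt_or_gt_of_ne hne with h | h
  · exact ⟨b - a, by omega, by rw [pow_sub _ h.le, h7, mul_inv_cancel]⟩
  · exact ⟨a - b, by omega, by rw [pow_sub _ h.le, h7, mul_inv_cancel]⟩

variable [CharZero k]

/-- The antisymmetrization as an endomorphism of the paracyclic representation. -/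
def antisymmHom (N n : ℕ) : (tupleParacyclic k x).obj n ⟶ (tupleParacyclic k x).obj n :=
  tupleHom x (antisymm k x N (n + 1)) fun _ hh => antisymm_mulTuple k x N hh (n + 1)

lemma b_comp_antisymmHom {N : ℕ} (hN : N ≠ 0) (n : ℕ) :
    (tupleParacyclic k x).b k n ≫ antisymmHom k x N n =
      antisymmHom k x N (n + 1) ≫ (tupleParacyclic k x).b k n := by
  refine Rep.hom_ext (Representation.IntertwiningMap.ext (LinearMap.ext fun z => ?_))
  have h := LinearMap.congr_fun (tupleD_antisymm k x hN (n + 1)) z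
  exact ((congrArg (antisymm k x N (n + 1)) (tupleParacyclic_b_apply k x n z)).trans h.symm).trans
    (tupleParacyclic_b_apply k x n _).symm

lemma sgnT_comp_antisymmHom {N : ℕ} (hN : x ^ N = 1) (n : ℕ) :
    (tupleParacyclic k x).sgnT k n ≫ antisymmHom k x N n = antisymmHom k x N n := by
  refine tupleRep_hom_ext x fun u => ?_
  change antisymm k x N (n + 1) ((-1 : k) ^ n • tupleMap k (rotateTuple x) (Finsupp.single u 1)) =
    antisymm k x N (n + 1) (Finsupp.single u 1)
  rw [map_smul, tupleMap_single, antisymm_rotateTuple k x hN, smul_smul, ← mul_pow]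
  simp

end Field

/-! ### Group homology from an arbitrary projective resolution -/

section Resolution

variable {k Γ : Type u} [CommRing k] [Group Γ]

lemma rep_exact (S : ShortComplex (Rep.{u} k Γ)) (h : ∀ z, S.g.hom z = 0 → ∃ y, S.f.hom y = z) :
    S.Exact := by
  apply (forget₂ _ (ModuleCat.{u} k)).reflects_exact_of_faithful
  rw [ShortComplex.moduleCat_exact_iff]
  exact h

/-- A sequence of projective representations over the trivial representation. -/
structure RepResolution (k Γ : Type u) [CommRing k] [Group Γ] where
  X : ℕ → Rep.{u} k Γ
  d : ∀ n, X (n + 1) ⟶ X n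
  ε : X 0 ⟶ Rep.trivial k Γ k
  projective : ∀ n, Projective (X n)
  d_comp_d : ∀ n, d (n + 1) ≫ d n = 0
  d_comp_ε : d 0 ≫ ε = 0
  surjective : Function.Surjective ε.hom
  exact_zero : ∀ z, ε.hom z = 0 → ∃ y, (d 0).hom y = z
  exact_succ : ∀ n z, (d n).hom z = 0 → ∃ y, (d (n + 1)).hom y = z

namespace RepResolution

variable (R : RepResolution k Γ)

/-- The complex underlying a resolution. -/
def complex : ChainComplex (Rep.{u} k Γ) ℕ := ChainComplex.of R.X R.d R.d_comp_d

lemma complex_d (n : ℕ) : R.complex.d (n + 1) n = R.d n := ChainComplex.of_d R.X R.d n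

/-- The augmentation. -/
def π : R.complex ⟶ (ChainComplex.single₀ (Rep k Γ)).obj (Rep.trivial k Γ k) :=
  (R.complex.toSingle₀Equiv _).symm ⟨R.ε, by
    rw [R.complex_d]
    exact R.d_comp_ε⟩

lemma π_f_zero : R.π.f 0 = R.ε := ChainComplex.toSingle₀Equiv_symm_apply_f_zero _ _

lemma quasiIso_π : QuasiIso R.π where
  quasiIsoAt m := by
    induction m with
    | zero =>
      rw [ChainComplex.quasiIsoAt₀_iff, ShortComplex.quasiIso_iff_of_zeros' _ rfl rfl rfl]
      constructor
      · refine rep_exact _ fun z hz => ?_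
        obtain ⟨y, hy⟩ := R.exact_zero z
          ((congrArg (fun f => Rep.Hom.hom f z) R.π_f_zero).symm.trans hz)
        exact ⟨y, (congrArg (fun f => Rep.Hom.hom f y) (R.complex_d 0)).trans hy⟩
      · refine (Rep.epi_iff_surjective _).2 fun r => ?_
        obtain ⟨y, hy⟩ := R.surjective r
        exact ⟨y, (congrArg (fun f => Rep.Hom.hom f y) R.π_f_zero).trans hy⟩
    | succ m _ =>
      rw [quasiIsoAt_iff_exactAt' (hL := ChainComplex.exactAt_succ_single_obj ..),
        HomologicalComplex.exactAt_iff' _ (m + 2) (m + 1) m (by simp) (by simp)]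
      refine rep_exact _ fun z hz => ?_
      obtain ⟨y, hy⟩ := R.exact_succ m z
        ((congrArg (fun f => Rep.Hom.hom f z) (R.complex_d m)).symm.trans hz)
      exact ⟨y, (congrArg (fun f => Rep.Hom.hom f y) (R.complex_d (m + 1))).trans hy⟩

/-- The resolution as a projective resolution of the trivial representation. -/
def toProjectiveResolution : ProjectiveResolution (Rep.trivial k Γ k) where
  complex := R.complex
  projective n := R.projective n
  π := R.π
  quasiIso := R.quasiIso_π

/-- Group homology is a derived functor of coinvariants, so any projective resolution of the trivial
representation computes it. -/
lemma nonempty_groupHomology_equiv (V : Rep.{u} k Γ) (n : ℕ) :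
    Nonempty (groupHomology V n ≃ₗ[k]
      Homology (X := fun n => ((Rep.coinvariantsTensor k Γ).obj V).obj (R.X n))
        (fun n => (((Rep.coinvariantsTensor k Γ).obj V).map (R.d n)).hom) n) := by
  classical
  let e := homologyEquiv (R.complex.coinvariantsTensorObj V)
    (fun n => (((Rep.coinvariantsTensor k Γ).obj V).map (R.d n)).hom) (fun n =>
      congrArg (fun f => (((Rep.coinvariantsTensor k Γ).obj V).map f).hom) (R.complex_d n)) n
  exact ⟨(groupHomologyIso V n R.toProjectiveResolution).toLinearEquiv ≪≫ₗ e⟩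

/-- The comparison theorem: the endomorphism and the identity both lift the identity of the trivial
representation, hence are homotopic. -/
lemma exists_homotopy (a : ∀ n, R.X n ⟶ R.X n) (ha : ∀ n, R.d n ≫ a n = a (n + 1) ≫ R.d n)
    (haε : a 0 ≫ R.ε = R.ε) : ∃ h : ∀ n, R.X n ⟶ R.X (n + 1),
      a 0 = 𝟙 _ + h 0 ≫ R.d 0 ∧
      ∀ n, a (n + 1) = 𝟙 _ + h (n + 1) ≫ R.d (n + 1) + R.d n ≫ h n := by
  let P := R.toProjectiveResolution
  let f : R.complex ⟶ R.complex :=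
    { f := a
      comm' := by
        rintro i j ⟨rfl⟩
        rw [R.complex_d]
        exact (ha _).symm }
  let H : Homotopy f (𝟙 R.complex) := ProjectiveResolution.liftHomotopy (P := P) (Q := P)
    (𝟙 (Rep.trivial k Γ k)) f (𝟙 _) (by
      refine HomologicalComplex.to_single_hom_ext ?_
      rw [CategoryTheory.Functor.map_id, Category.comp_id]
      change a 0 ≫ R.π.f 0 = R.π.f 0
      rw [R.π_f_zero]
      exact haε) (by simp)
  refine ⟨fun n => H.hom n (n + 1), ?_, fun n => ?_⟩
  · have := H.comm 0
    rw [dNext_eq_zero _ _ (by simp), Homotopy.prevD_chainComplex, R.complex_d, zero_add,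
      add_comm] at this
    exact this
  · have := H.comm (n + 1)
    rw [Homotopy.dNext_succ_chainComplex, Homotopy.prevD_chainComplex, R.complex_d, R.complex_d]
      at this
    exact this.trans ((show ∀ a b c : R.X (n + 1) ⟶ R.X (n + 1), a + b + c = c + b + a from
      fun a b c => by abel) _ _ _)

/-- Additive functors preserve homotopies, so `a` still induces the identity on homology after `F`,
although `F` need not be exact. -/
lemma map_sub_mem_range (F : Rep.{u} k Γ ⥤ ModuleCat.{u} k) [F.Additive]
    (a : ∀ n, R.X n ⟶ R.X n) (ha : ∀ n, R.d n ≫ a n = a (n + 1) ≫ R.d n)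
    (haε : a 0 ≫ R.ε = R.ε) (n : ℕ) (z : F.obj (R.X n))
    (hz : z ∈ cycles (X := fun n => F.obj (R.X n)) (fun n => (F.map (R.d n)).hom) n) :
    (F.map (a n)).hom z - z ∈ LinearMap.range (F.map (R.d n)).hom := by
  obtain ⟨h, h0, h1⟩ := R.exists_homotopy a ha haε
  cases n with
  | zero =>
    rw [h0, F.map_add, F.map_id, F.map_comp]
    exact ⟨(F.map (h 0)).hom z, (add_sub_cancel_left _ _).symm⟩
  | succ n =>
    rw [mem_cycles_succ] at hz
    rw [h1, F.map_add, F.map_add, F.map_id, F.map_comp, F.map_comp]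
    refine ⟨(F.map (h (n + 1))).hom z, ?_⟩
    change _ = z + (F.map (R.d (n + 1))).hom _ + (F.map (h n)).hom ((F.map (R.d n)).hom z) - z
    rw [hz, map_zero, add_zero, add_sub_cancel_left]
    rfl

end RepResolution

end Resolution

/-! ### Coinvariants under a normal subgroup -/

section Quotient

variable {k Γ : Type u} [CommRing k] [Group Γ] (S : Subgroup Γ) [S.Normal]

variable (k) in
/-- The coinvariants under a normal subgroup as a functor to representations of the quotient. -/
abbrev quotFunctor : Rep.{u} k Γ ⥤ Rep.{u} k (Γ ⧸ S) := Rep.quotientToCoinvariantsFunctor k S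

/-- The projection to the coinvariants under a normal subgroup. -/
def quotMk (X : Rep.{u} k Γ) : X →ₗ[k] (quotFunctor k S).obj X :=
  Representation.Coinvariants.mk (X.ρ.comp S.subtype)

lemma quotMk_surjective (X : Rep.{u} k Γ) : Function.Surjective (quotMk S X) :=
  Representation.Coinvariants.mk_surjective (X.ρ.comp S.subtype)

lemma quotFunctor_map_quotMk {X Y : Rep.{u} k Γ} (f : X ⟶ Y) (z : X) :
    ((quotFunctor k S).map f).hom (quotMk S X z) = quotMk S Y (f.hom z) := rfl

lemma quotFunctor_ρ_quotMk (X : Rep.{u} k Γ) (g : Γ) (z : X) :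
    ((quotFunctor k S).obj X).ρ (g : Γ ⧸ S) (quotMk S X z) = quotMk S X (X.ρ g z) := rfl

lemma quotMk_ρ (X : Rep.{u} k Γ) (g : S) (z : X) :
    quotMk S X (X.ρ (g : Γ) z) = quotMk S X z :=
  Representation.Coinvariants.mk_self_apply (X.ρ.comp S.subtype) g z

variable {S} in
lemma quotFunctor_hom_ext {X : Rep.{u} k Γ} {Y : Rep.{u} k (Γ ⧸ S)}
    {f g : (quotFunctor k S).obj X ⟶ Y}
    (h : ∀ z, f.hom (quotMk S X z) = g.hom (quotMk S X z)) : f = g := by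
  refine Rep.hom_ext (Representation.IntertwiningMap.ext (LinearMap.ext fun z => ?_))
  obtain ⟨z, rfl⟩ := quotMk_surjective S X z
  exact h z

instance : (quotFunctor k S).Additive where
  map_add := quotFunctor_hom_ext fun _ => rfl

instance : (quotFunctor k S).Linear k where
  map_smul _ _ := quotFunctor_hom_ext fun _ => rfl

/-- A morphism out of the coinvariants. -/
def quotDesc {X : Rep.{u} k Γ} {Y : Rep.{u} k (Γ ⧸ S)} (f : X →ₗ[k] Y)
    (hf : ∀ (g : Γ) (z : X), f (X.ρ g z) = Y.ρ (g : Γ ⧸ S) (f z)) :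
    (quotFunctor k S).obj X ⟶ Y :=
  Rep.ofHom (σ := Y.ρ) ⟨Representation.Coinvariants.lift (X.ρ.comp S.subtype) f fun g =>
      LinearMap.ext fun z => by
        have h : ((g : Γ) : Γ ⧸ S) = 1 := (QuotientGroup.eq_one_iff _).2 g.2
        have h2 := hf g z
        rw [h, map_one] at h2
        exact h2, fun g => by
    induction g using QuotientGroup.induction_on with
    | H g =>
      refine LinearMap.ext fun z => ?_
      obtain ⟨z, rfl⟩ := quotMk_surjective S X z
      exact hf g z⟩

/-- For a cyclic group every `g - 1` has its image inside that of `1 - s⁻¹`, by induction on the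
exponent. The inverse appears because a full turn of the rotation acts as `x⁻¹`. -/
lemma exists_of_quotMk_eq_zero {s : Γ} (hs : S = Subgroup.zpowers s) (X : Rep.{u} k Γ) {z : X}
    (hz : quotMk S X z = 0) : ∃ y, z = y - X.ρ s⁻¹ y := by
  have h1 : ∀ g ∈ Subgroup.zpowers s, ∀ y : X,
      X.ρ g y - y ∈ LinearMap.range (LinearMap.id - X.ρ s⁻¹) := by
    have h2 : ∀ y : X, X.ρ s y - y ∈ LinearMap.range (LinearMap.id - X.ρ s⁻¹) := fun y =>
      ⟨X.ρ s y, by simp⟩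
    have h3 : ∀ y : X, X.ρ s⁻¹ y - y ∈ LinearMap.range (LinearMap.id - X.ρ s⁻¹) := fun y =>
      ⟨-y, by simp; abel⟩
    intro g hg
    obtain ⟨i, rfl⟩ := Subgroup.mem_zpowers_iff.1 hg
    induction i using Int.induction_on with
    | zero => simp
    | succ i ih =>
      intro y
      have := add_mem (ih (Subgroup.zpow_mem_zpowers _ _) (X.ρ s y)) (h2 y)
      rw [zpow_add_one, map_mul]
      simpa using this
    | pred i ih =>
      intro y
      have := add_mem (ih (Subgroup.zpow_mem_zpowers _ _) (X.ρ s⁻¹ y)) (h3 y)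
      rw [zpow_sub_one, map_mul]
      simpa using this
  have h4 : Representation.Coinvariants.ker (X.ρ.comp S.subtype) ≤
      LinearMap.range (LinearMap.id - X.ρ s⁻¹) := by
    refine Submodule.span_le.2 ?_
    rintro _ ⟨⟨g, y⟩, rfl⟩
    exact h1 g (hs ▸ g.2) y
  obtain ⟨y, hy⟩ := h4 ((Representation.Coinvariants.mk_eq_zero _).1 hz)
  exact ⟨y, hy.symm⟩

end Quotient

/-! ### Exactness of coinvariants under a finite cyclic group -/

section FiniteOrder

variable {k Γ : Type u} [Field k] [CharZero k] [Group Γ] (S : Subgroup Γ) [S.Normal]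

/-- The required representative is the average of `z` over the powers of `s`. It has the same class,
and its image is the average of an element `y - s⁻¹y`, which is zero. -/
lemma exists_quotMk_eq_of_map_eq_zero {s : Γ} (hs : S = Subgroup.zpowers s) (h : IsOfFinOrder s)
    {X Y : Rep.{u} k Γ} (f : X ⟶ Y) {z : X}
    (hz : ((quotFunctor k S).map f).hom (quotMk S X z) = 0) :
    ∃ z', quotMk S X z' = quotMk S X z ∧ f.hom z' = 0 := by
  have hN : (orderOf s : k) ≠ 0 := Nat.cast_ne_zero.2 h.orderOf_pos.ne'
  rw [quotFunctor_map_quotMk] at hz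
  obtain ⟨y, hy⟩ := exists_of_quotMk_eq_zero S hs Y hz
  refine ⟨(orderOf s : k)⁻¹ • ∑ a ∈ Finset.range (orderOf s), X.ρ (s ^ a) z, ?_, ?_⟩
  · have h1 : ∀ a : ℕ, quotMk S X (X.ρ (s ^ a) z) = quotMk S X z := fun a =>
      quotMk_ρ S X ⟨s ^ a, hs ▸ Subgroup.npow_mem_zpowers s a⟩ z
    rw [map_smul, map_sum]
    simp only [h1]
    rw [Finset.sum_const, Finset.card_range, ← Nat.cast_smul_eq_nsmul k, inv_smul_smul₀ hN]
  · rw [map_smul, map_sum]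
    have h1 : ∀ a, f.hom (X.ρ (s ^ a) z) = Y.ρ (s ^ a) (f.hom z) := fun a =>
      Rep.hom_comm_apply f (s ^ a) z
    simp only [h1]
    have h2 : ∀ a, Y.ρ (s ^ a) (f.hom z) =
        Y.ρ (s ^ a) y - Y.ρ (s ^ a) (Y.ρ s⁻¹ y) := fun a => by
      conv_lhs => rw [hy]
      rw [map_sub]
    simp only [h2]
    have h3 : ∑ a ∈ Finset.range (orderOf s), Y.ρ (s ^ a) (Y.ρ s⁻¹ y) =
        ∑ a ∈ Finset.range (orderOf s), Y.ρ (s ^ a) y := by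
      have h4 : ∀ a, Y.ρ (s ^ (a + 1)) (Y.ρ s⁻¹ y) = Y.ρ (s ^ a) y := fun a => by
        rw [← LinearMap.comp_apply, ← Rep.ρ_mul, pow_succ, mul_inv_cancel_right]
      obtain ⟨N, hN'⟩ := Nat.exists_eq_succ_of_ne_zero h.orderOf_pos.ne'
      rw [hN', Finset.sum_range_succ', Finset.sum_range_succ]
      simp only [h4]
      congr 1
      rw [← LinearMap.comp_apply, ← Rep.ρ_mul, pow_zero, one_mul]
      congr 2
      rw [inv_eq_iff_mul_eq_one, ← pow_succ', ← Nat.succ_eq_add_one, ← hN', pow_orderOf_eq_one]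
    rw [Finset.sum_sub_distrib, h3, sub_self, smul_zero]

end FiniteOrder

/-! ### Projectivity of the coinvariants of chains -/

section Projective

variable (k : Type u) [CommRing k] {G : Type u} [Group G] (x : G)

/-- A retraction of `G` onto the centralizer of `x` that commutes with right multiplication by
elements of the centralizer. -/
def centralizerRetraction (a : G) : Subgroup.centralizer {x} :=
  ⟨(Quotient.out (a : G ⧸ Subgroup.centralizer {x}))⁻¹ * a, by
    rw [← QuotientGroup.eq]
    exact Quotient.out_eq _⟩

lemma centralizerRetraction_mul (a : G) (h : Subgroup.centralizer {x}) :
    centralizerRetraction x (a * h) = centralizerRetraction x a * h := by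
  have h1 : ((a * (h : G) : G) : G ⧸ Subgroup.centralizer {x}) = (a : G ⧸ _) := by
    rw [eq_comm, QuotientGroup.eq, inv_mul_cancel_left]
    exact h.2
  refine Subtype.ext ?_
  change (Quotient.out ((a * (h : G) : G) : G ⧸ Subgroup.centralizer {x}))⁻¹ * (a * h) =
    (Quotient.out (a : G ⧸ Subgroup.centralizer {x}))⁻¹ * a * h
  rw [h1, mul_assoc]

/-- The centralizer acts freely on nonempty tuples. Each tuple `u` is normalized by multiplying with
the inverse of the centralizer part `κ (u 0)` of its first entry. Arbitrary lifts on normalized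
tuples are then spread over the orbits by the action, which makes the lift equivariant. -/
instance projective_quotFunctor_tupleRep (n : ℕ) :
    Projective ((quotFunctor k (zpowersSelf x)).obj (tupleRep k x (n + 1))) where
  factors {E Y} f e he := by
    have he' := (Rep.epi_iff_surjective e).1 he
    choose l hl using fun v : Fin (n + 1) → G =>
      he' (f.hom (quotMk (zpowersSelf x) (tupleRep k x (n + 1)) (Finsupp.single v (1 : k))))
    let κ := centralizerRetraction x
    let ℓ : ((Fin (n + 1) → G) →₀ k) →ₗ[k] E := Finsupp.linearCombination k fun u =>
      E.ρ (((κ (u 0))⁻¹ : Subgroup.centralizer {x}) : Subgroup.centralizer {x} ⧸ zpowersSelf x)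
        (l (mulTuple u (κ (u 0) : G)⁻¹))
    have hℓ : ∀ u, ℓ (Finsupp.single u 1) =
        E.ρ (((κ (u 0))⁻¹ : Subgroup.centralizer {x}) : Subgroup.centralizer {x} ⧸ zpowersSelf x)
        (l (mulTuple u (κ (u 0) : G)⁻¹)) := fun u => by
      rw [Finsupp.linearCombination_single, one_smul]
    have hℓ' : ∀ (g : Subgroup.centralizer {x}) (z : tupleRep k x (n + 1)),
        ℓ ((tupleRep k x (n + 1)).ρ g z) =
          E.ρ (g : Subgroup.centralizer {x} ⧸ zpowersSelf x) (ℓ z) := by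
      intro g z
      refine LinearMap.congr_fun (f := ℓ ∘ₗ tupleRepresentation k x (n + 1) g)
        (g := E.ρ (g : Subgroup.centralizer {x} ⧸ zpowersSelf x) ∘ₗ ℓ) ?_ z
      refine Finsupp.lhom_ext' fun u => LinearMap.ext_ring ?_
      change ℓ (tupleMap k (mulTuple · (g : G)⁻¹) (Finsupp.single u 1)) =
        E.ρ (g : Subgroup.centralizer {x} ⧸ zpowersSelf x) (ℓ (Finsupp.single u 1))
      have h1 : κ (mulTuple u (g : G)⁻¹ 0) = κ (u 0) * g⁻¹ :=
        centralizerRetraction_mul x (u 0) g⁻¹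
      rw [tupleMap_single, hℓ, hℓ, h1, mulTuple_mulTuple, ← LinearMap.comp_apply, ← Rep.ρ_mul,
        ← QuotientGroup.mk_mul]
      congr 3
      · simp
      · simp
    refine ⟨quotDesc (zpowersSelf x) ℓ hℓ', quotFunctor_hom_ext fun z => ?_⟩
    refine LinearMap.congr_fun (f := e.hom.toLinearMap ∘ₗ ℓ)
      (g := f.hom.toLinearMap ∘ₗ quotMk (zpowersSelf x) (tupleRep k x (n + 1))) ?_ z
    refine Finsupp.lhom_ext' fun u => LinearMap.ext_ring ?_
    change e.hom (ℓ (Finsupp.single u 1)) =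
      f.hom (quotMk (zpowersSelf x) (tupleRep k x (n + 1)) (Finsupp.single u (1 : k)))
    rw [hℓ, Rep.hom_comm_apply]
    refine (congrArg _ (hl _)).trans ?_
    rw [← Rep.hom_comm_apply, quotFunctor_ρ_quotMk, tupleRep_ρ_apply, tupleMap_single,
      mulTuple_mulTuple]
    simp [mulTuple_one]

end Projective

/-! ### Differentials of the image of a paracyclic object -/

namespace ParacyclicObject

variable (k : Type*) [CommRing k] {𝒞 𝒟 : Type*} [Category 𝒞] [Preadditive 𝒞] [Linear k 𝒞]
  [Category 𝒟] [Preadditive 𝒟] [Linear k 𝒟] (X : ParacyclicObject 𝒞)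

lemma map_b (F : 𝒞 ⥤ 𝒟) [F.Additive] [F.Linear k] (n : ℕ) :
    (X.map F).b k n = F.map (X.b k n) := by
  simp only [b, F.map_sum, F.map_smul]
  rfl

lemma map_b' (F : 𝒞 ⥤ 𝒟) [F.Additive] [F.Linear k] (n : ℕ) :
    (X.map F).b' k n = F.map (X.b' k n) := by
  simp only [b', F.map_sum, F.map_smul]
  rfl

lemma map_sgnT (F : 𝒞 ⥤ 𝒟) [F.Additive] [F.Linear k] (n : ℕ) :
    (X.map F).sgnT k n = F.map (X.sgnT k n) := by
  simp only [sgnT, F.map_smul]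
  rfl

/-- Only the relations between faces and rotation enter, not the order of the rotation, so this is
available on chains before taking coinvariants. -/
lemma id_sub_sgnT_comp_b (n : ℕ) :
    (𝟙 _ - X.sgnT k (n + 1)) ≫ X.b k n = X.b' k n ≫ (𝟙 _ - X.sgnT k n) := by
  have h1 : X.b k n = X.b' k n + (-1 : k) ^ (n + 1) • X.d n (Fin.last (n + 1)) := by
    rw [b, Fin.sum_univ_castSucc]
    rfl
  have h2 : X.sgnT k (n + 1) ≫ X.b k n =
      (-1 : k) ^ (n + 1) • X.d n (Fin.last (n + 1)) + X.b' k n ≫ X.sgnT k n := by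
    rw [b, Fin.sum_univ_succ, Preadditive.comp_add, sgnT, b', Preadditive.comp_sum,
      Preadditive.sum_comp]
    congr 1
    · rw [Linear.smul_comp, Linear.comp_smul, X.t_comp_d_zero]
      simp
    · refine Finset.sum_congr rfl fun i _ => ?_
      rw [Linear.smul_comp, Linear.comp_smul, X.t_comp_d_succ, sgnT, Linear.smul_comp,
        Linear.comp_smul, smul_smul, smul_smul, Fin.val_succ, ← pow_add, ← pow_add]
      rw [show n + 1 + (i + 1) = i + n + 2 by ring, pow_add _ _ 2]
      simp
  rw [Preadditive.sub_comp, h2, h1, Preadditive.comp_sub, Category.id_comp, Category.comp_id]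
  abel

end ParacyclicObject

/-! ### The cyclic object of coinvariants and its augmentation -/

section Augmentation

variable (k : Type u) [CommRing k] {G : Type u} [Group G] (x : G)

lemma tupleD_comp_tupleD (n : ℕ) : tupleD k G n ∘ₗ tupleD k G (n + 1) = 0 :=
  PrecyclicModule.sum_comp_sum_eq_zero (n + 1) (fun i => tupleMap k (Fin.removeNth i))
    (fun i => tupleMap k (Fin.removeNth i)) fun i j h => by
      refine Finsupp.lhom_ext' fun u => LinearMap.ext_ring ?_
      change tupleMap k (Fin.removeNth i) (tupleMap k (Fin.removeNth j.succ) (Finsupp.single u 1)) =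
        tupleMap k (Fin.removeNth j) (tupleMap k (Fin.removeNth i.castSucc) (Finsupp.single u 1))
      rw [tupleMap_single, tupleMap_single, tupleMap_single, tupleMap_single]
      congr 1
      cases n with
      | zero => exact Subsingleton.elim _ _
      | succ n => exact removeNth_removeNth_of_le h u

lemma tupleParacyclic_b_comp_b (n : ℕ) :
    (tupleParacyclic k x).b k (n + 1) ≫ (tupleParacyclic k x).b k n = 0 := by
  refine Rep.hom_ext (Representation.IntertwiningMap.ext (LinearMap.ext fun z => ?_))
  have h := LinearMap.congr_fun (tupleD_comp_tupleD k (G := G) (n + 1)) z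
  exact ((tupleParacyclic_b_apply k x n _).trans
    (congrArg (tupleD k G (n + 1)) (tupleParacyclic_b_apply k x (n + 1) z))).trans h

lemma exists_tupleParacyclic_b_eq {n : ℕ} {z : (tupleParacyclic k x).obj (n + 1)}
    (hz : ((tupleParacyclic k x).b k n).hom z = 0) :
    ∃ y, ((tupleParacyclic k x).b k (n + 1)).hom y = z := by
  obtain ⟨y, hy⟩ := exists_tupleD_eq k ((tupleParacyclic_b_apply k x n z).symm.trans hz)
  exact ⟨y, (tupleParacyclic_b_apply k x (n + 1) y).trans hy⟩

variable (G) in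
/-- The sum of the coefficients. -/
def sumCoeff (n : ℕ) : ((Fin n → G) →₀ k) →ₗ[k] k := Finsupp.linearCombination k fun _ => 1

lemma sumCoeff_single (n : ℕ) (u : Fin n → G) : sumCoeff k G n (Finsupp.single u 1) = 1 := by
  rw [sumCoeff, Finsupp.linearCombination_single, one_smul]

lemma sumCoeff_tupleMap {m n : ℕ} (f : (Fin m → G) → (Fin n → G)) (z : (Fin m → G) →₀ k) :
    sumCoeff k G n (tupleMap k f z) = sumCoeff k G m z := by
  refine LinearMap.congr_fun (f := sumCoeff k G n ∘ₗ tupleMap k f) (g := sumCoeff k G m) ?_ z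
  refine Finsupp.lhom_ext' fun u => LinearMap.ext_ring ?_
  change sumCoeff k G n (tupleMap k f (Finsupp.single u 1)) = sumCoeff k G m (Finsupp.single u 1)
  rw [tupleMap_single, sumCoeff_single, sumCoeff_single]

lemma sumCoeff_tupleD (z : (Fin 2 → G) →₀ k) : sumCoeff k G 1 (tupleD k G 1 z) = 0 := by
  rw [tupleD, LinearMap.sum_apply, Fin.sum_univ_two, map_add, LinearMap.smul_apply,
    LinearMap.smul_apply, map_smul, map_smul, sumCoeff_tupleMap, sumCoeff_tupleMap]
  simp

lemma tupleD_zero_eq (z : (Fin 1 → G) →₀ k) :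
    tupleD k G 0 z = Finsupp.single default (sumCoeff k G 1 z) := by
  refine LinearMap.congr_fun (f := tupleD k G 0)
    (g := Finsupp.lsingle default ∘ₗ sumCoeff k G 1) ?_ z
  refine Finsupp.lhom_ext' fun u => LinearMap.ext_ring ?_
  change tupleD k G 0 (Finsupp.single u 1) =
    Finsupp.single default (sumCoeff k G 1 (Finsupp.single u 1))
  rw [tupleD_single, Fin.sum_univ_one, sumCoeff_single,
    Subsingleton.elim (Fin.removeNth _ u) default]
  simp

/-- The paracyclic representation of the quotient of the centralizer of `x` by the powers of `x`
on the coinvariants of the chains of `G`. -/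
def quotParacyclic :
    ParacyclicObject (Rep.{u} k (Subgroup.centralizer {x} ⧸ zpowersSelf x)) :=
  (tupleParacyclic k x).map (quotFunctor k (zpowersSelf x))

instance (n : ℕ) : Projective ((quotParacyclic k x).obj n) :=
  projective_quotFunctor_tupleRep k x n

lemma zpowersSelf_eq : zpowersSelf x = Subgroup.zpowers (selfCentralizer x) := rfl

/-- The projection from chains to coinvariants. -/
abbrev chainMk (n : ℕ) : (tupleParacyclic k x).obj n →ₗ[k] (quotParacyclic k x).obj n :=
  quotMk (zpowersSelf x) _

lemma quotParacyclic_b (n : ℕ) : (quotParacyclic k x).b k n =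
    (quotFunctor k (zpowersSelf x)).map ((tupleParacyclic k x).b k n) :=
  ParacyclicObject.map_b k _ _ n

lemma quotParacyclic_b' (n : ℕ) : (quotParacyclic k x).b' k n =
    (quotFunctor k (zpowersSelf x)).map ((tupleParacyclic k x).b' k n) :=
  ParacyclicObject.map_b' k _ _ n

lemma quotParacyclic_sgnT (n : ℕ) : (quotParacyclic k x).sgnT k n =
    (quotFunctor k (zpowersSelf x)).map ((tupleParacyclic k x).sgnT k n) :=
  ParacyclicObject.map_sgnT k _ _ n

lemma quotParacyclic_b_chainMk (n : ℕ) (z : (tupleParacyclic k x).obj (n + 1)) :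
    ((quotParacyclic k x).b k n).hom (chainMk k x (n + 1) z) =
      chainMk k x n (((tupleParacyclic k x).b k n).hom z) := by
  rw [quotParacyclic_b]
  rfl

lemma quotParacyclic_sgnT_chainMk (n : ℕ) (z : (tupleParacyclic k x).obj n) :
    ((quotParacyclic k x).sgnT k n).hom (chainMk k x n z) =
      chainMk k x n (((tupleParacyclic k x).sgnT k n).hom z) := by
  rw [quotParacyclic_sgnT]
  rfl

/-- A full turn is the action of `x⁻¹`, which is trivial on `⟨x⟩`-coinvariants: the paracyclic
object has become cyclic. -/
lemma quotParacyclic_t_pow (n : ℕ) : End.of ((quotParacyclic k x).t n) ^ (n + 1) = 1 := by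
  have h : ∀ (j : ℕ) (z : (tupleParacyclic k x).obj n),
      Rep.Hom.hom (End.of ((quotParacyclic k x).t n) ^ j).asHom (chainMk k x n z) =
        chainMk k x n ((((tupleParacyclic k x).t n).hom)^[j] z) := by
    intro j
    induction j with
    | zero => intro z; rfl
    | succ j ih =>
      intro z
      rw [pow_succ, Function.iterate_succ_apply, ← ih]
      rfl
  refine quotFunctor_hom_ext fun z => ?_
  refine (h (n + 1) z).trans ?_
  refine (congrArg (chainMk k x n) (tupleParacyclic_t_iterate k x n z)).trans ?_
  exact quotMk_ρ (zpowersSelf x) (tupleRep k x (n + 1))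
    ⟨(selfCentralizer x)⁻¹, inv_mem (Subgroup.mem_zpowers _)⟩ z

lemma map_quotParacyclic_t_pow
    (F : Rep.{u} k (Subgroup.centralizer {x} ⧸ zpowersSelf x) ⥤ ModuleCat.{u} k) [F.Additive]
    [F.Linear k] (n : ℕ) :
    (F.map ((quotParacyclic k x).t n)).hom ^ (n + 1) = 1 := by
  have h := ParacyclicObject.map_pow_hom F (End.of ((quotParacyclic k x).t n)) (n + 1)
  rw [quotParacyclic_t_pow] at h
  refine h.symm.trans ?_
  exact congrArg ModuleCat.Hom.hom (F.map_id _)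

/-- The augmentation of the coinvariants of the chains. -/
def chainAugmentation : (quotParacyclic k x).obj 0 ⟶ Rep.trivial k _ k :=
  quotDesc (X := tupleRep k x 1) (zpowersSelf x) (sumCoeff k G 1)
    fun g z => sumCoeff_tupleMap k (mulTuple · (g : G)⁻¹) z

lemma chainAugmentation_chainMk (z : (Fin 1 → G) →₀ k) :
    (chainAugmentation k x).hom (chainMk k x 0 z) = sumCoeff k G 1 z := rfl

lemma b_comp_chainAugmentation : (quotParacyclic k x).b k 0 ≫ chainAugmentation k x = 0 := by
  refine quotFunctor_hom_ext fun z => ?_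
  change (chainAugmentation k x).hom (((quotParacyclic k x).b k 0).hom (chainMk k x 1 z)) = 0
  rw [quotParacyclic_b_chainMk]
  exact (congrArg (sumCoeff k G 1) (tupleParacyclic_b_apply k x 0 z)).trans (sumCoeff_tupleD k z)

lemma sgnT_comp_chainAugmentation :
    (quotParacyclic k x).sgnT k 0 ≫ chainAugmentation k x = chainAugmentation k x := by
  refine quotFunctor_hom_ext fun z => ?_
  change (chainAugmentation k x).hom (((quotParacyclic k x).sgnT k 0).hom (chainMk k x 0 z)) = _
  rw [quotParacyclic_sgnT_chainMk]
  refine (congrArg (sumCoeff k G 1) (tupleParacyclic_sgnT_apply k x 0 z)).trans ?_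
  rw [pow_zero, one_smul]
  exact sumCoeff_tupleMap k (rotateTuple x) z

lemma chainAugmentation_surjective : Function.Surjective (chainAugmentation k x).hom := fun r =>
  ⟨chainMk k x 0 (r • Finsupp.single 1 1 : (Fin 1 → G) →₀ k), by
    rw [chainAugmentation_chainMk, map_smul, sumCoeff_single, smul_eq_mul, mul_one]⟩

/-- In degree zero no averaging is needed, whatever the order of `x`: the coefficient sum is already
defined on coinvariants, so any representative has coefficient sum zero and bounds. -/
lemma exists_b_eq_of_chainAugmentation {z : (quotParacyclic k x).obj 0}
    (hz : (chainAugmentation k x).hom z = 0) : ∃ y, ((quotParacyclic k x).b k 0).hom y = z := by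
  obtain ⟨w, rfl⟩ := quotMk_surjective (zpowersSelf x) ((tupleParacyclic k x).obj 0) z
  have h : tupleD k G 0 w = 0 :=
    (tupleD_zero_eq k w).trans ((congrArg _ hz).trans (Finsupp.single_zero _))
  obtain ⟨y, hy⟩ := exists_tupleD_eq k h
  exact ⟨chainMk k x 1 y, (quotParacyclic_b_chainMk k x 0 y).trans
    (congrArg (chainMk k x 0) ((tupleParacyclic_b_apply k x 0 y).trans hy))⟩

lemma quotParacyclic_b_comp_b (n : ℕ) :
    (quotParacyclic k x).b k (n + 1) ≫ (quotParacyclic k x).b k n = 0 := by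
  rw [quotParacyclic_b, quotParacyclic_b]
  refine ((quotFunctor k (zpowersSelf x)).map_comp _ _).symm.trans ?_
  rw [tupleParacyclic_b_comp_b]
  exact (quotFunctor k (zpowersSelf x)).map_zero _ _

end Augmentation

/-! ### The summand of `x` with coefficients -/

section Homology

variable (k : Type u) [CommRing k] {G : Type u} [Group G] (x : G)
  (V : Rep.{u} k (Subgroup.centralizer {x} ⧸ zpowersSelf x))

/-- The precyclic module of coinvariants of the chains of `G` with coefficients. -/
abbrev coeffPrecyclic : PrecyclicModule.{u, u} k :=
  (quotParacyclic k x).toPrecyclicModule ((Rep.coinvariantsTensor k _).obj V)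
    (map_quotParacyclic_t_pow k x _)

/-- The functor that computes `coeffPrecyclic` from chains. -/
abbrev coeffFunctor : Rep.{u} k (Subgroup.centralizer {x}) ⥤ ModuleCat.{u} k :=
  quotFunctor k (zpowersSelf x) ⋙ (Rep.coinvariantsTensor k _).obj V

lemma coeffPrecyclic_b' (n : ℕ) : (coeffPrecyclic k x V).b' n =
    ((coeffFunctor k x V).map ((tupleParacyclic k x).b' k n)).hom := by
  rw [ParacyclicObject.toPrecyclicModule_b', quotParacyclic_b']
  rfl

lemma coeffPrecyclic_sgnT (n : ℕ) : (coeffPrecyclic k x V).sgnT n =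
    ((coeffFunctor k x V).map ((tupleParacyclic k x).sgnT k n)).hom := by
  rw [ParacyclicObject.toPrecyclicModule_sgnT, quotParacyclic_sgnT]
  rfl

lemma mem_range_coeffPrecyclic_b' (n : ℕ) (z : (coeffPrecyclic k x V).obj n)
    (hz : z ∈ cycles (coeffPrecyclic k x V).b' n) :
    z ∈ LinearMap.range ((coeffPrecyclic k x V).b' n) := by
  rw [coeffPrecyclic_b']
  cases n with
  | zero =>
    have h := congrArg (fun f => ((coeffFunctor k x V).map f).hom z) (lastCons_comp_b'_zero k x)
    rw [(coeffFunctor k x V).map_comp, (coeffFunctor k x V).map_id] at h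
    exact ⟨_, h⟩
  | succ n =>
    rw [mem_cycles_succ, coeffPrecyclic_b'] at hz
    have h := congrArg (fun f => ((coeffFunctor k x V).map f).hom z) (lastCons_comp_b'_succ k x n)
    rw [(coeffFunctor k x V).map_add, (coeffFunctor k x V).map_comp, (coeffFunctor k x V).map_comp,
      (coeffFunctor k x V).map_id] at h
    refine ⟨((coeffFunctor k x V).map (lastCons k x (n + 1))).hom z, Eq.trans ?_ h⟩
    refine ((add_zero _).symm.trans ?_)
    refine congrArg₂ (· + ·) rfl ?_
    refine ((congrArg ((coeffFunctor k x V).map (lastCons k x n)).hom hz).trans ?_).symm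
    exact map_zero _

end Homology

/-! ### Elements of finite order -/

section FiniteOrder

variable (k : Type u) [Field k] [CharZero k] {G : Type u} [Group G] (x : G)
  (V : Rep.{u} k (Subgroup.centralizer {x} ⧸ zpowersSelf x))

/-- The coinvariants of the chains form a resolution if `x` has finite order. -/
def finiteResolution (hx : IsOfFinOrder x) :
    RepResolution k (Subgroup.centralizer {x} ⧸ zpowersSelf x) where
  X := (quotParacyclic k x).obj
  d := (quotParacyclic k x).b k
  ε := chainAugmentation k x
  projective _ := inferInstance
  d_comp_d := quotParacyclic_b_comp_b k x
  d_comp_ε := b_comp_chainAugmentation k x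
  surjective := chainAugmentation_surjective k x
  exact_zero _ := exists_b_eq_of_chainAugmentation k x
  exact_succ n z hz := by
    obtain ⟨w, rfl⟩ := quotMk_surjective (zpowersSelf x) ((tupleParacyclic k x).obj (n + 1)) z
    have hs : IsOfFinOrder (selfCentralizer x) :=
      Submonoid.isOfFinOrder_coe.1 hx
    rw [quotParacyclic_b] at hz
    -- Finite order enters here: a cycle of the coinvariants is represented by an honest cycle of
    -- chains.
    obtain ⟨w', hw, hw'⟩ :=
      exists_quotMk_eq_of_map_eq_zero (zpowersSelf x) (zpowersSelf_eq x) hs _ hz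
    obtain ⟨y, hy⟩ := exists_tupleParacyclic_b_eq k x hw'
    refine ⟨chainMk k x (n + 2) y, (quotParacyclic_b_chainMk k x (n + 1) y).trans ?_⟩
    rw [hy]
    exact hw

/-- The Hochschild complex comes from a projective resolution, so it computes group homology. On
that resolution the antisymmetrization is homotopic to the identity, and it absorbs the signed
rotation. With the contraction of `b'` this is the input of the splitting theorem. -/
theorem nonempty_HC_coeffPrecyclic_equiv (hx : IsOfFinOrder x) (n : ℕ) :
    Nonempty ((coeffPrecyclic k x V).HC n ≃ₗ[k]
      ⨁ i : {i : ℕ // 2 * i ≤ n}, groupHomology V (n - 2 * i)) := by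
  let N := orderOf x
  have hN : N ≠ 0 := hx.orderOf_pos.ne'
  let F := (Rep.coinvariantsTensor k (Subgroup.centralizer {x} ⧸ zpowersSelf x)).obj V
  let R := finiteResolution k x hx
  let A : ∀ n, R.X n ⟶ R.X n := fun n => (quotFunctor k (zpowersSelf x)).map (antisymmHom k x N n)
  have hbA : ∀ n, R.d n ≫ A n = A (n + 1) ≫ R.d n := fun n => by
    change (quotParacyclic k x).b k n ≫ A n = A (n + 1) ≫ (quotParacyclic k x).b k n
    rw [quotParacyclic_b]
    refine ((quotFunctor k (zpowersSelf x)).map_comp _ _).symm.trans ?_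
    rw [b_comp_antisymmHom k x hN]
    exact (quotFunctor k (zpowersSelf x)).map_comp _ _
  -- The chain-map property at the augmentation gives this, since `antisymm` is the identity on
  -- empty tuples.
  have hAε : A 0 ≫ R.ε = R.ε := by
    refine quotFunctor_hom_ext fun z => ?_
    change sumCoeff k G 1 (antisymm k x N 1 z) = sumCoeff k G 1 z
    have h1 := LinearMap.congr_fun (tupleD_antisymm k x hN 0) z
    have h2 := (tupleD_zero_eq k (antisymm k x N 1 z)).symm.trans
      (h1.trans (tupleD_zero_eq k (G := G) z))
    exact Finsupp.single_injective _ h2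
  obtain ⟨e⟩ := PrecyclicModule.nonempty_HC_equiv_directSum (Z := coeffPrecyclic k x V)
    (a := fun n => (F.map (A n)).hom) (mem_range_coeffPrecyclic_b' k x V) (fun n z => by
      rw [ParacyclicObject.toPrecyclicModule_b]
      have h := congrArg (fun f => (F.map f).hom z) (hbA n)
      exact ((congrArg (fun f => ModuleCat.Hom.hom f z) (F.map_comp _ _)).symm.trans h).trans
        (congrArg (fun f => ModuleCat.Hom.hom f z) (F.map_comp _ _))) (fun n z => by
      rw [coeffPrecyclic_sgnT]
      have h := congrArg (fun f => ((coeffFunctor k x V).map f).hom z)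
        (sgnT_comp_antisymmHom k x (pow_orderOf_eq_one x) n)
      simp only [Functor.map_comp] at h
      exact h) (fun n z hz => by
      have hb : (coeffPrecyclic k x V).b = fun n => (F.map (R.d n)).hom := by
        funext n
        exact ParacyclicObject.toPrecyclicModule_b _ _ _ n
      rw [hb] at hz ⊢
      exact R.map_sub_mem_range F A hbA hAε n z hz) n
  have h : ∀ m, Nonempty (Homology (coeffPrecyclic k x V).b m ≃ₗ[k] groupHomology V m) := by
    intro m
    obtain ⟨e⟩ := R.nonempty_groupHomology_equiv V m
    have hb : (coeffPrecyclic k x V).b = fun n => (F.map (R.d n)).hom := by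
      funext n
      exact ParacyclicObject.toPrecyclicModule_b _ _ _ n
    rw [hb]
    exact ⟨e.symm⟩
  exact ⟨e ≪≫ₗ DFinsupp.mapRange.linearEquiv fun i => (h _).some⟩

end FiniteOrder

/-! ### Elements of infinite order -/

section InfiniteOrder

variable (k : Type u) [Field k] [CharZero k] {G : Type u} [Group G] (x : G)
  (V : Rep.{u} k (Subgroup.centralizer {x} ⧸ zpowersSelf x))

/-- The kernel of the projection is the image of `1 - x⁻¹ = 1 - T^(n+1)`, which is a multiple of `1
- T`. -/
lemma exists_eq_sub_sgnT_of_chainMk_eq_zero {n : ℕ} {z : (tupleParacyclic k x).obj n}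
    (hz : chainMk k x n z = 0) : ∃ y, z = y - ((tupleParacyclic k x).sgnT k n).hom y := by
  obtain ⟨y, hy⟩ := exists_of_quotMk_eq_zero (zpowersSelf x) (zpowersSelf_eq x) _ hz
  have h1 : (tupleRep k x (n + 1)).ρ (selfCentralizer x)⁻¹ y =
      (((tupleParacyclic k x).sgnT k n).hom)^[n + 1] y := by
    refine (tupleParacyclic_t_iterate k x n y).symm.trans ?_
    have h2 : ∀ j, (((tupleParacyclic k x).sgnT k n).hom)^[j] y =
        (-1 : k) ^ (n * j) • (((tupleParacyclic k x).t n).hom)^[j] y := by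
      intro j
      induction j with
      | zero => simp
      | succ j ih =>
        rw [Function.iterate_succ_apply', ih, map_smul, Function.iterate_succ_apply', mul_add,
          mul_one, pow_add, mul_smul]
        rfl
    rw [h2, Even.neg_one_pow (Nat.even_mul_succ_self n), one_smul]
  have h3 : ∀ j, ∃ e, y - (((tupleParacyclic k x).sgnT k n).hom)^[j] y =
      e - ((tupleParacyclic k x).sgnT k n).hom e := by
    intro j
    induction j with
    | zero => exact ⟨0, by simp⟩
    | succ j ih =>
      obtain ⟨e, he⟩ := ih
      refine ⟨e + (((tupleParacyclic k x).sgnT k n).hom)^[j] y, ?_⟩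
      rw [Function.iterate_succ_apply', map_add, add_sub_add_comm, ← he]
      abel
  obtain ⟨e, he⟩ := h3 (n + 1)
  exact ⟨e, hy.trans ((congrArg (y - ·) h1).trans he)⟩

/-- On chains `b w = (1 - T) c`. Applying `b` gives `(1 - T) b' c = 0`, so `b' c = 0` by injectivity
of `1 - T`, and `c = b' f`. Then `w - (1 - T) f` is a `b`-cycle of chains, hence a boundary. This is
the long exact sequence of `1 - T` from the `b'`-complex to the `b`-complex. -/
lemma exists_eq_b_add_of_b_eq (hx : ¬ IsOfFinOrder x) (n : ℕ) (z : (quotParacyclic k x).obj (n + 1))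
    (hz : ∃ e, ((quotParacyclic k x).b k n).hom z = e - ((quotParacyclic k x).sgnT k n).hom e) :
    ∃ v e, z = ((quotParacyclic k x).b k (n + 1)).hom v +
      (e - ((quotParacyclic k x).sgnT k (n + 1)).hom e) := by
  obtain ⟨e, he⟩ := hz
  obtain ⟨w, rfl⟩ := quotMk_surjective (zpowersSelf x) ((tupleParacyclic k x).obj (n + 1)) z
  obtain ⟨e, rfl⟩ := quotMk_surjective (zpowersSelf x) ((tupleParacyclic k x).obj n) e
  have h1 : chainMk k x n (((tupleParacyclic k x).b k n).hom w -
      (e - ((tupleParacyclic k x).sgnT k n).hom e)) = 0 := by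
    rw [map_sub, map_sub, ← quotParacyclic_b_chainMk, ← quotParacyclic_sgnT_chainMk]
    exact sub_eq_zero.2 he
  -- The equation holds only modulo the kernel of the projection; the error is of the form `(1 - T)
  -- e'` and is absorbed into `c = e + e'`.
  obtain ⟨e', he'⟩ := exists_eq_sub_sgnT_of_chainMk_eq_zero k x h1
  obtain ⟨f, hf⟩ : ∃ f, ((tupleParacyclic k x).b' k n).hom f = e + e' := by
    have h2 : ((tupleParacyclic k x).b k n).hom w =
        (e + e') - ((tupleParacyclic k x).sgnT k n).hom (e + e') := by
      rw [map_add, add_sub_add_comm, ← he']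
      abel
    generalize e + e' = c at h2
    cases n with
    -- In the lowest degree `b'` is onto, so no condition on `c` is needed.
    | zero => exact ⟨_, congrArg (fun f => Rep.Hom.hom f c) (lastCons_comp_b'_zero k x)⟩
    | succ n =>
      have h3 := congrArg (fun f => Rep.Hom.hom f w) (tupleParacyclic_b_comp_b k x n)
      have h4 := congrArg (fun f => Rep.Hom.hom f c)
        ((tupleParacyclic k x).id_sub_sgnT_comp_b k n)
      have h5 : ((tupleParacyclic k x).b k n).hom (c - ((tupleParacyclic k x).sgnT k (n + 1)).hom c)
          = 0 := (congrArg ((tupleParacyclic k x).b k n).hom h2).symm.trans h3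
      have h6 : ((tupleParacyclic k x).b' k n).hom c -
          ((tupleParacyclic k x).sgnT k n).hom (((tupleParacyclic k x).b' k n).hom c) = 0 :=
        h4.symm.trans h5
      have h7 : ((tupleParacyclic k x).b' k n).hom c = 0 :=
        sub_sgnT_injective k x hx n (sub_eq_zero.1 h6).symm
      refine ⟨((lastCons k x (n + 1)).hom c), ?_⟩
      have h8 := congrArg (fun f => Rep.Hom.hom f c) (lastCons_comp_b'_succ k x n)
      have h9 : ((tupleParacyclic k x).b' k (n + 1)).hom ((lastCons k x (n + 1)).hom c) +
          (lastCons k x n).hom (((tupleParacyclic k x).b' k n).hom c) = c := h8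
      rw [h7, map_zero, add_zero] at h9
      exact h9
  have h10 : ((tupleParacyclic k x).b k n).hom
      (w - (f - ((tupleParacyclic k x).sgnT k (n + 1)).hom f)) = 0 := by
    have h4 := congrArg (fun g => Rep.Hom.hom g f) ((tupleParacyclic k x).id_sub_sgnT_comp_b k n)
    have h5 : ((tupleParacyclic k x).b k n).hom (f - ((tupleParacyclic k x).sgnT k (n + 1)).hom f)
        = ((tupleParacyclic k x).b' k n).hom f -
          ((tupleParacyclic k x).sgnT k n).hom (((tupleParacyclic k x).b' k n).hom f) := h4
    rw [map_sub, h5, hf, map_add, add_sub_add_comm, ← he']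
    abel
  obtain ⟨v, hv⟩ := exists_tupleParacyclic_b_eq k x h10
  refine ⟨chainMk k x (n + 2) v, chainMk k x (n + 1) f, ?_⟩
  rw [quotParacyclic_b_chainMk, quotParacyclic_sgnT_chainMk, hv, ← map_sub, ← map_add,
    sub_add_cancel]
  rfl

lemma ParacyclicObject.exists_map_totRepD_eq {Γ : Type u} [Group Γ]
    (X : ParacyclicObject (Rep.{u} k Γ)) (F : Rep.{u} k Γ ⥤ ModuleCat.{u} k) [F.Additive]
    [F.Linear k] (hF : ∀ n, (F.map (X.t n)).hom ^ (n + 1) = 1)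
    (hZ : ∀ n (z : F.obj (X.obj (n + 1))),
      (∃ e, (F.map (X.b k n)).hom z = e - (F.map (X.sgnT k n)).hom e) →
      ∃ v e, z = (F.map (X.b k (n + 1))).hom v + (e - (F.map (X.sgnT k (n + 1))).hom e))
    (n : ℕ) (z : F.obj (X.totRep (n + 1))) (hz : (F.map (X.totRepD n)).hom z = 0) :
    ∃ y, (F.map (X.totRepD (n + 1))).hom y = z := by
  have h1 : (X.toPrecyclicModule F hF).totD n (X.mapTotEquiv F hF (n + 1) z) = 0 := by
    rw [← X.mapTotEquiv_comm F hF n z, hz, map_zero]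
  have h2 := PrecyclicModule.mem_range_totD (X.toPrecyclicModule F hF) (fun n z hz => by
    rw [ParacyclicObject.toPrecyclicModule_b, ParacyclicObject.toPrecyclicModule_sgnT] at *
    exact hZ n z hz) n h1
  obtain ⟨y, hy⟩ := h2
  obtain ⟨y, rfl⟩ := (X.mapTotEquiv F hF (n + 2)).surjective y
  exact ⟨y, (X.mapTotEquiv F hF (n + 1)).injective
    ((X.mapTotEquiv_comm F hF (n + 1) y).trans hy)⟩

/-- The total complex of the coinvariants of the chains is a resolution if `x` has infinite
order. -/
def infiniteResolution (hx : ¬ IsOfFinOrder x) :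
    RepResolution k (Subgroup.centralizer {x} ⧸ zpowersSelf x) where
  X := (quotParacyclic k x).totRep
  d := (quotParacyclic k x).totRepD
  ε := (quotParacyclic k x).totProj 0 0 ≫ chainAugmentation k x
  projective _ := inferInstance
  d_comp_d := ParacyclicObject.totRepD_comp_totRepD _ (forget₂ _ (ModuleCat.{u} k))
    (map_quotParacyclic_t_pow k x _)
  d_comp_ε := by
    rw [← Category.assoc, ParacyclicObject.totRepD_comp_totProj, Preadditive.add_comp]
    have h1 : (quotParacyclic k x).vert k (0 - ((0 : Fin 1) : ℕ)) (0 : Fin 1) =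
      (quotParacyclic k x).b k 0 := rfl
    have h2 : (quotParacyclic k x).horiz k (0 + 1 - ((0 : Fin 1) : ℕ)) (0 : Fin 1) =
      𝟙 _ - (quotParacyclic k x).sgnT k 0 := rfl
    rw [h1, h2, Category.assoc, Category.assoc, b_comp_chainAugmentation, Preadditive.sub_comp]
    erw [sgnT_comp_chainAugmentation]
    simp
  surjective r := by
    obtain ⟨z, hz⟩ := chainAugmentation_surjective k x r
    exact ⟨((quotParacyclic k x).totSingle 0 0).hom z, (congrArg (chainAugmentation k x).hom
      (congrArg (fun f => Rep.Hom.hom f z)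
        ((quotParacyclic k x).totSingle_comp_totProj 0 0))).trans hz⟩
  exact_zero z hz := by
    obtain ⟨y, hy⟩ := exists_b_eq_of_chainAugmentation k x
      (z := ((quotParacyclic k x).totProj 0 0).hom z) hz
    -- The bounding chain is placed in column 0, row 1, so that only the Hochschild differential
    -- contributes.
    refine ⟨((quotParacyclic k x).totSingle 1 1).hom y, ?_⟩
    have h1 := congrArg (fun f => Rep.Hom.hom f (((quotParacyclic k x).totSingle 1 1).hom y))
      ((quotParacyclic k x).totRepD_comp_totProj 0 0)
    have h2 : ((quotParacyclic k x).totProj 1 1).hom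
        (((quotParacyclic k x).totSingle 1 1).hom y) = y :=
      congrArg (fun f => Rep.Hom.hom f y) ((quotParacyclic k x).totSingle_comp_totProj 1 1)
    have h3 : ((quotParacyclic k x).totProj 1 0).hom
        (((quotParacyclic k x).totSingle 1 1).hom y) = 0 :=
      congrArg (fun f => Rep.Hom.hom f y)
        ((quotParacyclic k x).totSingle_comp_totProj_of_ne 1 (q := 1) (q' := 0) (by simp))
    have h4 : ((quotParacyclic k x).totProj 0 0).hom (((quotParacyclic k x).totRepD 0).hom
          (((quotParacyclic k x).totSingle 1 1).hom y)) =
        ((quotParacyclic k x).b k 0).hom (((quotParacyclic k x).totProj 1 1).hom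
          (((quotParacyclic k x).totSingle 1 1).hom y)) +
        ((quotParacyclic k x).horiz k 1 0).hom (((quotParacyclic k x).totProj 1 0).hom
          (((quotParacyclic k x).totSingle 1 1).hom y)) := h1
    rw [h2, h3, map_zero, add_zero, hy] at h4
    funext q
    obtain rfl : q = 0 := Subsingleton.elim (α := Fin 1) _ _
    exact h4
  exact_succ n z hz := by
    exact ParacyclicObject.exists_map_totRepD_eq k (quotParacyclic k x)
      (forget₂ (Rep.{u} k (Subgroup.centralizer {x} ⧸ zpowersSelf x)) (ModuleCat.{u} k))
      (map_quotParacyclic_t_pow k x _) (fun n z hz => exists_eq_b_add_of_b_eq k x hx n z hz) n z hz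

/-- Tensoring with `V` and taking coinvariants commutes with forming the total complex. The same
complex thus computes cyclic homology and, as the total complex is a projective resolution, group
homology. -/
theorem nonempty_HC_coeffPrecyclic_equiv_of_not (hx : ¬ IsOfFinOrder x) (n : ℕ) :
    Nonempty ((coeffPrecyclic k x V).HC n ≃ₗ[k] groupHomology V n) := by
  let F := (Rep.coinvariantsTensor k (Subgroup.centralizer {x} ⧸ zpowersSelf x)).obj V
  let R := infiniteResolution k x hx
  obtain ⟨e⟩ := R.nonempty_groupHomology_equiv V n
  obtain ⟨e'⟩ := nonempty_homology_equiv_of_equiv (X := fun n => F.obj (R.X n))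
    (Y := (coeffPrecyclic k x V).Tot) (d := fun n => (F.map (R.d n)).hom)
    (d' := (coeffPrecyclic k x V).totD)
    (fun n => (quotParacyclic k x).mapTotEquiv F (map_quotParacyclic_t_pow k x _) n)
    (fun n z => (quotParacyclic k x).mapTotEquiv_comm F (map_quotParacyclic_t_pow k x _) n z) n
  exact ⟨(coeffPrecyclic k x V).HCEquiv n ≪≫ₗ e'.symm ≪≫ₗ e.symm⟩

end InfiniteOrder

end CyclicHomology

namespace CyclicHomology

/-! ### Tensor powers of the group algebra in the basis of tuples -/

section GroupAlgebraTensor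

open WithConv

lemma prod_ofFn_eq_of_forall_ne {N : Type*} [Monoid N] {n : ℕ} (f : Fin n → N) (j : Fin n)
    (h : ∀ i, i ≠ j → f i = 1) : (List.ofFn f).prod = f j := by
  induction n with
  | zero => exact j.elim0
  | succ n ih =>
    rw [List.ofFn_succ, List.prod_cons]
    cases j using Fin.cases with
    | zero =>
      rw [List.prod_eq_one, mul_one]
      intro a ha
      obtain ⟨i, rfl⟩ := List.mem_ofFn.1 ha
      exact h _ (Fin.succ_ne_zero i)
    | succ j =>
      rw [h 0 (Fin.succ_ne_zero j).symm, one_mul]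
      exact ih (fun i => f i.succ) j fun i hi => h _ fun e => hi (Fin.succ_injective n e)

variable {k G : Type u} [CommRing k] [Group G]

/-- Group elements are group-like, so convolution becomes multiplication of values. -/
lemma convMul_single {A : Type*} [Ring A] [Algebra k A]
    (f f' : WithConv (MonoidAlgebra k G →ₗ[k] A)) (g : G) :
    (f * f') (MonoidAlgebra.single g 1) =
      f (MonoidAlgebra.single g 1) * f' (MonoidAlgebra.single g 1) := by
  rw [LinearMap.convMul_apply, MonoidAlgebra.comul_single]
  simp

lemma list_prod_single {A : Type*} [Ring A] [Algebra k A]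
    (l : List (WithConv (MonoidAlgebra k G →ₗ[k] A))) (g : G) :
    l.prod (MonoidAlgebra.single g 1) = (l.map fun f => f (MonoidAlgebra.single g 1)).prod := by
  induction l with
  | nil =>
    rw [List.prod_nil, LinearMap.convOne_apply, MonoidAlgebra.counit_single]
    simp
  | cons f l ih => rw [List.prod_cons, convMul_single, ih, List.map_cons, List.prod_cons]

/-- The pure tensor of group elements. -/
def tupleTensor (k : Type u) [CommRing k] {n : ℕ} (u : Fin n → G) : TPow k (MonoidAlgebra k G) n :=
  PiTensorProduct.tprod k fun i => MonoidAlgebra.single (u i) 1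

lemma tupleTensor_mul {n : ℕ} (u v : Fin n → G) :
    tupleTensor k u * tupleTensor k v = tupleTensor k (u * v) := by
  rw [tupleTensor, tupleTensor, PiTensorProduct.tprod_mul_tprod]
  congr 1
  funext i
  rw [Pi.mul_apply, MonoidAlgebra.single_mul_single, one_mul]
  rfl

lemma inj_single {n : ℕ} (i : Fin n) (g : G) :
    inj (k := k) i (MonoidAlgebra.single g 1) = tupleTensor k (Pi.mulSingle i g) := by
  rw [inj_apply, tupleTensor]
  congr 1
  funext j
  rcases eq_or_ne j i with rfl | h
  · simp
  · simp [h, MonoidAlgebra.one_def]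

lemma iterComul_single (n : ℕ) (g : G) :
    iterComul k (MonoidAlgebra k G) n (MonoidAlgebra.single g 1) = tupleTensor k fun _ => g := by
  rw [iterComul_eq, list_prod_single, List.map_ofFn]
  -- Tuples embed multiplicatively, so the product of the one-entry tensors can be computed
  -- entrywise in `Fin n → G`.
  let φ : (Fin n → G) →* TPow k (MonoidAlgebra k G) n :=
    { toFun := tupleTensor k
      map_one' := rfl
      map_mul' := fun u v => (tupleTensor_mul u v).symm }
  have h1 : ((fun f : WithConv (MonoidAlgebra k G →ₗ[k] _) => f (MonoidAlgebra.single g 1)) ∘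
      fun i : Fin n => inj (k := k) i) = φ ∘ fun i => Pi.mulSingle i g :=
    funext fun i => inj_single i g
  rw [h1, ← List.map_ofFn, ← map_list_prod]
  change tupleTensor k _ = _
  congr 1
  funext j
  have h2 := map_list_prod (Pi.evalMonoidHom (fun _ : Fin n => G) j)
    (List.ofFn fun i => Pi.mulSingle i g)
  rw [List.map_ofFn] at h2
  refine h2.trans ((prod_ofFn_eq_of_forall_ne _ j fun i hi => ?_).trans ?_)
  · exact Pi.mulSingle_eq_of_ne hi.symm _
  · exact Pi.mulSingle_eq_same _ _

lemma tupleTensor_mul_iterComul {n : ℕ} (u : Fin n → G) (g : G) :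
    tupleTensor k u * iterComul k (MonoidAlgebra k G) n (MonoidAlgebra.single g 1) =
      tupleTensor k (mulTuple u g) := by
  rw [iterComul_single, tupleTensor_mul]
  rfl

lemma face_tupleTensor {n : ℕ} (i : Fin (n + 1)) (u : Fin (n + 1) → G) :
    face i (tupleTensor k u) = tupleTensor k (Fin.removeNth i u) := by
  rw [tupleTensor, face_tprod, MonoidAlgebra.counit_single]
  simp
  rfl

lemma rot_tupleTensor_mul_inj {n : ℕ} (u : Fin (n + 1) → G) (g : G) :
    rot k (MonoidAlgebra k G) (n + 1) (tupleTensor k u) *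
      inj (k := k) (0 : Fin (n + 1)) (MonoidAlgebra.single g 1) =
      tupleTensor k (rotateTuple g u) := by
  rw [tupleTensor, rot_tprod, inj_single]
  refine (tupleTensor_mul (fun i => u ((finRotate (n + 1)).symm i)) _).trans ?_
  congr 1
  funext j
  cases j using Fin.cases with
  | zero =>
    have h : (finRotate (n + 1)).symm 0 = Fin.last n := by
      rw [Equiv.symm_apply_eq, finRotate_last]
    rw [Pi.mul_apply, Pi.mulSingle_eq_same]
    exact congrArg (fun i => u i * g) h
  | succ j =>
    have h : (finRotate (n + 1)).symm j.succ = j.castSucc := by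
      rw [Equiv.symm_apply_eq, finRotate_castSucc]
    rw [Pi.mul_apply, Pi.mulSingle_eq_of_ne (Fin.succ_ne_zero j), mul_one]
    exact congrArg u h

open Classical in
variable (k G) in
/-- The pure tensors of group elements form a basis. -/
def tpowEquiv (n : ℕ) : ((Fin n → G) →₀ k) ≃ₗ[k] TPow k (MonoidAlgebra k G) n :=
  (PiTensorProduct.ofFinsuppEquiv' (ι := Fin n) (κ := fun _ => G) (R := k)).symm ≪≫ₗ
    PiTensorProduct.congr fun _ => (MonoidAlgebra.coeffLinearEquiv k).symm

open Classical in
lemma tpowEquiv_single {n : ℕ} (u : Fin n → G) :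
    tpowEquiv k G n (Finsupp.single u 1) = tupleTensor k u := by
  have h : (PiTensorProduct.ofFinsuppEquiv' (ι := Fin n) (κ := fun _ => G) (R := k)).symm
      (Finsupp.single u 1) = PiTensorProduct.tprod k fun i => Finsupp.single (u i) 1 := by
    rw [LinearEquiv.symm_apply_eq, PiTensorProduct.ofFinsuppEquiv'_tprod_single]
    simp
  rw [tpowEquiv, LinearEquiv.trans_apply, h, PiTensorProduct.congr_tprod]
  rfl

end GroupAlgebraTensor

/-! ### The grading of a crossed module by group elements -/

section Component

variable {k G : Type u} [CommRing k] [Group G] {M : Type u} [AddCommGroup M] [Module k M]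
  [Module (MonoidAlgebra k G) M] [IsScalarTower k (MonoidAlgebra k G) M]
  (C : CrossedModule k (MonoidAlgebra k G) M)

variable (k) in
/-- The coefficient of a group element. -/
def coeffAt (g : G) : MonoidAlgebra k G →ₗ[k] k :=
  Finsupp.lapply g ∘ₗ (MonoidAlgebra.coeffLinearEquiv k).toLinearMap

lemma coeffAt_single_self (g : G) (r : k) : coeffAt k g (MonoidAlgebra.single g r) = r := by
  simp [coeffAt]

lemma coeffAt_single_of_ne {g h : G} (hgh : h ≠ g) (r : k) :
    coeffAt k g (MonoidAlgebra.single h r) = 0 := by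
  simp [coeffAt, hgh]

variable (k M) in
/-- The coefficient of a group element in a tensor. -/
def tensorCoeffAt (g : G) : M ⊗[k] MonoidAlgebra k G →ₗ[k] M :=
  (TensorProduct.rid k M).toLinearMap ∘ₗ (coeffAt k g).lTensor M

lemma tensorCoeffAt_tmul (g : G) (m : M) (h : MonoidAlgebra k G) :
    tensorCoeffAt k M g (m ⊗ₜ h) = coeffAt k g h • m := by
  simp [tensorCoeffAt]

/-- The projection to a homogeneous component. -/
def CrossedModule.proj (g : G) : M →ₗ[k] M := tensorCoeffAt k M g ∘ₗ C.coact

lemma CrossedModule.proj_mem (g : G) (m : M) : C.proj g m ∈ C.component g := by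
  rw [mem_component]
  let Φ : M ⊗[k] (MonoidAlgebra k G ⊗[k] MonoidAlgebra k G) →ₗ[k] M ⊗[k] MonoidAlgebra k G :=
    (TensorProduct.rid k _).toLinearMap ∘ₗ (coeffAt k g).lTensor _ ∘ₗ
      (TensorProduct.assoc k M (MonoidAlgebra k G) (MonoidAlgebra k G)).symm.toLinearMap
  have h1 : ∀ z : M ⊗[k] MonoidAlgebra k G,
      Φ (TensorProduct.assoc k M _ _ (C.coact.rTensor _ z)) = C.coact (tensorCoeffAt k M g z) := by
    intro z
    induction z with
    | zero => simp
    | add x y hx hy => simp only [map_add, hx, hy]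
    | tmul m h =>
      rw [tensorCoeffAt_tmul]
      simp [Φ]
  have h2 : ∀ z : M ⊗[k] MonoidAlgebra k G,
      Φ ((Coalgebra.comul (R := k) (A := MonoidAlgebra k G)).lTensor M z) =
        tensorCoeffAt k M g z ⊗ₜ MonoidAlgebra.single g 1 := by
    intro z
    induction z with
    | zero => simp
    | add x y hx hy => simp only [map_add, TensorProduct.add_tmul, hx, hy]
    | tmul m h =>
      induction h using MonoidAlgebra.induction_linear with
      | zero => simp
      | add x y hx hy => simp only [map_add, TensorProduct.tmul_add, TensorProduct.add_tmul, hx, hy]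
      | single h r =>
        rw [tensorCoeffAt_tmul, LinearMap.lTensor_tmul, MonoidAlgebra.comul_single]
        rcases eq_or_ne h g with rfl | hgh
        · simp only [Φ, coeffAt_single_self, LinearMap.comp_apply, LinearEquiv.coe_coe]
          simp [coeffAt_single_self]
          rfl
        · simp [Φ, coeffAt_single_of_ne hgh]
  have h3 := congrArg Φ (LinearMap.congr_fun C.coassoc m)
  exact (h1 (C.coact m)).symm.trans (h3.trans (h2 (C.coact m)))

lemma CrossedModule.proj_of_mem {g : G} {m : M} (hm : m ∈ C.component g) : C.proj g m = m := by
  rw [mem_component] at hm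
  rw [proj, LinearMap.comp_apply, hm, tensorCoeffAt_tmul, coeffAt_single_self, one_smul]

lemma CrossedModule.proj_of_mem_of_ne {g h : G} (hgh : h ≠ g) {m : M} (hm : m ∈ C.component h) :
    C.proj g m = 0 := by
  rw [mem_component] at hm
  rw [proj, LinearMap.comp_apply, hm, tensorCoeffAt_tmul, coeffAt_single_of_ne hgh, zero_smul]

/-- The counit axiom says that `m` is the sum of all coefficients of `ρ(m)`, of which only finitely
many are nonzero. -/
lemma CrossedModule.exists_eq_sum_proj (m : M) : ∃ s : Finset G, m = ∑ g ∈ s, C.proj g m := by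
  classical
  -- Asking for the identity for all `t ⊇ s` makes it stable under addition, by taking unions.
  have h1 : ∀ z : M ⊗[k] MonoidAlgebra k G, ∃ s : Finset G, ∀ t, s ⊆ t →
      TensorProduct.rid k M ((Coalgebra.counit (R := k)).lTensor M z) =
        ∑ g ∈ t, tensorCoeffAt k M g z := by
    intro z
    induction z with
    | zero => exact ⟨∅, by simp⟩
    | add x y hx hy =>
      obtain ⟨s, hs⟩ := hx
      obtain ⟨s', hs'⟩ := hy
      refine ⟨s ∪ s', fun t ht => ?_⟩
      simp only [map_add, Finset.sum_add_distrib]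
      rw [hs t (Finset.union_subset_left ht), hs' t (Finset.union_subset_right ht)]
    | tmul m h =>
      induction h using MonoidAlgebra.induction_linear with
      | zero => exact ⟨∅, by simp⟩
      | add x y hx hy =>
        obtain ⟨s, hs⟩ := hx
        obtain ⟨s', hs'⟩ := hy
        refine ⟨s ∪ s', fun t ht => ?_⟩
        simp only [TensorProduct.tmul_add, map_add, Finset.sum_add_distrib]
        rw [hs t (Finset.union_subset_left ht), hs' t (Finset.union_subset_right ht)]
      | single h r =>
        refine ⟨{h}, fun t ht => ?_⟩
        rw [Finset.sum_eq_single_of_mem h (ht (Finset.mem_singleton_self h))]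
        · simp [tensorCoeffAt_tmul, coeffAt_single_self, MonoidAlgebra.counit_single]
        · intro g _ hg
          rw [tensorCoeffAt_tmul, coeffAt_single_of_ne hg.symm, zero_smul]
  obtain ⟨s, hs⟩ := h1 (C.coact m)
  refine ⟨s, ?_⟩
  have h2 := LinearMap.congr_fun C.counit m
  rw [LinearMap.comp_apply] at h2
  have h3 := hs s subset_rfl
  rw [h2] at h3
  have h4 : m = ∑ g ∈ s, tensorCoeffAt k M g (C.coact m) := by simpa using h3
  exact h4

lemma CrossedModule.homogeneous_induction {p : M → Prop} (m : M) (h0 : p 0)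
    (hadd : ∀ x y, p x → p y → p (x + y)) (hom : ∀ g, ∀ x ∈ C.component g, p x) : p m := by
  obtain ⟨s, hs⟩ := C.exists_eq_sum_proj m
  rw [hs]
  exact Finset.sum_induction _ p hadd h0 fun g _ => hom g _ (C.proj_mem g m)

lemma CrossedModule.isInternal_component [DecidableEq G] : DirectSum.IsInternal C.component := by
  constructor
  · rw [injective_iff_map_eq_zero]
    intro v hv
    ext g
    have h1 : ∀ v : ⨁ g, C.component g,
        C.proj g (DirectSum.coeAddMonoidHom C.component v) = v g := by
      intro v
      induction v using DirectSum.induction_on with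
      | zero => simp
      | add x y hx hy => simp only [map_add, hx, hy, DirectSum.add_apply, Submodule.coe_add]
      | of h m =>
        rw [DirectSum.coeAddMonoidHom_of]
        rcases eq_or_ne h g with rfl | hgh
        · rw [C.proj_of_mem m.2, DirectSum.of_eq_same]
        · rw [C.proj_of_mem_of_ne hgh m.2, DirectSum.of_eq_of_ne _ _ _ hgh.symm]
          rfl
    rw [← h1, hv, map_zero]
    rfl
  · intro m
    induction m using C.homogeneous_induction with
    | h0 => exact ⟨0, map_zero _⟩
    | hadd x y hx hy =>
      obtain ⟨x, rfl⟩ := hx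
      obtain ⟨y, rfl⟩ := hy
      exact ⟨x + y, map_add _ _ _⟩
    | hom g x hx => exact ⟨DirectSum.of _ g ⟨x, hx⟩, DirectSum.coeAddMonoidHom_of _ _ _⟩

/-- A linear map given by its restrictions to the homogeneous components. -/
def CrossedModule.lift {W : Type*} [AddCommGroup W] [Module k W]
    (f : ∀ g, C.component g →ₗ[k] W) : M →ₗ[k] W := by
  classical
  exact DirectSum.toModule k G W f ∘ₗ
    (LinearEquiv.ofBijective (DirectSum.coeLinearMap C.component)
      C.isInternal_component).symm.toLinearMap

lemma CrossedModule.lift_of_mem {W : Type*} [AddCommGroup W] [Module k W]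
    (f : ∀ g, C.component g →ₗ[k] W) {g : G} (m : C.component g) : C.lift f m = f g m := by
  classical
  have h : (LinearEquiv.ofBijective (DirectSum.coeLinearMap C.component)
      C.isInternal_component).symm m = DirectSum.lof k G (fun g => C.component g) g m := by
    refine (LinearEquiv.symm_apply_eq _).2 ?_
    exact (DirectSum.coeLinearMap_lof C.component g m).symm
  rw [lift, LinearMap.comp_apply, LinearEquiv.coe_coe, h, DirectSum.toModule_lof]

end Component

/-! ### Balanced tensors of tuples -/

section BalancedTuples

variable {k G : Type u} [CommRing k] [Group G] {M : Type u} [AddCommGroup M] [Module k M]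
  [Module (MonoidAlgebra k G) M] [IsScalarTower k (MonoidAlgebra k G) M]

variable (k M) in
/-- The balanced tensor of a chain of `G` and an element of `M`. -/
def balMk (n : ℕ) : ((Fin n → G) →₀ k) →ₗ[k] M →ₗ[k] Bal k (MonoidAlgebra k G) M n :=
  (TensorProduct.mk k (TPow k (MonoidAlgebra k G) n) M).compr₂
    (balRel k (MonoidAlgebra k G) M n).mkQ ∘ₗ
    (tpowEquiv k G n).toLinearMap

lemma balMk_single {n : ℕ} (u : Fin n → G) (m : M) :
    balMk k M n (Finsupp.single u 1) m =
      (balRel k (MonoidAlgebra k G) M n).mkQ (tupleTensor k u ⊗ₜ m) := by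
  rw [← tpowEquiv_single]
  rfl

lemma balMk_mulTuple {n : ℕ} (g : G) (z : (Fin n → G) →₀ k) (m : M) :
    balMk k M n (tupleMap k (mulTuple · g) z) m =
      balMk k M n z ((MonoidAlgebra.single g 1 : MonoidAlgebra k G) • m) := by
  refine LinearMap.congr_fun (f := (balMk k M n).flip m ∘ₗ tupleMap k (mulTuple · g))
    (g := (balMk k M n).flip ((MonoidAlgebra.single g 1 : MonoidAlgebra k G) • m)) ?_ z
  refine Finsupp.lhom_ext' fun u => LinearMap.ext_ring ?_
  change balMk k M n (tupleMap k (mulTuple · g) (Finsupp.single u 1)) m =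
    balMk k M n (Finsupp.single u 1) ((MonoidAlgebra.single g 1 : MonoidAlgebra k G) • m)
  rw [tupleMap_single, balMk_single, balMk_single, ← mk_balanced, tupleTensor_mul_iterComul]

lemma faceZ_balMk {n : ℕ} (i : Fin (n + 1)) (z : (Fin (n + 1) → G) →₀ k) (m : M) :
    faceZ k (MonoidAlgebra k G) M i (balMk k M (n + 1) z m) =
      balMk k M n (tupleMap k (Fin.removeNth i) z) m := by
  refine LinearMap.congr_fun (f := faceZ k (MonoidAlgebra k G) M i ∘ₗ (balMk k M (n + 1)).flip m)
    (g := (balMk k M n).flip m ∘ₗ tupleMap k (Fin.removeNth i)) ?_ z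
  refine Finsupp.lhom_ext' fun u => LinearMap.ext_ring ?_
  change faceZ k (MonoidAlgebra k G) M i (balMk k M (n + 1) (Finsupp.single u 1) m) =
    balMk k M n (tupleMap k (Fin.removeNth i) (Finsupp.single u 1)) m
  rw [tupleMap_single, balMk_single, balMk_single, ← face_tupleTensor]
  rfl

lemma CrossedModule.tauZ_balMk (C : CrossedModule k (MonoidAlgebra k G) M) {n : ℕ} {x : G}
    (z : (Fin (n + 1) → G) →₀ k) {m : M} (hm : m ∈ C.component x) :
    C.tauZ n (balMk k M (n + 1) z m) = balMk k M (n + 1) (tupleMap k (rotateTuple x) z) m := by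
  refine LinearMap.congr_fun (f := C.tauZ n ∘ₗ (balMk k M (n + 1)).flip m)
    (g := (balMk k M (n + 1)).flip m ∘ₗ tupleMap k (rotateTuple x)) ?_ z
  refine Finsupp.lhom_ext' fun u => LinearMap.ext_ring ?_
  change C.tauZ n (balMk k M (n + 1) (Finsupp.single u 1) m) =
    balMk k M (n + 1) (tupleMap k (rotateTuple x) (Finsupp.single u 1)) m
  rw [tupleMap_single, balMk_single, balMk_single, ← rot_tupleTensor_mul_inj, tauZ,
    Submodule.mkQ_apply, Submodule.mapQ_apply, tau_tmul, mem_component.1 hm, contr_tmul]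
  rfl

/-- A linear map out of the balanced tensor product, given on chains. -/
def balLift {n : ℕ} {W : Type*} [AddCommGroup W] [Module k W]
    (D : ((Fin n → G) →₀ k) →ₗ[k] M →ₗ[k] W)
    (hD : ∀ (g : G) (u : Fin n → G) (m : M), D (Finsupp.single (mulTuple u g) 1) m =
      D (Finsupp.single u 1) ((MonoidAlgebra.single g 1 : MonoidAlgebra k G) • m)) :
    Bal k (MonoidAlgebra k G) M n →ₗ[k] W :=
  (balRel k (MonoidAlgebra k G) M n).liftQ
    (TensorProduct.lift (D ∘ₗ (tpowEquiv k G n).symm.toLinearMap)) <| by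
    refine Submodule.span_le.2 ?_
    rintro _ ⟨t, h, m, rfl⟩
    rw [SetLike.mem_coe, LinearMap.mem_ker, map_sub, sub_eq_zero, TensorProduct.lift.tmul,
      TensorProduct.lift.tmul]
    obtain ⟨z, rfl⟩ := (tpowEquiv k G n).surjective t
    induction h using MonoidAlgebra.induction_linear with
    | zero => simp
    | add a b ha hb => simp only [map_add, mul_add, LinearMap.add_apply, ha, hb, add_smul]
    | single g r =>
      have e : MonoidAlgebra.single g r = r • MonoidAlgebra.single g (1 : k) := by simp
      rw [e, map_smul, mul_smul_comm, map_smul, LinearMap.smul_apply, smul_assoc, map_smul]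
      congr 1
      induction z using Finsupp.induction_linear with
      | zero => simp
      | add a b ha hb => simp only [map_add, add_mul, LinearMap.add_apply, ha, hb]
      | single u s =>
        have e : Finsupp.single u s = s • Finsupp.single u (1 : k) := by simp
        rw [e, map_smul, smul_mul_assoc, map_smul _ s, map_smul _ s, LinearMap.smul_apply,
          LinearMap.smul_apply, tpowEquiv_single, tupleTensor_mul_iterComul, ← tpowEquiv_single,
          ← tpowEquiv_single]
        congr 1
        have := hD g u m
        simpa using this

lemma balLift_balMk {n : ℕ} {W : Type*} [AddCommGroup W] [Module k W]
    (D : ((Fin n → G) →₀ k) →ₗ[k] M →ₗ[k] W)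
    (hD : ∀ (g : G) (u : Fin n → G) (m : M), D (Finsupp.single (mulTuple u g) 1) m =
      D (Finsupp.single u 1) ((MonoidAlgebra.single g 1 : MonoidAlgebra k G) • m))
    (z : (Fin n → G) →₀ k) (m : M) : balLift D hD (balMk k M n z m) = D z m := by
  refine (TensorProduct.lift.tmul _ _).trans ?_
  rw [LinearMap.comp_apply]
  congr 2
  exact (tpowEquiv k G n).symm_apply_apply z

lemma CrossedModule.bal_induction (C : CrossedModule k (MonoidAlgebra k G) M) {n : ℕ}
    {p : Bal k (MonoidAlgebra k G) M n → Prop} (b : Bal k (MonoidAlgebra k G) M n) (h0 : p 0)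
    (hadd : ∀ a b, p a → p b → p (a + b))
    (hom : ∀ z g, ∀ m ∈ C.component g, p (balMk k M n z m)) : p b := by
  obtain ⟨t, rfl⟩ := Submodule.mkQ_surjective _ b
  induction t with
  | zero => rwa [map_zero]
  | add x y hx hy => rw [map_add]; exact hadd _ _ hx hy
  | tmul t m =>
    obtain ⟨z, rfl⟩ := (tpowEquiv k G n).surjective t
    change p (balMk k M n z m)
    induction m using C.homogeneous_induction with
    | h0 => rwa [map_zero]
    | hadd x y hx hy => rw [map_add]; exact hadd _ _ hx hy
    | hom g x hx => exact hom z g x hx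

end BalancedTuples

/-! ### The summand of a conjugacy class -/

section ConjugacyComponent

variable {k G : Type u} [CommRing k] [Group G] {M : Type u} [AddCommGroup M] [Module k M]
  [Module (MonoidAlgebra k G) M] [IsScalarTower k (MonoidAlgebra k G) M]
  (C : ModularCrossedModule k (MonoidAlgebra k G) M) (x : G)

/-- The class of the tensor of an element of `M_x` and a chain in the coinvariants. -/
def coeffMk (n : ℕ) : C.component x →ₗ[k] ((Fin (n + 1) → G) →₀ k) →ₗ[k]
    (coeffPrecyclic k x (C.componentQuot x)).obj n :=
  (Rep.coinvariantsTensorMk (C.componentQuot x) ((quotParacyclic k x).obj n)).compl₂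
    (chainMk k x n)

/-- In coinvariants of the diagonal action, `gm ⊗ z` and `m ⊗ g⁻¹z` agree, and `g⁻¹` acts on chains
by right multiplication with `g`. -/
lemma coeffMk_smul (n : ℕ) (g : Subgroup.centralizer {x}) (m : C.component x)
    (z : (Fin (n + 1) → G) →₀ k) :
    coeffMk C x n (C.componentRep x g m) z =
      coeffMk C x n m (tupleMap k (mulTuple · (g : G)) z) := by
  have h := Representation.Coinvariants.mk_self_apply
    ((C.componentQuot x).ρ.tprod ((quotParacyclic k x).obj n).ρ)
    (g : Subgroup.centralizer {x} ⧸ zpowersSelf x)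
    (m ⊗ₜ chainMk k x n (tupleMap k (mulTuple · (g : G)) z))
  refine Eq.trans ?_ h
  have h2 : tupleMap k (mulTuple · (g : G)⁻¹) (tupleMap k (mulTuple · (g : G)) z) = z := by
    rw [← LinearMap.comp_apply, tupleMap_comp]
    have : ((fun u : Fin (n + 1) → G => mulTuple u (g : G)⁻¹) ∘ fun u => mulTuple u (g : G)) =
        id := by
      funext u
      simp [mulTuple_mulTuple, mulTuple_one]
    rw [this, tupleMap_id, LinearMap.id_apply]
  conv_lhs => rw [← h2]
  rfl

lemma coeff_induction {n : ℕ} {p : (coeffPrecyclic k x (C.componentQuot x)).obj n → Prop}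
    (w : (coeffPrecyclic k x (C.componentQuot x)).obj n) (h0 : p 0)
    (hadd : ∀ a b, p a → p b → p (a + b)) (hmk : ∀ m z, p (coeffMk C x n m z)) : p w := by
  obtain ⟨t, rfl⟩ := Representation.Coinvariants.mk_surjective _ w
  induction t using TensorProduct.induction_on with
  | zero => rwa [map_zero]
  | add x y hx hy => rw [map_add]; exact hadd _ _ hx hy
  | tmul m z =>
    obtain ⟨z, rfl⟩ := quotMk_surjective (zpowersSelf x) _ z
    exact hmk m z

lemma coeffPrecyclic_d_coeffMk (n : ℕ) (i : Fin (n + 2)) (m : C.component x)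
    (z : (Fin (n + 2) → G) →₀ k) :
    (coeffPrecyclic k x (C.componentQuot x)).d n i (coeffMk C x (n + 1) m z) =
      coeffMk C x n m (tupleMap k (Fin.removeNth i) z) := rfl

lemma coeffPrecyclic_t_coeffMk (n : ℕ) (m : C.component x) (z : (Fin (n + 1) → G) →₀ k) :
    (coeffPrecyclic k x (C.componentQuot x)).t n (coeffMk C x n m z) =
      coeffMk C x n m (tupleMap k (rotateTuple x) z) := rfl

/-- The inclusion of the part of the cyclic object that belongs to the conjugacy class of `x`. -/
def classIncl (n : ℕ) : (coeffPrecyclic k x (C.componentQuot x)).obj n →ₗ[k] C.Z.obj n :=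
  Representation.Coinvariants.lift _ (TensorProduct.lift (LinearMap.flip
    (Representation.Coinvariants.lift
      ((tupleRep k x (n + 1)).ρ.comp (zpowersSelf x).subtype)
      ((LinearMap.lcomp k _ (C.component x).subtype) ∘ₗ balMk k M (n + 1)) (by
        -- Descent to `⟨x⟩`-coinvariants: the balancing relation moves a power of `x` to `M_x`,
        -- where modularity makes it act trivially.
        intro g
        refine LinearMap.ext fun z => LinearMap.ext fun (m : C.component x) => ?_
        change balMk k M (n + 1) (tupleMap k (mulTuple · ((g : Subgroup.centralizer {x}) : G)⁻¹) z)
            m =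
          balMk k M (n + 1) z m
        rw [balMk_mulTuple]
        congr 1
        have h := (C.isTrivial_zpowersSelf x).out g⁻¹
        exact congrArg Subtype.val (LinearMap.congr_fun h m))))) (by
    intro g
    induction g using QuotientGroup.induction_on with
    | H g =>
      refine TensorProduct.ext' fun (m : C.component x) z => ?_
      obtain ⟨z, rfl⟩ := quotMk_surjective (zpowersSelf x) _ z
      change balMk k M (n + 1) (tupleMap k (mulTuple · (g : G)⁻¹) z)
        ((MonoidAlgebra.single (g : G) 1 : MonoidAlgebra k G) • (m : M)) = balMk k M (n + 1) z m
      refine (balMk_mulTuple (g : G)⁻¹ z _).trans ?_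
      rw [← mul_smul, MonoidAlgebra.single_mul_single, inv_mul_cancel, mul_one,
        ← MonoidAlgebra.one_def, one_smul])

lemma classIncl_coeffMk (n : ℕ) (m : C.component x) (z : (Fin (n + 1) → G) →₀ k) :
    classIncl C x n (coeffMk C x n m z) = balMk k M (n + 1) z (m : M) := rfl

lemma classIncl_d (n : ℕ) (i : Fin (n + 2)) (w) : classIncl C x n
    ((coeffPrecyclic k x (C.componentQuot x)).d n i w) = C.Z.d n i (classIncl C x (n + 1) w) := by
  induction w using coeff_induction with
  | h0 => simp
  | hadd a b ha hb => simp only [map_add, ha, hb]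
  | hmk m z =>
    rw [coeffPrecyclic_d_coeffMk, classIncl_coeffMk, classIncl_coeffMk]
    exact (faceZ_balMk i z (m : M)).symm

lemma classIncl_t (n : ℕ) (w) : classIncl C x n
    ((coeffPrecyclic k x (C.componentQuot x)).t n w) = C.Z.t n (classIncl C x n w) := by
  induction w using coeff_induction with
  | h0 => simp
  | hadd a b ha hb => simp only [map_add, ha, hb]
  | hmk m z =>
    rw [coeffPrecyclic_t_coeffMk, classIncl_coeffMk, classIncl_coeffMk]
    exact (C.tauZ_balMk z m.2).symm

variable {x} in
/-- Translation from `M_y` to `M_x` for `y = cxc⁻¹`. -/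
def transport {c y : G} (h : c * x * c⁻¹ = y) : C.component y →ₗ[k] C.component x :=
  (Algebra.lsmul k k M (MonoidAlgebra.single c⁻¹ 1 : MonoidAlgebra k G)).restrict fun m hm => by
    have h1 := C.single_smul_mem c⁻¹ y hm
    rwa [← h, show c⁻¹ * (c * x * c⁻¹) * c⁻¹⁻¹ = x by group] at h1

variable {x} in
lemma coe_transport {c y : G} (h : c * x * c⁻¹ = y) (m : C.component y) :
    (transport C h m : M) = (MonoidAlgebra.single c⁻¹ 1 : MonoidAlgebra k G) • (m : M) := rfl

variable {x} in
/-- The projection to the part of a conjugacy class on a homogeneous component. -/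
def classProjAux {c y : G} (h : c * x * c⁻¹ = y) (n : ℕ) :
    C.component y →ₗ[k] ((Fin (n + 1) → G) →₀ k) →ₗ[k]
      (coeffPrecyclic k x (C.componentQuot x)).obj n :=
  (coeffMk C x n ∘ₗ transport C h).compl₂ (tupleMap k (mulTuple · c))

variable {x} in
lemma classProjAux_apply {c y : G} (h : c * x * c⁻¹ = y) (n : ℕ) (m : C.component y)
    (z : (Fin (n + 1) → G) →₀ k) : classProjAux C h n m z =
      coeffMk C x n (transport C h m) (tupleMap k (mulTuple · c) z) := rfl

variable {x} in
-- Two conjugating elements differ by an element of the centralizer, which can be moved across the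
-- tensor.
lemma classProjAux_eq {c c' y : G} (h : c * x * c⁻¹ = y) (h' : c' * x * c'⁻¹ = y) (n : ℕ) :
    classProjAux C h n = classProjAux C h' n := by
  refine LinearMap.ext fun m => LinearMap.ext fun z => ?_
  have hg : c⁻¹ * c' ∈ Subgroup.centralizer {x} := by
    rw [Subgroup.mem_centralizer_singleton_iff]
    have h2 : c' * x * c'⁻¹ = c * x * c⁻¹ := h'.trans h.symm
    calc c⁻¹ * c' * x = c⁻¹ * (c' * x * c'⁻¹) * c' := by group
      _ = x * (c⁻¹ * c') := by rw [h2]; group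
  have e : transport C h m = C.componentRep x ⟨c⁻¹ * c', hg⟩ (transport C h' m) := by
    refine Subtype.ext ?_
    change (MonoidAlgebra.single c⁻¹ 1 : MonoidAlgebra k G) • (m : M) =
      (MonoidAlgebra.single (c⁻¹ * c') 1 : MonoidAlgebra k G) •
        (MonoidAlgebra.single c'⁻¹ 1 : MonoidAlgebra k G) • (m : M)
    rw [← mul_smul, MonoidAlgebra.single_mul_single, mul_one, mul_inv_cancel_right]
  rw [classProjAux_apply, classProjAux_apply, e, coeffMk_smul,
    ← LinearMap.comp_apply (tupleMap k _), tupleMap_comp]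
  congr 3
  funext u
  simp [mulTuple_mulTuple]

open Classical in
/-- The projection to the part of a conjugacy class before passing to balanced tensors. -/
def classProjLift (n : ℕ) : M →ₗ[k] ((Fin (n + 1) → G) →₀ k) →ₗ[k]
    (coeffPrecyclic k x (C.componentQuot x)).obj n :=
  C.lift fun y => if h : ∃ c, c * x * c⁻¹ = y then classProjAux C h.choose_spec n else 0

variable {x} in
lemma classProjLift_apply {c y : G} (h : c * x * c⁻¹ = y) (n : ℕ) (m : C.component y) :
    classProjLift C x n m = classProjAux C h n m := by
  have h' : ∃ c, c * x * c⁻¹ = y := ⟨c, h⟩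
  rw [classProjLift, C.lift_of_mem, dif_pos h', classProjAux_eq C _ h]

lemma classProjLift_eq_zero {y : G} (h : ¬ IsConj x y) (n : ℕ) (m : C.component y) :
    classProjLift C x n m = 0 := by
  rw [classProjLift, C.lift_of_mem, dif_neg (mt isConj_iff.2 h), LinearMap.zero_apply]

/-- If `c` conjugates `x` to `y` then `gc` conjugates `x` to `gyg⁻¹`. With this choice of
conjugating element both sides agree, so the projection respects the balancing relation. -/
lemma classProjLift_smul (n : ℕ) (g : G) (u : Fin (n + 1) → G) (m : M) :
    classProjLift C x n m (Finsupp.single (mulTuple u g) 1) =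
      classProjLift C x n ((MonoidAlgebra.single g 1 : MonoidAlgebra k G) • m)
        (Finsupp.single u 1) := by
  induction m using C.homogeneous_induction with
  | h0 => simp
  | hadd a b ha hb => simp only [map_add, smul_add, LinearMap.add_apply, ha, hb]
  | hom y m hm =>
    have hm' := C.single_smul_mem g y hm
    by_cases h : IsConj x y
    · obtain ⟨c, h⟩ := isConj_iff.1 h
      have h' : g * c * x * (g * c)⁻¹ = g * y * g⁻¹ := by rw [← h]; group
      have e1 := classProjLift_apply C h n ⟨m, hm⟩
      have e2 := classProjLift_apply C h' n ⟨_, hm'⟩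
      simp only at e1 e2
      rw [e1, e2, classProjAux_apply, classProjAux_apply, tupleMap_single, tupleMap_single,
        mulTuple_mulTuple]
      congr 2
      refine Subtype.ext ?_
      rw [coe_transport, coe_transport, ← mul_smul, MonoidAlgebra.single_mul_single, mul_one,
        mul_inv_rev, inv_mul_cancel_right]
    · have h' : ¬ IsConj x (g * y * g⁻¹) := fun h1 =>
        h (h1.trans (isConj_iff.2 ⟨g, rfl⟩ : IsConj y _).symm)
      have e1 := classProjLift_eq_zero C x h n ⟨m, hm⟩
      have e2 := classProjLift_eq_zero C x h' n ⟨_, hm'⟩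
      simp only at e1 e2
      rw [e1, e2]
      rfl

/-- The projection to the part of the cyclic object that belongs to the conjugacy class of `x`. -/
def classProj (n : ℕ) : C.Z.obj n →ₗ[k] (coeffPrecyclic k x (C.componentQuot x)).obj n :=
  balLift (classProjLift C x n).flip fun g u m => classProjLift_smul C x n g u m

variable {x} in
lemma classProj_balMk {c y : G} (h : c * x * c⁻¹ = y) (n : ℕ) (z : (Fin (n + 1) → G) →₀ k)
    (m : C.component y) : classProj C x n (balMk k M (n + 1) z (m : M)) =
      coeffMk C x n (transport C h m) (tupleMap k (mulTuple · c) z) := by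
  refine (balLift_balMk _ _ z (m : M)).trans ?_
  rw [LinearMap.flip_apply, classProjLift_apply C h, classProjAux_apply]

lemma classProj_balMk_eq_zero {y : G} (h : ¬ IsConj x y) (n : ℕ) (z : (Fin (n + 1) → G) →₀ k)
    {m : M} (hm : m ∈ C.component y) : classProj C x n (balMk k M (n + 1) z m) = 0 := by
  refine (balLift_balMk _ _ z m).trans ?_
  rw [LinearMap.flip_apply]
  exact LinearMap.congr_fun (classProjLift_eq_zero C x h n ⟨m, hm⟩) z

lemma classProj_classIncl (n : ℕ) (w) : classProj C x n (classIncl C x n w) = w := by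
  induction w using coeff_induction with
  | h0 => simp
  | hadd a b ha hb => simp only [map_add, ha, hb]
  | hmk m z =>
    have h : (1 : G) * x * 1⁻¹ = x := by group
    have e1 : (fun u : Fin (n + 1) → G => mulTuple u (1 : G)) = id := funext mulTuple_one
    have e2 : transport C h m = m := Subtype.ext (by
      rw [coe_transport, inv_one, ← MonoidAlgebra.one_def, one_smul])
    rw [classIncl_coeffMk, classProj_balMk C h, e1, e2, tupleMap_id, LinearMap.id_apply]

lemma classProj_classIncl_of_not_isConj {x y : G} (h : ¬ IsConj x y) (n : ℕ) (w) :
    classProj C x n (classIncl C y n w) = 0 := by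
  induction w using coeff_induction with
  | h0 => simp
  | hadd a b ha hb => simp only [map_add, ha, hb, add_zero]
  | hmk m z => rw [classIncl_coeffMk, classProj_balMk_eq_zero C x h n z m.2]

variable {x} in
-- The projection moves `c` from the tuple to `M` and the inclusion moves it back, by the balancing
-- relation.
lemma classIncl_classProj {y : G} (h : IsConj x y) (n : ℕ) (z : (Fin (n + 1) → G) →₀ k)
    {m : M} (hm : m ∈ C.component y) :
    classIncl C x n (classProj C x n (balMk k M (n + 1) z m)) = balMk k M (n + 1) z m := by
  obtain ⟨c, h⟩ := isConj_iff.1 h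
  refine (congrArg _ (classProj_balMk C h n z ⟨m, hm⟩)).trans ?_
  rw [classIncl_coeffMk, coe_transport, balMk_mulTuple, ← mul_smul,
    MonoidAlgebra.single_mul_single, mul_one, mul_inv_cancel, ← MonoidAlgebra.one_def, one_smul]

/-- A tensor with homogeneous second factor belongs to exactly one class. The form with all `t ⊇ s`
allows sums. -/
lemma exists_sum_classIncl {T : Set G} (hT : ∀ g : G, ∃! x : G, x ∈ T ∧ IsConj x g) (n : ℕ)
    (b : C.Z.obj n) : ∃ s : Finset T, ∀ t, s ⊆ t →
      b = ∑ x ∈ t, classIncl C (x : G) n (classProj C (x : G) n b) := by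
  classical
  induction b using C.bal_induction with
  | h0 =>
    exact ⟨∅, fun t _ => (Finset.sum_eq_zero fun (x : T) _ =>
      (classIncl C (x : G) n ∘ₗ classProj C (x : G) n).map_zero).symm⟩
  | hadd a b ha hb =>
    obtain ⟨s, hs⟩ := ha
    obtain ⟨s', hs'⟩ := hb
    refine ⟨s ∪ s', fun t ht => ?_⟩
    have e1 := hs t (Finset.union_subset_left ht)
    have e2 := hs' t (Finset.union_subset_right ht)
    refine (congrArg₂ (· + ·) e1 e2).trans ?_
    rw [← Finset.sum_add_distrib]
    exact Finset.sum_congr rfl fun x _ =>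
      ((congrArg _ (map_add (classProj C (x : G) n) a b)).trans (map_add _ _ _)).symm
  | hom z y m hm =>
    obtain ⟨x, ⟨hxT, hx⟩, huniq⟩ := hT y
    refine ⟨{⟨x, hxT⟩}, fun t ht => ?_⟩
    rw [Finset.sum_eq_single_of_mem ⟨x, hxT⟩ (ht (Finset.mem_singleton_self _)) fun x' _ hx' => ?_]
    · exact (classIncl_classProj C hx n z hm).symm
    · have h : ¬ IsConj (x' : G) y := fun h => hx' (Subtype.ext (huniq x' ⟨x'.2, h⟩))
      exact (congrArg _ (classProj_balMk_eq_zero C x' h n z hm)).trans (map_zero _)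

end ConjugacyComponent

/-! ### Cyclic homology of a direct sum -/

namespace PrecyclicModule

variable {k : Type u} [CommRing k] {Z : PrecyclicModule.{u, v} k} {W : PrecyclicModule.{u, w} k}
  (f : ∀ n, Z.obj n →ₗ[k] W.obj n)

/-- The map of total complexes induced by a family of linear maps. -/
def totMap (n : ℕ) : Z.Tot n →ₗ[k] W.Tot n :=
  LinearMap.pi fun q : Fin (n + 1) =>
    f q ∘ₗ LinearMap.proj (R := k) (φ := fun j : Fin (n + 1) => Z.obj j) q

variable {f} (hd : ∀ n i z, f n (Z.d n i z) = W.d n i (f (n + 1) z))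
  (ht : ∀ n z, f n (Z.t n z) = W.t n (f n z))

include hd in
lemma map_b_apply (n : ℕ) (z : Z.obj (n + 1)) : f n (Z.b n z) = W.b n (f (n + 1) z) := by
  simp only [b, LinearMap.sum_apply, LinearMap.smul_apply, map_sum, map_smul, hd]

include hd in
lemma map_b'_apply (n : ℕ) (z : Z.obj (n + 1)) : f n (Z.b' n z) = W.b' n (f (n + 1) z) := by
  simp only [b', LinearMap.sum_apply, LinearMap.smul_apply, map_sum, map_smul, hd]

include ht in
lemma map_sgnT_apply (n : ℕ) (z : Z.obj n) : f n (Z.sgnT n z) = W.sgnT n (f n z) := by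
  simp only [sgnT, LinearMap.smul_apply, map_smul, ht]

include ht in
lemma map_norm_apply (n : ℕ) (z : Z.obj n) : f n (Z.norm n z) = W.norm n (f n z) := by
  have h : ∀ (j : ℕ) (z : Z.obj n), f n ((Z.sgnT n ^ j) z) = (W.sgnT n ^ j) (f n z) := by
    intro j
    induction j with
    | zero => intro z; rfl
    | succ j ih =>
      intro z
      rw [pow_succ, pow_succ, Module.End.mul_apply, Module.End.mul_apply, ih,
        map_sgnT_apply ht]
  simp only [norm, LinearMap.sum_apply, map_sum, h]

include hd ht in
lemma totMap_totD (n : ℕ) (x : Z.Tot (n + 1)) :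
    totMap f n (Z.totD n x) = W.totD n (totMap f (n + 1) x) := by
  have hv : ∀ p q z, f q (Z.vert p q z) = W.vert p q (f (q + 1) z) := by
    intro p q z
    by_cases hp : Even p
    · rw [vert_even _ hp, vert_even _ hp, map_b_apply hd]
    · rw [vert_odd _ hp, vert_odd _ hp, LinearMap.neg_apply, LinearMap.neg_apply, map_neg,
        map_b'_apply hd]
  have hh : ∀ p q z, f q (Z.horiz p q z) = W.horiz p q (f q z) := by
    intro p q z
    by_cases hp : Even p
    · rw [horiz_even _ hp, horiz_even _ hp, map_norm_apply ht]
    · rw [horiz_odd _ hp, horiz_odd _ hp, LinearMap.sub_apply, LinearMap.sub_apply, map_sub,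
        map_sgnT_apply ht]
      rfl
  funext q
  exact (map_add (f q) _ _).trans (congrArg₂ (· + ·) (hv _ _ _) (hh _ _ _))

/-- Cyclic homology of a direct sum of precyclic modules. -/
lemma nonempty_HC_equiv_directSum_of_decomposition {ι : Type*} {Y : ι → PrecyclicModule.{u, w} k}
    (θ : ∀ i n, (Y i).obj n →ₗ[k] Z.obj n) (π : ∀ i n, Z.obj n →ₗ[k] (Y i).obj n)
    (hd : ∀ i n j z, θ i n ((Y i).d n j z) = Z.d n j (θ i (n + 1) z))
    (ht : ∀ i n z, θ i n ((Y i).t n z) = Z.t n (θ i n z))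
    (h1 : ∀ i n y, π i n (θ i n y) = y) (h2 : ∀ i j, i ≠ j → ∀ n y, π i n (θ j n y) = 0)
    (h3 : ∀ n x, ∃ s : Finset ι, ∀ t, s ⊆ t → x = ∑ i ∈ t, θ i n (π i n x)) (n : ℕ) :
    Nonempty (Z.HC n ≃ₗ[k] ⨁ i, (Y i).HC n) := by
  classical
  obtain ⟨e⟩ := nonempty_homology_equiv_directSum (X := Z.Tot) (d := Z.totD)
    (Y := fun i => (Y i).Tot) (d' := fun i => (Y i).totD) (fun i => totMap (θ i))
    (fun i => totMap (π i)) (fun i => totMap_totD (hd i) (ht i))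
    (fun i n y => funext fun q => h1 i q (y q))
    (fun i j hij n y => funext fun q => h2 i j hij q (y q))
    (fun n x => by
      -- One finite set of indices must serve all rows at once; the union over the finitely many
      -- rows does.
      choose s hs using fun q : Fin (n + 1) => h3 q (x q)
      refine ⟨Finset.univ.biUnion s, funext fun q => ?_⟩
      refine (hs q _ (Finset.subset_biUnion_of_mem s (Finset.mem_univ q))).trans ?_
      rw [Finset.sum_apply]
      rfl) n
  exact ⟨Z.HCEquiv n ≪≫ₗ e ≪≫ₗ DirectSum.congrLinearEquiv fun i => ((Y i).HCEquiv n).symm⟩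

end PrecyclicModule

/-! ### Decomposition over conjugacy classes -/

section Decomposition

variable {k G : Type u} [CommRing k] [Group G] {M : Type u} [AddCommGroup M] [Module k M]
  [Module (MonoidAlgebra k G) M] [IsScalarTower k (MonoidAlgebra k G) M]

/-- The cyclic homology of the group algebra is the direct sum of the parts of the conjugacy
classes. -/
lemma nonempty_HC_equiv_directSum_conjClasses (C : ModularCrossedModule k (MonoidAlgebra k G) M)
    {T : Set G} (hT : ∀ g : G, ∃! x : G, x ∈ T ∧ IsConj x g) (n : ℕ) :
    Nonempty (C.HC n ≃ₗ[k]
      ⨁ x : T, (coeffPrecyclic k (x : G) (C.componentQuot (x : G))).HC n) :=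
  PrecyclicModule.nonempty_HC_equiv_directSum_of_decomposition
    (fun x : T => classIncl C (x : G)) (fun x : T => classProj C (x : G))
    (fun x => classIncl_d C x) (fun x => classIncl_t C x) (fun x => classProj_classIncl C x)
    (fun x y hxy n w => classProj_classIncl_of_not_isConj C (fun h => hxy (Subtype.ext
      ((hT y).unique ⟨x.2, h⟩ ⟨y.2, IsConj.refl _⟩))) n w)
    (fun n b => exists_sum_classIncl C hT n b) n

lemma nonempty_directSum_equiv_prod {α : Type*} (T : Set α) (p : α → Prop) (W : α → Type v)
    [∀ x, AddCommGroup (W x)] [∀ x, Module k (W x)] :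
    Nonempty ((⨁ x : T, W x) ≃ₗ[k]
      (⨁ x : {x : α // x ∈ T ∧ p x}, W x) × (⨁ x : {x : α // x ∈ T ∧ ¬ p x}, W x)) := by
  classical
  let f : (⨁ x : T, W x) →ₗ[k]
      (⨁ x : {x : α // x ∈ T ∧ p x}, W x) × (⨁ x : {x : α // x ∈ T ∧ ¬ p x}, W x) :=
    DirectSum.toModule k T _ fun x =>
      if h : p x then LinearMap.inl k _ _ ∘ₗ DirectSum.lof k {x : α // x ∈ T ∧ p x}
        (fun x => W x) ⟨x, x.2, h⟩
      else LinearMap.inr k _ _ ∘ₗ DirectSum.lof k {x : α // x ∈ T ∧ ¬ p x}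
        (fun x => W x) ⟨x, x.2, h⟩
  let g₁ : (⨁ x : {x : α // x ∈ T ∧ p x}, W x) →ₗ[k] ⨁ x : T, W x :=
    DirectSum.toModule k _ _ fun x => DirectSum.lof k T (fun x => W x) ⟨x, x.2.1⟩
  let g₂ : (⨁ x : {x : α // x ∈ T ∧ ¬ p x}, W x) →ₗ[k] ⨁ x : T, W x :=
    DirectSum.toModule k _ _ fun x => DirectSum.lof k T (fun x => W x) ⟨x, x.2.1⟩
  have hf : ∀ (x : T) (h : p x) (w : W x), f (DirectSum.lof k T (fun x => W x) x w) =
      (DirectSum.lof k {x : α // x ∈ T ∧ p x} (fun x => W x) ⟨x, x.2, h⟩ w, 0) := by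
    intro x h w
    simp only [f, DirectSum.toModule_lof, dif_pos h]
    rfl
  have hf' : ∀ (x : T) (h : ¬ p x) (w : W x), f (DirectSum.lof k T (fun x => W x) x w) =
      (0, DirectSum.lof k {x : α // x ∈ T ∧ ¬ p x} (fun x => W x) ⟨x, x.2, h⟩ w) := by
    intro x h w
    simp only [f, DirectSum.toModule_lof, dif_neg h]
    rfl
  refine ⟨LinearEquiv.ofLinearMap f (LinearMap.coprod g₁ g₂) ?_ ?_⟩
  · refine LinearMap.prod_ext ?_ ?_
    · refine DirectSum.linearMap_ext k fun x => LinearMap.ext fun w => ?_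
      change f (g₁ (DirectSum.lof k _ _ x w) + g₂ 0) = (DirectSum.lof k _ _ x w, 0)
      rw [map_zero, add_zero, DirectSum.toModule_lof, hf _ x.2.2]
    · refine DirectSum.linearMap_ext k fun x => LinearMap.ext fun w => ?_
      change f (g₁ 0 + g₂ (DirectSum.lof k _ _ x w)) = (0, DirectSum.lof k _ _ x w)
      rw [map_zero, zero_add, DirectSum.toModule_lof, hf' _ x.2.2]
  · refine DirectSum.linearMap_ext k fun x => LinearMap.ext fun w => ?_
    change (g₁.coprod g₂) (f (DirectSum.lof k _ _ x w)) = DirectSum.lof k _ _ x w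
    by_cases h : p x
    · rw [hf x h, LinearMap.coprod_apply, map_zero, add_zero, DirectSum.toModule_lof]
    · rw [hf' x h, LinearMap.coprod_apply, map_zero, zero_add, DirectSum.toModule_lof]

end Decomposition

end CyclicHomology

end

/-! ### The decomposition of cyclic homology -/

theorem mainTheorem4 {k G M : Type u} [Field k] [CharZero k] [Group G] [AddCommGroup M]
    [Module k M] [Module (MonoidAlgebra k G) M] [IsScalarTower k (MonoidAlgebra k G) M]
    (C : CyclicHomology.ModularCrossedModule k (MonoidAlgebra k G) M)
    (T : Set G) (hT : ∀ g : G, ∃! x : G, x ∈ T ∧ IsConj x g) (n : ℕ) :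
    Nonempty (C.HC n ≃ₗ[k]
      (⨁ x : {x : G // x ∈ T ∧ IsOfFinOrder x}, ⨁ i : {i : ℕ // 2 * i ≤ n},
          groupHomology (C.componentQuot (x : G)) (n - 2 * i)) ×
        (⨁ x : {x : G // x ∈ T ∧ ¬ IsOfFinOrder x},
          groupHomology (C.componentQuot (x : G)) n)) := by
  classical
  obtain ⟨e⟩ := CyclicHomology.nonempty_HC_equiv_directSum_conjClasses C hT n
  obtain ⟨e'⟩ := CyclicHomology.nonempty_directSum_equiv_prod (k := k) T (fun x => IsOfFinOrder x)
    fun x => (CyclicHomology.coeffPrecyclic k x (C.componentQuot x)).HC n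
  have h₁ := fun x : {x : G // x ∈ T ∧ IsOfFinOrder x} =>
    CyclicHomology.nonempty_HC_coeffPrecyclic_equiv k (x : G) (C.componentQuot (x : G)) x.2.2 n
  have h₂ := fun x : {x : G // x ∈ T ∧ ¬ IsOfFinOrder x} =>
    CyclicHomology.nonempty_HC_coeffPrecyclic_equiv_of_not k (x : G) (C.componentQuot (x : G))
      x.2.2 n
  exact ⟨e ≪≫ₗ e' ≪≫ₗ LinearEquiv.prodCongr
    (DirectSum.congrLinearEquiv fun x => (h₁ x).some)
    (DirectSum.congrLinearEquiv fun x => (h₂ x).some)⟩
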